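/- Throughout, $\lambda$ is the security parameter, "polynomial" functions $\mathbb N\to\mathbb N$ are those bounded by a polynomial in $\lambda$, and negligible means $o(\lambda^{-c})$ for every $c$. Quantum polynomial-time (QPT) algorithms are families of polynomial-size generalized quantum circuits (ancillas initialized to zero, some outputs traced out) over a fixed set of unitary gates that contains $H$, $T$ and $\mathsf{CNOT}$; non-uniform QPT algorithms additionally receive an arbitrary polynomial-size quantum advice state. **Strong invertible PRI.** For an isometry $\mathcal I$ from $n$ to $n+m$ qubits let $\mathcal I^{-1}(X)=\mathbb E_U\,\mathrm{Tr}_{\mathsf{Aux}}(U^\dagger XU)$, where $U$ is a Haar random $(n+m)$-qubit unitary conditioned on $U|\psi\rangle|0^m\rangle=\mathcal I|\psi\rangle$ for all $|\psi\rangle$, and $\mathsf{Aux}$ is the last $m$ qubits. A pair of QPT algorithms $F,\mathsf{Inv}$ is a strong invertible adaptive $(n,n+m)$-pseudorandom isometry if for every $\lambda$ and $k\in\{0,1\}^\lambda$ there is an isometry $\mathcal I_k$ from $n(\lambda)$ to $n(\lambda)+m(\lambda)$ qubits such that $F(k,\cdot)$ implements $\mathcal I_k$ and $\mathsf{Inv}(k,\cdot)$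 implements $\mathcal I_k^{-1}$, and for every non-uniform QPT oracle algorithm $\mathcal A$ (which makes adaptive queries to both oracles), $$\Big|\Pr_{k\leftarrow\{0,1\}^\lambda}\big[\mathcal A^{F(k,\cdot),\mathsf{Inv}(k,\cdot)}=1\big]-\Pr_{\mathcal I}\big[\mathcal A^{\mathcal I(\cdot),\mathcal I^{-1}(\cdot)}=1\big]\Big|$$ is negligible, where $\mathcal I$ is a Haar random isometry (the first $2^n$ columns of a Haar random unitary). **Unforgeability.** Consider a MAC for $n$-qubit messages with uniform keys $k\in\{0,1\}^\lambda$, signing algorithm $\mathsf{Sign}(k,\cdot)$ and verification algorithm $\mathsf{Ver}(k,\cdot)$, which maps tags back to message states. Let $t,q$ be polynomial. In the game, a non-uniform QPT adversary sends pure $n$-qubit states $|\psi_1\rangle,\dots,|\psi_q\rangle$, receives $\mathsf{Sign}(k,|\psi_i\rangle)$ for $i=1,\dots,q$, and outputs $|\psi^*\rangle^{\otimes t}\otimes|\phi^*\rangle$ with $|\psi^*\rangle$ orthogonal to all $|\psi_i\rangle$ (the forgery may be chosen at random). It wins with the probability that the permutation test on $|\psi^*\rangle\langle\psi^*|^{\otimes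 t}\otimes\mathsf{Ver}(k,|\phi^*\rangle)$ outputs $1$; on a state $\rho$ of $t+1$ registers this is $\mathrm{Tr}(\Pi_{\mathsf{sym}}\rho)$, where $\Pi_{\mathsf{sym}}$ projects onto the span of all $|\psi\rangle^{\otimes(t+1)}$. The MAC is $(\mathsf{PermTest},t,\varepsilon)$-unforgeable if every such adversary wins with probability at most $\varepsilon(\lambda)$ for all sufficiently large $\lambda$. **Theorem.** There is an absolute constant $C>0$ such that the following holds. Let $n,m$ be polynomial with $2^{-n(\lambda)}$ negligible, let $(F,\mathsf{Inv})$ be a strong invertible adaptive $(n,n+m)$-pseudorandom isometry, and consider the MAC with $\mathsf{Sign}(k,\cdot)=F(k,\cdot)$ and $\mathsf{Ver}(k,\cdot)=\mathsf{Inv}(k,\cdot)$. Let $t=t(\lambda)$ be polynomial (for instance constant). Then 1. every non-uniform QPT adversary wins the above game with probability at most $\frac1{t+1}+\mathsf{negl}(\lambda)$; 2. if $t\ge1$, the MAC is $(\mathsf{PermTest},t,C/t)$-unforgeable. -/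

import Mathlib

open Filter MeasureTheory
open scoped Matrix ComplexOrder

noncomputable section

namespace PRIMac

/-! ### Asymptotics -/

/-- `f` is bounded by a polynomial in the security parameter. -/
def PolyBounded (f : ℕ → ℕ) : Prop := ∃ p : Polynomial ℕ, ∀ l, f l ≤ p.eval l

/-- `ε` is negligible: `l ^ c * ε l → 0` for every `c`. -/
def Negligible (ε : ℕ → ℝ) : Prop :=
  Asymptotics.SuperpolynomialDecay atTop (fun l : ℕ => (l : ℝ)) ε

/-! ### Registers of qubits

A register is a finite type `Q` of qubit labels. Its computational basis is `Q → Bool`. -/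

/-- Vectors of a register. -/
abbrev Ket (Q : Type) [Fintype Q] [DecidableEq Q] := EuclideanSpace ℂ (Q → Bool)

/-- Operators on a register. -/
abbrev Op (Q : Type) := Matrix (Q → Bool) (Q → Bool) ℂ

/-- Density operators. -/
def IsDensity {Q : Type} [Fintype Q] [DecidableEq Q] (ρ : Op Q) : Prop := ρ.PosSemidef ∧ ρ.trace = 1

/-- The operator `|ψ⟩⟨ψ|`. -/
def pureState {Q : Type} [Fintype Q] [DecidableEq Q] (ψ : Ket Q) : Op Q := Matrix.of fun x y => ψ x * star (ψ y)

open Classical in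
/-- The operator `|k⟩⟨k|` of a computational basis state. -/
def basisState {Q : Type} (k : Q → Bool) : Op Q :=
  Matrix.of fun x y => if x = k ∧ y = k then 1 else 0

/-- Tensor product of operators on two registers. -/
def tensor {P Q : Type} (A : Op P) (B : Op Q) : Op (P ⊕ Q) :=
  Matrix.of fun x y => A (x ∘ Sum.inl) (y ∘ Sum.inl) * B (x ∘ Sum.inr) (y ∘ Sum.inr)

/-- Tensor product `ρ₀ ⊗ ⋯ ⊗ ρ_{q-1}` of operators on `q` registers of `n` qubits. -/
def tensorFamily {q n : ℕ} (ρ : Fin q → Op (Fin n)) : Op (Fin q × Fin n) :=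
  Matrix.of fun x y => ∏ i, ρ i (fun j => x (i, j)) (fun j => y (i, j))

/-- The map `Φ ⊗ id`, where `Φ` acts on the qubits selected by `e`. -/
def applyOn {A Q : Type} (e : A ↪ Q) (Φ : Op A → Op A) (X : Op Q) : Op Q :=
  Matrix.of fun x y => Φ (Matrix.of fun a b => X (Function.extend e a x) (Function.extend e b y)) (x ∘ e) (y ∘ e)

/-- The map `id ⊗ Φ` on a bipartite register. -/
def applyRight {P A B : Type} (Φ : Op A → Op B) (X : Op (P ⊕ A)) : Op (P ⊕ B) :=
  Matrix.of fun x y => Φ (Matrix.of fun a b => X (Sum.elim (x ∘ Sum.inl) a) (Sum.elim (y ∘ Sum.inl) b))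
    (x ∘ Sum.inr) (y ∘ Sum.inr)

open Classical in
/-- Partial trace over all qubits that are not selected by `e`. -/
def reduce {A Q : Type} [Fintype Q] [DecidableEq Q] (e : A ↪ Q) (X : Op Q) : Op A :=
  Matrix.of fun a b => ∑ x : Q → Bool, if x ∘ e = a then X x (Function.extend e b x) else 0

open Classical in
/-- The operator on `Q` that is `X` on the qubits selected by `e` and `|0⟩⟨0|` on all others. -/
def initZero {A Q : Type} (e : A ↪ Q) (X : Op A) : Op Q :=
  Matrix.of fun x y => if ∀ i, i ∉ Set.range e → x i = false ∧ y i = false then X (x ∘ e) (y ∘ e) else 0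

/-! ### Quantum circuits -/

/-- The Hadamard gate. -/
def hadamard : Op (Fin 1) :=
  Matrix.of fun x y => ((Real.sqrt 2 : ℝ) : ℂ)⁻¹ * (if x 0 = true ∧ y 0 = true then -1 else 1)

/-- The gate `T = diag (1, exp (iπ/4))`. -/
def tGate : Op (Fin 1) :=
  Matrix.of fun x y => if x = y then (if x 0 = true then Complex.exp (Complex.I * Real.pi / 4) else 1) else 0

/-- The controlled-not gate, with control qubit `0` and target qubit `1`. -/
def cnot : Op (Fin 2) :=
  Matrix.of fun x y => if x 0 = y 0 ∧ x 1 = xor (y 0) (y 1) then 1 else 0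

/-- A gate set: a set of unitary gates that contains the universal set consisting of
`H`, `T` and `CNOT`. -/
structure GateSet where
  gates : Set (Σ a : ℕ, Op (Fin a))
  unitary : ∀ g ∈ gates, g.2 ∈ Matrix.unitaryGroup (Fin g.1 → Bool) ℂ
  hadamard_mem : (⟨1, hadamard⟩ : Σ a : ℕ, Op (Fin a)) ∈ gates
  tGate_mem : (⟨1, tGate⟩ : Σ a : ℕ, Op (Fin a)) ∈ gates
  cnot_mem : (⟨2, cnot⟩ : Σ a : ℕ, Op (Fin a)) ∈ gates

/-- A gate of the gate set placed on distinct wires out of `w` wires. -/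
structure Gate (𝒢 : GateSet) (w : ℕ) where
  op : Σ a : ℕ, Op (Fin a)
  mem : op ∈ 𝒢.gates
  wires : Fin op.1 ↪ Fin w

/-- The channel `X ↦ U X U†` of a gate. -/
def Gate.run {𝒢 : GateSet} {w : ℕ} (g : Gate 𝒢 w) : Op (Fin w) → Op (Fin w) :=
  applyOn g.wires fun X => g.op.2 * X * g.op.2ᴴ

/-- A generalized quantum circuit: the wires outside the range of `inp` are initialized to zero,
and the wires outside the range of `out` are traced out at the end. -/
structure Circuit (𝒢 : GateSet) (I O : Type) where
  wires : ℕ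
  gates : List (Gate 𝒢 wires)
  inp : I ↪ Fin wires
  out : O ↪ Fin wires

/-- The size of a circuit: number of gates plus number of wires. -/
def Circuit.size {𝒢 : GateSet} {I O : Type} (C : Circuit 𝒢 I O) : ℕ :=
  C.gates.length + C.wires

/-- The channel implemented by a circuit. -/
def Circuit.run {𝒢 : GateSet} {I O : Type} (C : Circuit 𝒢 I O) (X : Op I) : Op O :=
  reduce C.out (C.gates.foldl (fun Y g => g.run Y) (initZero C.inp X))

/-- A quantum polynomial-time algorithm that takes a key of `l` bits and a state of `a l` qubits,
and outputs a state of `b l` qubits, where `l` is the security parameter. -/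
structure KeyedAlg (𝒢 : GateSet) (a b : ℕ → ℕ) where
  circ : ∀ l, Circuit 𝒢 (Fin l ⊕ Fin (a l)) (Fin (b l))
  poly : PolyBounded fun l => (circ l).size

/-- The channel implemented by a keyed algorithm for the key `k`. -/
def KeyedAlg.run {𝒢 : GateSet} {a b : ℕ → ℕ} (F : KeyedAlg 𝒢 a b) (l : ℕ) (k : Fin l → Bool)
    (X : Op (Fin (a l))) : Op (Fin (b l)) :=
  (F.circ l).run (tensor (basisState k) X)

/-! ### Haar measure, Haar isometries and their inverses -/

instance (ι : Type) [Fintype ι] [DecidableEq ι] : CompactSpace (Matrix.unitaryGroup ι ℂ) := by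
  rw [← isCompact_univ_iff, Subtype.isCompact_iff, Set.image_univ, Subtype.range_coe_subtype]
  have h : IsCompact {f : ι → ι → ℂ | ∀ i j, f i j ∈ Metric.closedBall (0 : ℂ) 1} := by
    have := isCompact_univ_pi fun _ : ι => isCompact_univ_pi fun _ : ι =>
      isCompact_closedBall (0 : ℂ) 1
    simpa only [Set.pi, Set.mem_univ, true_imp_iff, Set.mem_ofPred_eq] using this
  have hK : IsCompact {M : Matrix ι ι ℂ | ∀ i j, M i j ∈ Metric.closedBall (0 : ℂ) 1} := h
  refine hK.of_isClosed_subset ?_ ?_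
  · simp only [Matrix.mem_unitaryGroup_iff]
    exact isClosed_eq (by fun_prop) continuous_const
  · intro U hU i j
    simpa using entry_norm_bound_of_unitary hU i j

instance (ι : Type) [Fintype ι] [DecidableEq ι] : MeasurableSpace (Matrix.unitaryGroup ι ℂ) := borel _

instance (ι : Type) [Fintype ι] [DecidableEq ι] : BorelSpace (Matrix.unitaryGroup ι ℂ) := ⟨rfl⟩

/-- The Haar probability measure on the unitary group. -/
def haarUnitary (ι : Type) [Fintype ι] [DecidableEq ι] : Measure (Matrix.unitaryGroup ι ℂ) :=
  Measure.haarMeasure ⊤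

/-- The last `m` qubits (the register `Aux`) of a basis state are all zero. -/
def AuxZero {n m : ℕ} (x : Fin (n + m) → Bool) : Prop := ∀ j, x (Fin.natAdd n j) = false

instance {n m : ℕ} : DecidablePred (AuxZero (n := n) (m := m)) :=
  fun x => inferInstanceAs (Decidable (∀ j, x (Fin.natAdd n j) = false))

/-- Partial trace over the last `m` qubits. -/
def traceAux {n m : ℕ} (X : Op (Fin (n + m))) : Op (Fin n) :=
  Matrix.of fun a b => ∑ z : Fin m → Bool, X (Fin.append a z) (Fin.append b z)

/-- The operator `X ⊗ |0ᵐ⟩⟨0ᵐ|`. -/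
def withAux {n m : ℕ} (X : Op (Fin n)) : Op (Fin (n + m)) :=
  Matrix.of fun x y => if AuxZero x ∧ AuxZero y then X (x ∘ Fin.castAdd m) (y ∘ Fin.castAdd m) else 0

/-- The map `ψ ↦ U (ψ ⊗ 0ᵐ)`, that is, the first `2ⁿ` columns of `U`. -/
def isoOf {n m : ℕ} (U : Op (Fin (n + m))) :
    Matrix (Fin (n + m) → Bool) (Fin n → Bool) ℂ :=
  Matrix.of fun x y => U x (Fin.append y fun _ => false)

/-- The unitary that is the identity on the states `ψ ⊗ 0ᵐ` and acts as `S` on the orthogonal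
complement of these states. -/
def extendById {n m : ℕ}
    (S : Matrix.unitaryGroup {x : Fin (n + m) → Bool // ¬ AuxZero x} ℂ) : Op (Fin (n + m)) :=
  Matrix.of fun x y => if h : ¬ AuxZero x ∧ ¬ AuxZero y then S.1 ⟨x, h.1⟩ ⟨y, h.2⟩
    else if x = y then 1 else 0

open Classical in
/-- The inverse channel of an isometry `V`: the average of `Tr_Aux (U† X U)` over a Haar random
unitary `U` conditioned on being consistent with `V`, i.e. on `U (ψ ⊗ 0ᵐ) = V ψ` for all `ψ`.
The conditioned measure is the law of `U₀ (1 ⊕ S)`, where `U₀` is any consistent unitary and `S` is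
Haar distributed on the unitaries of the orthogonal complement of all `ψ ⊗ 0ᵐ`; by invariance
it does not depend on `U₀`. -/
def inverseIso {n m : ℕ} (V : Matrix (Fin (n + m) → Bool) (Fin n → Bool) ℂ)
    (X : Op (Fin (n + m))) : Op (Fin n) :=
  if h : ∃ U₀ ∈ Matrix.unitaryGroup (Fin (n + m) → Bool) ℂ, isoOf U₀ = V then
    Matrix.of fun a b => ∫ S, traceAux ((h.choose * extendById S)ᴴ * X * (h.choose * extendById S)) a b
      ∂haarUnitary {x : Fin (n + m) → Bool // ¬ AuxZero x}
  else 0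

/-! ### Distinguishers with oracle access to an isometry and its inverse -/

/-- A pair of oracles, from `n` to `n + m` qubits and back. -/
structure Oracles (n m : ℕ) where
  fwd : Op (Fin n) → Op (Fin (n + m))
  bwd : Op (Fin (n + m)) → Op (Fin n)

/-- A step of an oracle circuit on `w` wires: a gate, a query to the forward oracle, or a query to
the inverse oracle. A forward query consumes the first `n` of `n + m` wires, discards the last `m`
of them, and returns its output on all of them; an inverse query consumes the `n + m` wires,
returns its output on the first `n` of them and resets the last `m` to zero. -/
inductive OracleStep (𝒢 : GateSet) (n m w : ℕ) where
  | gate (g : Gate 𝒢 w)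
  | fwd (e : Fin (n + m) ↪ Fin w)
  | bwd (e : Fin (n + m) ↪ Fin w)

/-- The channel of a step. -/
def OracleStep.run {𝒢 : GateSet} {n m w : ℕ} (O : Oracles n m) :
    OracleStep 𝒢 n m w → Op (Fin w) → Op (Fin w)
  | .gate g => g.run
  | .fwd e => applyOn e fun X => O.fwd (traceAux X)
  | .bwd e => applyOn e fun X => withAux (O.bwd X)

/-- A non-uniform quantum polynomial-time oracle algorithm that outputs a bit. The advice is the
initial state of all wires (ancillas included). -/
structure Distinguisher (𝒢 : GateSet) (n m : ℕ → ℕ) where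
  wires : ℕ → ℕ
  advice : ∀ l, Op (Fin (wires l))
  advice_density : ∀ l, IsDensity (advice l)
  steps : ∀ l, List (OracleStep 𝒢 (n l) (m l) (wires l))
  out : ∀ l, Fin (wires l)
  poly : PolyBounded fun l => (steps l).length + wires l

/-- Probability that the output wire is measured as `1`. -/
def Distinguisher.prob {𝒢 : GateSet} {n m : ℕ → ℕ} (D : Distinguisher 𝒢 n m) (l : ℕ)
    (O : Oracles (n l) (m l)) : ℝ :=
  let ρ := (D.steps l).foldl (fun X s => s.run O X) (D.advice l)
  ∑ x : Fin (D.wires l) → Bool, if x (D.out l) = true then (ρ x x).re else 0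

/-- The oracles `X ↦ V X V†` and the inverse channel of `V`. -/
def isoOracles {n m : ℕ} (V : Matrix (Fin (n + m) → Bool) (Fin n → Bool) ℂ) : Oracles n m where
  fwd X := V * X * Vᴴ
  bwd := inverseIso V

/-- Probability of output `1` with oracles `F(k, ·)`, `Inv(k, ·)` for a uniform key `k`. -/
def Distinguisher.realProb {𝒢 : GateSet} {n m : ℕ → ℕ} (D : Distinguisher 𝒢 n m)
    (F : KeyedAlg 𝒢 n fun l => n l + m l) (Inv : KeyedAlg 𝒢 (fun l => n l + m l) n)
    (l : ℕ) : ℝ :=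
  (∑ k : Fin l → Bool, D.prob l ⟨F.run l k, Inv.run l k⟩) / 2 ^ l

/-- Probability of output `1` with a Haar random isometry and its inverse as oracles. -/
def Distinguisher.haarProb {𝒢 : GateSet} {n m : ℕ → ℕ} (D : Distinguisher 𝒢 n m) (l : ℕ) : ℝ :=
  ∫ U, D.prob l (isoOracles (isoOf U.1)) ∂haarUnitary (Fin (n l + m l) → Bool)

/-- `(F, Inv)` is a strong invertible adaptive `(n, n + m)`-pseudorandom isometry. -/
structure IsStrongInvertiblePRI {𝒢 : GateSet} {n m : ℕ → ℕ}
    (F : KeyedAlg 𝒢 n fun l => n l + m l) (Inv : KeyedAlg 𝒢 (fun l => n l + m l) n) : Prop where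
  isometry : ∀ (l : ℕ) (k : Fin l → Bool),
    ∃ V : Matrix (Fin (n l + m l) → Bool) (Fin (n l) → Bool) ℂ, Vᴴ * V = 1 ∧
      (∀ X, F.run l k X = V * X * Vᴴ) ∧ ∀ X, Inv.run l k X = inverseIso V X
  security : ∀ D : Distinguisher 𝒢 n m,
    Negligible fun l => |D.realProb F Inv l - D.haarProb l|

/-! ### The permutation test -/

/-- The symmetric subspace of `(ℂ^d)^{⊗ s}`, spanned by the tensor powers `ψ^{⊗ s}`. -/
def symSubspace (d : Type) [Fintype d] (s : ℕ) : Submodule ℂ (EuclideanSpace ℂ (Fin s → d)) :=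
  Submodule.span ℂ {v | ∃ ψ : EuclideanSpace ℂ d, ∀ x, v x = ∏ i, ψ (x i)}

/-- The matrix of the orthogonal projection onto the symmetric subspace. -/
def symProj (d : Type) [Fintype d] [DecidableEq d] (s : ℕ) : Matrix (Fin s → d) (Fin s → d) ℂ :=
  Matrix.of fun x y => (symSubspace d s).starProjection (EuclideanSpace.single y 1) x

/-- Probability `Tr (Π_sym ρ)` that the permutation test on `ρ` outputs `1`. -/
def permTestProb {d : Type} [Fintype d] [DecidableEq d] {s : ℕ} (ρ : Matrix (Fin s → d) (Fin s → d) ℂ) : ℝ :=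
  (symProj d s * ρ).trace.re

/-- View an operator on `t` registers and one further register, all of `n` qubits, as an operator
on `(ℂ^(2ⁿ))^{⊗ (t+1)}`. -/
def collect {t n : ℕ} (X : Op ((Fin t × Fin n) ⊕ Fin n)) :
    Matrix (Fin (t + 1) → Fin n → Bool) (Fin (t + 1) → Fin n → Bool) ℂ :=
  Matrix.of fun x y => X (Sum.elim (fun p => x p.1.castSucc p.2) (x (Fin.last t)))
    (Sum.elim (fun p => y p.1.castSucc p.2) (y (Fin.last t)))

/-! ### Message authentication codes for quantum messages -/

/-- A MAC for quantum messages, with keys uniform in `{0,1}^l`: signing maps messages of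
`msgLen l` qubits to tags of `tagLen l` qubits, verification maps tags back to messages. -/
structure QMAC (𝒢 : GateSet) where
  msgLen : ℕ → ℕ
  tagLen : ℕ → ℕ
  sign : KeyedAlg 𝒢 msgLen tagLen
  ver : KeyedAlg 𝒢 tagLen msgLen

/-- The MAC built from a pseudorandom isometry: sign by `F`, verify by `Inv`. -/
def priMAC {𝒢 : GateSet} {n m : ℕ → ℕ} (F : KeyedAlg 𝒢 n fun l => n l + m l)
    (Inv : KeyedAlg 𝒢 (fun l => n l + m l) n) : QMAC 𝒢 where
  msgLen := n
  tagLen := fun l => n l + m l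
  sign := F
  ver := Inv

/-- The forgeries `|ψ*⟩⟨ψ*|^{⊗ t} ⊗ |φ*⟩⟨φ*|` with `ψ*` orthogonal to all queried messages. -/
def forgeries {q n s : ℕ} (t : ℕ) (msg : Fin q → Ket (Fin n)) :
    Set (Op ((Fin t × Fin n) ⊕ Fin s)) :=
  {X | ∃ (ψ : Ket (Fin n)) (φ : Ket (Fin s)), ‖ψ‖ = 1 ∧ ‖φ‖ = 1 ∧ (∀ i, inner ℂ (msg i) ψ = 0) ∧
    X = tensor (tensorFamily fun _ => pureState ψ) (pureState φ)}

/-- A non-uniform quantum polynomial-time adversary in the unforgeability game with `t` copies of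
the forged message and a single tag. The first stage runs on the advice state and sends the pure
messages `msg l i`, keeping a memory; the second stage runs on the tags of these messages and the
memory and outputs a forgery, possibly chosen at random. -/
structure Forger {𝒢 : GateSet} (M : QMAC 𝒢) (t : ℕ → ℕ) where
  queries : ℕ → ℕ
  queries_poly : PolyBounded queries
  adviceLen : ℕ → ℕ
  advice : ∀ l, Op (Fin (adviceLen l))
  advice_density : ∀ l, IsDensity (advice l)
  memLen : ℕ → ℕ
  stage1 : ∀ l, Circuit 𝒢 (Fin (adviceLen l)) ((Fin (queries l) × Fin (M.msgLen l)) ⊕ Fin (memLen l))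
  stage1_poly : PolyBounded fun l => (stage1 l).size
  stage2 : ∀ l, Circuit 𝒢 ((Fin (queries l) × Fin (M.tagLen l)) ⊕ Fin (memLen l))
    ((Fin (t l) × Fin (M.msgLen l)) ⊕ Fin (M.tagLen l))
  stage2_poly : PolyBounded fun l => (stage2 l).size
  msg : ∀ l, Fin (queries l) → Ket (Fin (M.msgLen l))
  msg_norm : ∀ l i, ‖msg l i‖ = 1
  mem : ∀ l, Op (Fin (memLen l))
  sends : ∀ l, (stage1 l).run (advice l)
    = tensor (tensorFamily fun i => pureState (msg l i)) (mem l)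
  forges : ∀ (l : ℕ) (k : Fin l → Bool),
    (stage2 l).run (tensor (tensorFamily fun i => M.sign.run l k (pureState (msg l i))) (mem l))
      ∈ convexHull ℝ (forgeries (t l) (msg l))

/-- The state output by the adversary when the key is `k`. -/
def Forger.output {𝒢 : GateSet} {M : QMAC 𝒢} {t : ℕ → ℕ} (A : Forger M t) (l : ℕ)
    (k : Fin l → Bool) : Op ((Fin (t l) × Fin (M.msgLen l)) ⊕ Fin (M.tagLen l)) :=
  (A.stage2 l).run
    (tensor (tensorFamily fun i => M.sign.run l k (pureState (A.msg l i))) (A.mem l))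

/-- The probability that the adversary wins: for a uniform key, the permutation test on the `t`
message copies and the verified tag outputs `1`. -/
def Forger.winProb {𝒢 : GateSet} {M : QMAC 𝒢} {t : ℕ → ℕ} (A : Forger M t) (l : ℕ) : ℝ :=
  (∑ k : Fin l → Bool, permTestProb (collect (applyRight (M.ver.run l k) (A.output l k)))) / 2 ^ l

/-- `(PermTest, t, ε)`-unforgeability. -/
def PermTestUnforgeable {𝒢 : GateSet} (M : QMAC 𝒢) (t : ℕ → ℕ) (ε : ℕ → ℝ) : Prop :=
  ∀ A : Forger M t, ∀ᶠ l in atTop, A.winProb l ≤ ε l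

end PRIMac

end

set_option linter.unusedSectionVars false

namespace PRIMac

section Registers

variable {A B P Q R : Type} [Fintype A] [DecidableEq A] [Fintype B] [DecidableEq B]
  [Fintype P] [DecidableEq P] [Fintype Q] [DecidableEq Q] [Fintype R] [DecidableEq R]

/-- The qubits that are not selected by `e`. -/
abbrev Rest (e : A ↪ Q) : Type := {i : Q // i ∉ Set.range e}

open Classical in
/-- The qubits of `Q` are the selected ones and the remaining ones. -/
noncomputable def splitEquiv (e : A ↪ Q) : A ⊕ Rest e ≃ Q :=
  ((Equiv.ofInjective e e.injective).sumCongr (Equiv.refl _)).trans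
    (Equiv.Set.sumCompl (Set.range e))

/-- A basis state of `Q` consists of the selected bits and the remaining bits. -/
noncomputable def glue (e : A ↪ Q) : (A → Bool) × (Rest e → Bool) ≃ (Q → Bool) :=
  (Equiv.sumArrowEquivProdArrow A (Rest e) Bool).symm.trans
    (Equiv.arrowCongr (splitEquiv e) (Equiv.refl Bool))

@[simp] lemma glue_apply_emb (e : A ↪ Q) (p : (A → Bool) × (Rest e → Bool)) (a : A) :
    glue e p (e a) = p.1 a := by
  have : (splitEquiv e).symm (e a) = Sum.inl a := by
    rw [Equiv.symm_apply_eq]; rfl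
  simp only [glue, Equiv.trans_apply, Equiv.arrowCongr_apply, Function.comp_apply, this]
  rfl

@[simp] lemma glue_apply_rest (e : A ↪ Q) (p : (A → Bool) × (Rest e → Bool)) (i : Rest e) :
    glue e p i.1 = p.2 i := by
  have : (splitEquiv e).symm i.1 = Sum.inr i := by
    rw [Equiv.symm_apply_eq]; rfl
  simp only [glue, Equiv.trans_apply, Equiv.arrowCongr_apply, Function.comp_apply, this]
  rfl

@[simp] lemma glue_comp (e : A ↪ Q) (p : (A → Bool) × (Rest e → Bool)) : glue e p ∘ e = p.1 := by
  ext a; simp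

lemma eq_glue (e : A ↪ Q) (x : Q → Bool) (p : (A → Bool) × (Rest e → Bool))
    (h1 : ∀ a, x (e a) = p.1 a) (h2 : ∀ i : Rest e, x i.1 = p.2 i) : x = glue e p := by
  ext i
  by_cases h : i ∈ Set.range e
  · obtain ⟨a, rfl⟩ := h; simp [h1]
  · rw [h2 ⟨i, h⟩, glue_apply_rest e p ⟨i, h⟩]

@[simp] lemma extend_glue (e : A ↪ Q) (b : A → Bool) (p : (A → Bool) × (Rest e → Bool)) :
    Function.extend e b (glue e p) = glue e (b, p.2) := by
  apply eq_glue
  · intro a; simp [e.injective.extend_apply]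
  · intro i
    rw [Function.extend_apply' _ _ _ (fun h => i.2 h)]; simp

lemma sum_glue (e : A ↪ Q) {M : Type*} [AddCommMonoid M] (f : (Q → Bool) → M) :
    ∑ x, f x = ∑ r, ∑ a, f (glue e (a, r)) := by
  classical
  rw [← (glue e).sum_comp, Fintype.sum_prod_type, Finset.sum_comm]

@[simp] lemma applyOn_glue (e : A ↪ Q) (Φ : Op A → Op A) (X : Op Q)
    (p p' : (A → Bool) × (Rest e → Bool)) :
    applyOn e Φ X (glue e p) (glue e p')
      = Φ (Matrix.of fun a b => X (glue e (a, p.2)) (glue e (b, p'.2))) p.1 p'.1 := by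
  simp [applyOn]

lemma reduce_apply (e : A ↪ Q) (X : Op Q) (a b : A → Bool) :
    reduce e X a b = ∑ r, X (glue e (a, r)) (glue e (b, r)) := by
  classical
  simp [reduce, sum_glue e]

open Classical in
lemma initZero_glue (e : A ↪ Q) (X : Op A) (p p' : (A → Bool) × (Rest e → Bool)) :
    initZero e X (glue e p) (glue e p') =
      X p.1 p'.1 * basisState (fun _ => false) p.2 p'.2 := by
  have : (∀ i, i ∉ Set.range e → glue e p i = false ∧ glue e p' i = false) ↔
      (p.2 = fun _ => false) ∧ p'.2 = fun _ => false := by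
    constructor
    · intro h
      constructor <;> ext i
      · simpa using (h i.1 i.2).1
      · simpa using (h i.1 i.2).2
    · rintro ⟨h1, h2⟩ i hi
      have := glue_apply_rest e p ⟨i, hi⟩
      have := glue_apply_rest e p' ⟨i, hi⟩
      simp_all
  simp only [initZero, Matrix.of_apply, this, basisState, glue_comp, mul_ite, mul_one, mul_zero]

/-- Two operators agree if they agree in the coordinates given by `glue`. -/
lemma op_ext (e : A ↪ Q) {X Y : Op Q}
    (h : ∀ p p', X (glue e p) (glue e p') = Y (glue e p) (glue e p')) : X = Y := by
  ext x y
  obtain ⟨p, rfl⟩ := (glue e).surjective x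
  obtain ⟨p', rfl⟩ := (glue e).surjective y
  exact h p p'

/-! ### Linearity -/

lemma isLinearMap_applyOn (e : A ↪ Q) {Φ : Op A → Op A} (hΦ : IsLinearMap ℂ Φ) :
    IsLinearMap ℂ (applyOn e Φ) where
  map_add X Y := by
    ext x y
    simp only [applyOn, Matrix.of_apply, Matrix.add_apply]
    rw [← Matrix.add_apply, ← hΦ.map_add]; rfl
  map_smul c X := by
    ext x y
    simp only [applyOn, Matrix.of_apply, Matrix.smul_apply]
    rw [← Matrix.smul_apply, ← hΦ.map_smul]; rfl

lemma isLinearMap_applyRight {Φ : Op A → Op B} (hΦ : IsLinearMap ℂ Φ) :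
    IsLinearMap ℂ (applyRight (P := P) Φ) where
  map_add X Y := by
    ext x y
    simp only [applyRight, Matrix.of_apply, Matrix.add_apply]
    rw [← Matrix.add_apply, ← hΦ.map_add]; rfl
  map_smul c X := by
    ext x y
    simp only [applyRight, Matrix.of_apply, Matrix.smul_apply]
    rw [← Matrix.smul_apply, ← hΦ.map_smul]; rfl

lemma isLinearMap_reduce (e : A ↪ Q) : IsLinearMap ℂ (reduce e) where
  map_add X Y := by ext a b; simp [reduce_apply, Finset.sum_add_distrib]
  map_smul c X := by ext a b; simp [reduce_apply, Finset.mul_sum]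

lemma isLinearMap_initZero (e : A ↪ Q) : IsLinearMap ℂ (initZero e) where
  map_add X Y := by ext x y; simp only [initZero, Matrix.of_apply, Matrix.add_apply]; split_ifs <;> simp
  map_smul c X := by ext x y; simp [initZero]

lemma isLinearMap_tensor_right (X : Op A) : IsLinearMap ℂ (tensor (Q := B) X) where
  map_add Y Z := by ext x y; simp [tensor, mul_add]
  map_smul c Y := by ext x y; simp [tensor]; ring

lemma isLinearMap_conj {ι κ : Type} [Fintype ι] [Fintype κ] (K : Matrix ι κ ℂ) :
    IsLinearMap ℂ fun X : Matrix κ κ ℂ => K * X * Kᴴ where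
  map_add X Y := by simp [Matrix.mul_add, Matrix.add_mul]
  map_smul c X := by simp

lemma isLinearMap_gate_run {𝒢 : GateSet} {w : ℕ} (g : Gate 𝒢 w) : IsLinearMap ℂ g.run :=
  isLinearMap_applyOn _ (isLinearMap_conj _)

lemma isLinearMap_foldl_run {𝒢 : GateSet} {w : ℕ} (L : List (Gate 𝒢 w)) :
    IsLinearMap ℂ fun X => L.foldl (fun Y g => g.run Y) X := by
  induction L with
  | nil => exact ⟨fun _ _ => rfl, fun _ _ => rfl⟩
  | cons g L ih =>
    constructor
    · intro X Y
      simp only [List.foldl_cons, (isLinearMap_gate_run g).map_add]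
      exact ih.map_add _ _
    · intro c X
      simp only [List.foldl_cons, (isLinearMap_gate_run g).map_smul]
      exact ih.map_smul _ _

lemma isLinearMap_circuit_run {𝒢 : GateSet} (C : Circuit 𝒢 A B) : IsLinearMap ℂ C.run where
  map_add X Y := by
    simp only [Circuit.run, (isLinearMap_initZero _).map_add, (isLinearMap_foldl_run _).map_add,
      (isLinearMap_reduce _).map_add]
  map_smul c X := by
    simp only [Circuit.run, (isLinearMap_initZero _).map_smul, (isLinearMap_foldl_run _).map_smul,
      (isLinearMap_reduce _).map_smul]

lemma isLinearMap_keyedAlg_run {𝒢 : GateSet} {a b : ℕ → ℕ} (F : KeyedAlg 𝒢 a b) (l : ℕ)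
    (k : Fin l → Bool) : IsLinearMap ℂ (F.run l k) where
  map_add X Y := by
    simp only [KeyedAlg.run, (isLinearMap_tensor_right _).map_add,
      (isLinearMap_circuit_run _).map_add]
  map_smul c X := by
    simp only [KeyedAlg.run, (isLinearMap_tensor_right _).map_smul,
      (isLinearMap_circuit_run _).map_smul]

/-! ### Positivity -/

open scoped Kronecker

lemma tensor_eq_kronecker (X : Op A) (Y : Op B) :
    tensor X Y = (X ⊗ₖ Y).submatrix (fun x => (x ∘ Sum.inl, x ∘ Sum.inr))
      (fun x => (x ∘ Sum.inl, x ∘ Sum.inr)) := rfl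

lemma posSemidef_tensor {X : Op A} {Y : Op B} (hX : X.PosSemidef) (hY : Y.PosSemidef) :
    (tensor X Y).PosSemidef := by
  classical
  rw [tensor_eq_kronecker]; exact (hX.kronecker hY).submatrix _

lemma posSemidef_pureState (ψ : Ket Q) : (pureState ψ).PosSemidef :=
  Matrix.posSemidef_vecMulVec_self_star (ψ : (Q → Bool) → ℂ)

lemma pureState_basis (k : Q → Bool) :
    basisState k = pureState (EuclideanSpace.single k (1 : ℂ)) := by
  classical
  ext x y
  by_cases hx : x = k <;> by_cases hy : y = k <;> simp [basisState, pureState, hx, hy]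

lemma posSemidef_basisState (k : Q → Bool) : (basisState k).PosSemidef := by
  rw [pureState_basis]; exact posSemidef_pureState _

lemma trace_basisState (k : Q → Bool) : (basisState k).trace = 1 := by
  simp [Matrix.trace, basisState]

lemma posSemidef_initZero (e : A ↪ Q) {X : Op A} (hX : X.PosSemidef) :
    (initZero e X).PosSemidef := by
  classical
  rw [← Matrix.posSemidef_submatrix_equiv (glue e)]
  have : (initZero e X).submatrix (glue e) (glue e)
      = X ⊗ₖ basisState (fun _ => false) := by
    ext p p'; simp [initZero_glue, Matrix.kroneckerMap_apply]
  rw [this]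
  exact hX.kronecker (posSemidef_basisState _)

lemma trace_eq_sum_glue (e : A ↪ Q) (X : Op Q) :
    X.trace = ∑ r, ∑ a, X (glue e (a, r)) (glue e (a, r)) := sum_glue e fun x => X x x

lemma trace_initZero (e : A ↪ Q) (X : Op A) : (initZero e X).trace = X.trace := by
  rw [trace_eq_sum_glue e, Finset.sum_comm]
  simp only [initZero_glue, ← Finset.mul_sum]
  have := trace_basisState (fun _ : Rest e => false)
  simp only [Matrix.trace, Matrix.diag_apply] at this
  simp [this, Matrix.trace]

lemma posSemidef_reduce (e : A ↪ Q) {X : Op Q} (hX : X.PosSemidef) : (reduce e X).PosSemidef := by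
  have : reduce e X = ∑ r, X.submatrix (fun a => glue e (a, r)) (fun a => glue e (a, r)) := by
    ext a b; simp [reduce_apply, Matrix.sum_apply]
  rw [this]
  exact Matrix.posSemidef_sum _ fun r _ => hX.submatrix _

lemma trace_reduce (e : A ↪ Q) (X : Op Q) : (reduce e X).trace = X.trace := by
  rw [trace_eq_sum_glue e, Finset.sum_comm]
  simp [Matrix.trace, reduce_apply]

lemma trace_tensor (X : Op A) (Y : Op B) : (tensor X Y).trace = X.trace * Y.trace := by
  classical
  simp only [Matrix.trace, Matrix.diag_apply, tensor, Matrix.of_apply]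
  rw [← (Equiv.sumArrowEquivProdArrow A B Bool).symm.sum_comp, Fintype.sum_prod_type,
    Finset.sum_mul_sum]
  rfl

lemma applyOn_conj_eq (e : A ↪ Q) (K : Op A) (X : Op Q) :
    (applyOn e (fun Y => K * Y * Kᴴ) X).submatrix (glue e) (glue e)
      = (K ⊗ₖ (1 : Matrix (Rest e → Bool) (Rest e → Bool) ℂ)) * X.submatrix (glue e) (glue e)
        * (K ⊗ₖ (1 : Matrix (Rest e → Bool) (Rest e → Bool) ℂ))ᴴ := by
  ext ⟨a, r⟩ ⟨b, s⟩
  simp only [Matrix.submatrix_apply, applyOn_glue, Matrix.mul_apply, Matrix.conjTranspose_apply,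
    Matrix.kroneckerMap_apply, Matrix.one_apply, Fintype.sum_prod_type, Matrix.of_apply]
  refine Finset.sum_congr rfl fun d _ => ?_
  rw [Finset.sum_eq_single s]
  · simp only [if_true, mul_one]
    congr 1
    refine Finset.sum_congr rfl fun c _ => ?_
    rw [Finset.sum_eq_single r]
    · simp
    · intro r' _ h; simp [Ne.symm h]
    · simp
  · intro s' _ h; simp [Ne.symm h]
  · simp

lemma posSemidef_applyOn_conj (e : A ↪ Q) (K : Op A) {X : Op Q} (hX : X.PosSemidef) :
    (applyOn e (fun Y => K * Y * Kᴴ) X).PosSemidef := by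
  rw [← Matrix.posSemidef_submatrix_equiv (glue e), applyOn_conj_eq]
  exact (hX.submatrix _).mul_mul_conjTranspose_same _

lemma trace_applyOn (e : A ↪ Q) {Φ : Op A → Op A} (hΦ : ∀ X, (Φ X).trace = X.trace) (X : Op Q) :
    (applyOn e Φ X).trace = X.trace := by
  rw [trace_eq_sum_glue e, trace_eq_sum_glue e]
  refine Finset.sum_congr rfl fun r _ => ?_
  simpa [Matrix.trace] using hΦ (Matrix.of fun a b => X (glue e (a, r)) (glue e (b, r)))

lemma trace_conj_unitary {ι : Type} [Fintype ι] [DecidableEq ι] {U : Matrix ι ι ℂ}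
    (hU : U ∈ Matrix.unitaryGroup ι ℂ) (X : Matrix ι ι ℂ) : (U * X * Uᴴ).trace = X.trace := by
  rw [Matrix.trace_mul_comm, ← mul_assoc, ← Matrix.star_eq_conjTranspose,
    Matrix.mem_unitaryGroup_iff'.1 hU, one_mul]

lemma trace_foldl_run {𝒢 : GateSet} {w : ℕ} (L : List (Gate 𝒢 w)) (X : Op (Fin w)) :
    (L.foldl (fun Y g => g.run Y) X).trace = X.trace := by
  induction L generalizing X with
  | nil => rfl
  | cons g L ih =>
    rw [List.foldl_cons, ih, Gate.run, trace_applyOn]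
    exact trace_conj_unitary (𝒢.unitary _ g.mem)

lemma posSemidef_foldl_run {𝒢 : GateSet} {w : ℕ} (L : List (Gate 𝒢 w)) {X : Op (Fin w)}
    (hX : X.PosSemidef) : (L.foldl (fun Y g => g.run Y) X).PosSemidef := by
  induction L generalizing X with
  | nil => exact hX
  | cons g L ih => exact ih (posSemidef_applyOn_conj _ _ hX)

lemma trace_circuit_run {𝒢 : GateSet} (C : Circuit 𝒢 A B) (X : Op A) :
    (C.run X).trace = X.trace := by
  rw [Circuit.run, trace_reduce, trace_foldl_run, trace_initZero]

lemma posSemidef_circuit_run {𝒢 : GateSet} (C : Circuit 𝒢 A B) {X : Op A} (hX : X.PosSemidef) :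
    (C.run X).PosSemidef :=
  posSemidef_reduce _ (posSemidef_foldl_run _ (posSemidef_initZero _ hX))

lemma trace_keyedAlg_run {𝒢 : GateSet} {a b : ℕ → ℕ} (F : KeyedAlg 𝒢 a b) (l : ℕ)
    (k : Fin l → Bool) (X : Op (Fin (a l))) : (F.run l k X).trace = X.trace := by
  rw [KeyedAlg.run, trace_circuit_run, trace_tensor, trace_basisState, one_mul]

lemma posSemidef_keyedAlg_run {𝒢 : GateSet} {a b : ℕ → ℕ} (F : KeyedAlg 𝒢 a b) (l : ℕ)
    (k : Fin l → Bool) {X : Op (Fin (a l))} (hX : X.PosSemidef) : (F.run l k X).PosSemidef :=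
  posSemidef_circuit_run _ (posSemidef_tensor (posSemidef_basisState _) hX)

end Registers

section Circuits

variable {𝒢 : GateSet} {w : ℕ}

/-- The map `Φ` is implemented by a circuit of at most `c` gates on `w` wires. -/
def Implements (𝒢 : GateSet) {w : ℕ} (Φ : Op (Fin w) → Op (Fin w)) (c : ℕ) : Prop :=
  ∃ L : List (Gate 𝒢 w), L.length ≤ c ∧ ∀ X, L.foldl (fun Y g => g.run Y) X = Φ X

lemma Implements.comp {Φ Ψ : Op (Fin w) → Op (Fin w)} {c d : ℕ} (hΦ : Implements 𝒢 Φ c)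
    (hΨ : Implements 𝒢 Ψ d) : Implements 𝒢 (fun X => Ψ (Φ X)) (c + d) := by
  obtain ⟨L, hL, h⟩ := hΦ
  obtain ⟨L', hL', h'⟩ := hΨ
  exact ⟨L ++ L', by simp; omega, fun X => by rw [List.foldl_append, h, h']⟩

lemma Implements.of_gate (g : Gate 𝒢 w) : Implements 𝒢 g.run 1 := ⟨[g], by simp, fun X => rfl⟩

/-- Conjugation by the operator with entries `p x` at `(x, f x)`. -/
def monomial {Q : Type} (f : (Q → Bool) → Q → Bool) (p : (Q → Bool) → ℂ) (X : Op Q) : Op Q :=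
  Matrix.of fun x y => p x * star (p y) * X (f x) (f y)

lemma monomial_monomial {Q : Type} (f g : (Q → Bool) → Q → Bool) (p q : (Q → Bool) → ℂ)
    (X : Op Q) : monomial f p (monomial g q X)
      = monomial (fun x => g (f x)) (fun x => p x * q (f x)) X := by
  ext x y; simp [monomial]; ring

lemma applyOn_monomial {A : Type} [Fintype A] [DecidableEq A] {Q : Type} (e : A ↪ Q)
    (M : Op A) (f : (A → Bool) → A → Bool) (p : (A → Bool) → ℂ)
    (hM : ∀ a b, M a b = if b = f a then p a else 0) :
    applyOn e (fun X => M * X * Mᴴ)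
      = monomial (fun x => Function.extend e (f (x ∘ e)) x) (fun x => p (x ∘ e)) := by
  ext X x y
  simp only [applyOn, monomial, Matrix.of_apply, Matrix.mul_apply, Matrix.conjTranspose_apply, hM,
    ite_mul, zero_mul, Finset.sum_ite_eq', Finset.mem_univ, if_true, apply_ite star, star_zero,
    mul_ite, mul_zero]
  ring

/-- The wire `i` as an embedded register. -/
def wire {w : ℕ} (i : Fin w) : Fin 1 ↪ Fin w := ⟨fun _ => i, fun _ _ _ => Subsingleton.elim _ _⟩

/-- Two distinct wires as an embedded register. -/
def wirePair {w : ℕ} {i j : Fin w} (h : i ≠ j) : Fin 2 ↪ Fin w :=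
  ⟨![i, j], by intro a b; fin_cases a <;> fin_cases b <;> simp [h, h.symm]⟩

@[simp] lemma wire_apply (i : Fin w) (a : Fin 1) : wire i a = i := rfl

@[simp] lemma wirePair_zero {i j : Fin w} (h : i ≠ j) : wirePair h 0 = i := rfl

@[simp] lemma wirePair_one {i j : Fin w} (h : i ≠ j) : wirePair h 1 = j := rfl

lemma extend_wire (i : Fin w) (a : Fin 1 → Bool) (x : Fin w → Bool) :
    Function.extend (wire i) a x = Function.update x i (a 0) := by
  ext j
  by_cases h : j = i
  · subst h
    have := (wire j).injective.extend_apply a x 0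
    simpa using this
  · rw [Function.update_of_ne h, Function.extend_apply']
    rintro ⟨_, rfl⟩; exact h rfl

lemma extend_wirePair {i j : Fin w} (h : i ≠ j) (a : Fin 2 → Bool) (x : Fin w → Bool) :
    Function.extend (wirePair h) a x = Function.update (Function.update x i (a 0)) j (a 1) := by
  ext k
  by_cases hj : k = j
  · subst hj
    simpa using (wirePair h).injective.extend_apply a x 1
  by_cases hi : k = i
  · subst hi
    simpa [h] using (wirePair h).injective.extend_apply a x 0
  rw [Function.update_of_ne hj, Function.update_of_ne hi, Function.extend_apply']
  rintro ⟨b, rfl⟩; fin_cases b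
  · exact hi rfl
  · exact hj rfl

/-- The phase `exp (iπ/4)`. -/
noncomputable def phase : ℂ := Complex.exp (Complex.I * Real.pi / 4)

lemma phase_pow_four : phase ^ 4 = -1 := by
  rw [phase, ← Complex.exp_nat_mul, ← Complex.exp_pi_mul_I]; congr 1; push_cast; ring

lemma implements_tGate (i : Fin w) :
    Implements 𝒢 (monomial id fun x : Fin w → Bool => if x i = true then phase else 1) 1 := by
  have := Implements.of_gate (⟨⟨1, tGate⟩, 𝒢.tGate_mem, wire i⟩ : Gate 𝒢 w)
  convert this using 1
  refine ((applyOn_monomial (wire i) tGate id (fun a => if a 0 = true then phase else 1) ?_).trans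
    ?_).symm
  · intro a b; simp only [tGate, Matrix.of_apply, phase, id, eq_comm (a := b)]
  · congr 1
    ext x j; simp [extend_wire]

/-- The action of a controlled-not on basis states. -/
def cnotMap {w : ℕ} (i j : Fin w) (x : Fin w → Bool) : Fin w → Bool :=
  Function.update x j (xor (x i) (x j))

lemma implements_cnot {i j : Fin w} (h : i ≠ j) : Implements 𝒢 (monomial (cnotMap i j) 1) 1 := by
  have := Implements.of_gate (⟨⟨2, cnot⟩, 𝒢.cnot_mem, wirePair h⟩ : Gate 𝒢 w)
  convert this using 1
  refine ((applyOn_monomial (wirePair h) cnot (fun a => ![a 0, xor (a 0) (a 1)]) (fun _ => 1)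
    ?_).trans ?_).symm
  · intro a b
    simp only [cnot, Matrix.of_apply, funext_iff, Fin.forall_fin_two]
    cases a 0 <;> cases a 1 <;> cases b 0 <;> cases b 1 <;> simp
  · congr 1
    ext x k
    simp [extend_wirePair, cnotMap]

lemma cnotMap_cnotMap {i j : Fin w} (h : i ≠ j) (x : Fin w → Bool) :
    cnotMap i j (cnotMap i j x) = x := by
  simp [cnotMap, h]

lemma Implements.phase_mul {p q : (Fin w → Bool) → ℂ} {c d : ℕ}
    (hp : Implements 𝒢 (monomial id p) c) (hq : Implements 𝒢 (monomial id q) d) :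
    Implements 𝒢 (monomial id (p * q)) (c + d) := by
  convert hp.comp hq using 1
  ext X : 1
  rw [monomial_monomial]; congr 1; ext x; simp [mul_comm]

lemma Implements.phase_pow {p : (Fin w → Bool) → ℂ} {c : ℕ}
    (hp : Implements 𝒢 (monomial id p) c) (k : ℕ) :
    Implements 𝒢 (monomial id (p ^ k)) (k * c) := by
  induction k with
  | zero => exact ⟨[], by simp, fun X => by ext; simp [monomial]⟩
  | succ k ih => rw [pow_succ, Nat.succ_mul]; exact ih.phase_mul hp

lemma Implements.phase_cnot {p : (Fin w → Bool) → ℂ} {c : ℕ}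
    (hp : Implements 𝒢 (monomial id p) c) {i j : Fin w} (h : i ≠ j) :
    Implements 𝒢 (monomial id fun x => p (cnotMap i j x)) (1 + c + 1) := by
  convert ((implements_cnot h).comp hp).comp (implements_cnot h) using 1
  ext X : 1
  simp only [monomial_monomial]; congr 1
  · ext x : 1; simp [cnotMap_cnotMap h]
  · ext x; simp

lemma implements_ccz {i j k : Fin w} (hij : i ≠ j) (hik : i ≠ k) (hjk : j ≠ k) :
    Implements 𝒢
      (monomial id fun x : Fin w → Bool => if x k = true ∧ (x i && x j) = true then -1 else 1) 80 := by
  have t := fun l : Fin w => implements_tGate (𝒢 := 𝒢) l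
  have h := ((((((t i).phase_mul (t j)).phase_mul (t k)).phase_mul
    (((t j).phase_cnot hij).phase_pow 7)).phase_mul
    (((t k).phase_cnot hik).phase_pow 7)).phase_mul
    (((t k).phase_cnot hjk).phase_pow 7)).phase_mul
    (((t k).phase_cnot hik).phase_cnot hjk)
  obtain ⟨L, hL, h⟩ := h
  have h16 : phase ^ 16 = 1 := by
    rw [show (16 : ℕ) = 4 * 4 from rfl, pow_mul, phase_pow_four]; norm_num
  refine ⟨L, hL.trans (by norm_num), fun X => (h X).trans ?_⟩
  congr 1
  ext x
  simp only [Pi.mul_apply, Pi.pow_apply, cnotMap, Function.update_self, ne_eq, hik,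
    not_false_eq_true, Function.update_of_ne]
  rcases x i <;> rcases x j <;> rcases x k <;> simp
  all_goals first
    | linear_combination phase_pow_four
    | linear_combination h16

/-- The sign `(-1) ^ (a b)`. -/
def sgn (a b : Bool) : ℂ := if a = true ∧ b = true then -1 else 1

/-- Conjugation by a Hadamard gate on wire `i`. -/
noncomputable def hadamardMap {w : ℕ} (i : Fin w) (X : Op (Fin w)) : Op (Fin w) :=
  Matrix.of fun x y => (1 / 2 : ℂ) * ∑ u : Bool, ∑ v : Bool,
    sgn (x i) u * sgn (y i) v * X (Function.update x i u) (Function.update y i v)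

lemma implements_hadamard (i : Fin w) : Implements 𝒢 (hadamardMap i) 1 := by
  have := Implements.of_gate (⟨⟨1, hadamard⟩, 𝒢.hadamard_mem, wire i⟩ : Gate 𝒢 w)
  convert this using 1
  ext X x y
  have hs : ((Real.sqrt 2 : ℝ) : ℂ)⁻¹ * ((Real.sqrt 2 : ℝ) : ℂ)⁻¹ = 1 / 2 := by
    rw [← mul_inv, ← Complex.ofReal_mul, Real.mul_self_sqrt (by norm_num)]; simp
  simp only [hadamardMap, Gate.run, applyOn, Matrix.of_apply, Matrix.mul_apply,
    Matrix.conjTranspose_apply, hadamard, extend_wire]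
  rw [← (Equiv.funUnique (Fin 1) Bool).symm.sum_comp, Finset.sum_comm, Finset.mul_sum]
  refine Finset.sum_congr rfl fun v _ => ?_
  rw [← (Equiv.funUnique (Fin 1) Bool).symm.sum_comp, Finset.mul_sum, Finset.sum_mul]
  refine Finset.sum_congr rfl fun u _ => ?_
  simp only [sgn, wire_apply, Equiv.funUnique_symm_apply, uniqueElim_const, Function.comp_apply,
    star_mul', ← hs]
  have : star (((Real.sqrt 2 : ℝ) : ℂ)⁻¹) = ((Real.sqrt 2 : ℝ) : ℂ)⁻¹ := by simp
  rw [this]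
  split_ifs <;> simp <;> ring

lemma hadamard_phase_hadamard (i : Fin w) (g : (Fin w → Bool) → Bool)
    (hg : ∀ x u, g (Function.update x i u) = g x) (X : Op (Fin w)) :
    hadamardMap i (monomial id (fun x => if x i = true ∧ g x = true then -1 else 1)
      (hadamardMap i X)) = monomial (fun x => Function.update x i (xor (x i) (g x))) 1 X := by
  ext x y
  simp only [hadamardMap, monomial, Matrix.of_apply, id, Function.update_self, Fintype.sum_bool,
    Function.update_idem, hg, sgn]
  rcases x i <;> rcases y i <;> rcases g x <;> rcases g y <;> simp <;> ring_nf

/-- Exchange the bits `i` and `j` if the bit `c` is set. -/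
def cswapMap {Q : Type} (c : Q) (σ : Equiv.Perm Q) (x : Q → Bool) : Q → Bool :=
  if x c = true then x ∘ σ else x

lemma implements_cswap {c i j : Fin w} (hci : c ≠ i) (hcj : c ≠ j) (hij : i ≠ j) :
    Implements 𝒢 (monomial (cswapMap c (Equiv.swap i j)) 1) 84 := by
  have h := ((((implements_cnot (𝒢 := 𝒢) hij).comp (implements_hadamard i)).comp
    (implements_ccz hcj hci hij.symm)).comp (implements_hadamard i)).comp (implements_cnot hij)
  obtain ⟨L, hL, h⟩ := h
  refine ⟨L, hL.trans (by norm_num), fun X => (h X).trans ?_⟩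
  beta_reduce
  rw [hadamard_phase_hadamard i fun x => x c && x j]
  · simp only [monomial_monomial]
    congr 1
    · ext x l
      simp only [cnotMap, cswapMap, Function.update_self, ne_eq, hcj, hij,
        hij.symm, not_false_eq_true, Function.update_of_ne]
      by_cases hli : l = i
      · subst hli
        simp only [hij, Function.update_self, ne_eq, not_false_eq_true, Function.update_of_ne]
        rcases hc : x c <;> rcases hi : x l <;> rcases hj : x j <;> simp [hi, hj]
      by_cases hlj : l = j
      · subst hlj
        simp only [Function.update_self]
        rcases hc : x c <;> rcases hi : x l <;> rcases hj : x i <;> simp [hi, hj]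
      rcases hc : x c <;> simp [hli, hlj, Equiv.swap_apply_of_ne_of_ne]
    · ext x; simp
  · intro x u; simp [hci, hij.symm]

/-- A controlled exchange of two registers of `n` qubits takes `O(n)` gates. -/
lemma implements_cswap_registers (c : Fin w) {n : ℕ} (a b : Fin n → Fin w)
    (ha : a.Injective) (hb : b.Injective) (hab : ∀ i j, a i ≠ b j) (hca : ∀ i, c ≠ a i)
    (hcb : ∀ i, c ≠ b i) :
    ∃ σ : Equiv.Perm (Fin w), (∀ i, σ (a i) = b i) ∧ (∀ i, σ (b i) = a i) ∧
      (∀ x, (∀ i, x ≠ a i) → (∀ i, x ≠ b i) → σ x = x) ∧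
      Implements 𝒢 (monomial (cswapMap c σ) 1) (n * 84) := by
  induction n with
  | zero =>
    refine ⟨1, nofun, nofun, fun _ _ _ => rfl, [], by simp, fun X => ?_⟩
    ext x y; simp [monomial, cswapMap]
  | succ n ih =>
    obtain ⟨σ, h1, h2, h3, h4⟩ := ih (fun i => a i.castSucc) (fun i => b i.castSucc)
      (fun i j h => by simpa using ha h) (fun i j h => by simpa using hb h)
      (fun i j => hab _ _) (fun i => hca _) (fun i => hcb _)
    have hal : ∀ i : Fin n, a i.castSucc ≠ a (Fin.last n) :=
      fun i h => (Fin.castSucc_lt_last i).ne (ha h)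
    have hbl : ∀ i : Fin n, b i.castSucc ≠ b (Fin.last n) :=
      fun i h => (Fin.castSucc_lt_last i).ne (hb h)
    have hσa : σ (a (Fin.last n)) = a (Fin.last n) := h3 _ (fun i => (hal i).symm) fun i => hab _ _
    have hσb : σ (b (Fin.last n)) = b (Fin.last n) :=
      h3 _ (fun i => (hab _ _).symm) fun i => (hbl i).symm
    refine ⟨Equiv.swap (a (Fin.last n)) (b (Fin.last n)) * σ, ?_, ?_, ?_, ?_⟩
    · intro i
      refine Fin.lastCases ?_ (fun i => ?_) i
      · simp [hσa]
      · rw [Equiv.Perm.mul_apply, h1, Equiv.swap_apply_of_ne_of_ne (hab _ _).symm (hbl i)]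
    · intro i
      refine Fin.lastCases ?_ (fun i => ?_) i
      · simp [hσb]
      · rw [Equiv.Perm.mul_apply, h2, Equiv.swap_apply_of_ne_of_ne (hal i) (hab _ _)]
    · intro x hxa hxb
      rw [Equiv.Perm.mul_apply, h3 x (fun i => hxa _) (fun i => hxb _),
        Equiv.swap_apply_of_ne_of_ne (hxa _) (hxb _)]
    · have hc : Equiv.swap (a (Fin.last n)) (b (Fin.last n)) c = c :=
        Equiv.swap_apply_of_ne_of_ne (hca _) (hcb _)
      convert h4.comp (implements_cswap (𝒢 := 𝒢) (hca (Fin.last n)) (hcb (Fin.last n)) (hab _ _))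
        using 1
      · ext X : 1
        rw [monomial_monomial]
        congr 1
        · ext x l
          rcases hx : x c <;> simp [cswapMap, hx, hc]
        · ext x; simp
      · ring

lemma sum_ite_bit {Q : Type} [Fintype Q] [DecidableEq Q] (c : Q) (g : (Q → Bool) → ℝ)
    (hg : ∀ x u, g (Function.update x c u) = g x) :
    ∑ x, (if x c = true then g x else 0) = (1 / 2) * ∑ x, g x := by
  have hflip : Function.Involutive fun x : Q → Bool => Function.update x c (!x c) := by
    intro x; simp
  have h1 : ∑ x, (if x c = true then g x else 0) = ∑ x, (if x c = true then 0 else g x) := by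
    rw [← Equiv.sum_comp hflip.toPerm]
    refine Finset.sum_congr rfl fun x _ => ?_
    rcases h : x c <;> simp [hg, h]
  have h2 : ∑ x, g x = ∑ x, (if x c = true then g x else 0)
      + ∑ x, (if x c = true then 0 else g x) := by
    rw [← Finset.sum_add_distrib]
    refine Finset.sum_congr rfl fun x _ => ?_
    split_ifs <;> simp
  rw [h2, ← h1]; ring

/-- The swap test: with the control qubit `c` in the state `|+⟩`, a controlled permutation `σ` of
the qubits followed by a Hadamard gate on `c` yields the outcome `1` with probability
`(1 - Re Tr (σ X)) / 2`. -/
lemma swap_test {X : Op (Fin w)} {c : Fin w}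
    (hc : ∀ x y u v, X (Function.update x c u) (Function.update y c v) = X x y)
    {σ : Equiv.Perm (Fin w)} (hσ : σ c = c) (hσσ : ∀ i, σ (σ i) = i) :
    ∑ x : Fin w → Bool, (if x c = true
      then (hadamardMap c (monomial (cswapMap c σ) 1 X) x x).re else 0)
      = (X.trace.re - (∑ x, X x (x ∘ σ)).re) / 2 := by
  have hup : ∀ (x : Fin w → Bool) u, Function.update x c u ∘ σ = Function.update (x ∘ σ) c u := by
    intro x u; ext i
    by_cases hi : i = c
    · subst hi; simp [hσ]
    · have : σ i ≠ c := fun h => hi (σ.injective (h.trans hσ.symm))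
      simp [hi, this]
  have key : ∀ x : Fin w → Bool, (if x c = true
      then (hadamardMap c (monomial (cswapMap c σ) 1 X) x x).re else 0)
      = if x c = true then ((X x x).re + (X (x ∘ σ) (x ∘ σ)).re) / 2
          - ((X x (x ∘ σ)).re + (X (x ∘ σ) x).re) / 2 else 0 := by
    intro x
    split_ifs with h
    · have h1 : X (x ∘ σ) (Function.update x c false) = X (x ∘ σ) x := by
        have := hc (x ∘ σ) x ((x ∘ σ) c) false
        rwa [Function.update_eq_self] at this
      have h2 : X (Function.update x c false) (x ∘ σ) = X x (x ∘ σ) := by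
        have := hc x (x ∘ σ) false ((x ∘ σ) c)
        rwa [Function.update_eq_self] at this
      have h3 : Function.update x c true = x := by rw [← h, Function.update_eq_self]
      simp [hadamardMap, monomial, cswapMap, sgn, h, hc, h3, h1, h2]
      ring
    · rfl
  rw [Finset.sum_congr rfl fun x _ => key x, sum_ite_bit c]
  · rw [Finset.sum_sub_distrib, ← Finset.sum_div, ← Finset.sum_div, Finset.sum_add_distrib,
      Finset.sum_add_distrib]
    have h2 : ∑ x : Fin w → Bool, (X (x ∘ σ) x).re = ∑ x, (X x (x ∘ σ)).re := by
      rw [← (Equiv.arrowCongr σ.symm (Equiv.refl Bool)).sum_comp fun x => (X x (x ∘ σ)).re]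
      refine Finset.sum_congr rfl fun x _ => ?_
      congr 2
      ext i; exact congrArg x (hσσ i).symm
    have : ∑ x : Fin w → Bool, (X (x ∘ σ) (x ∘ σ)).re = ∑ x, (X x x).re :=
      (Equiv.arrowCongr σ.symm (Equiv.refl Bool)).sum_comp fun x => (X x x).re
    rw [this, h2]
    simp only [Matrix.trace, Matrix.diag_apply, Complex.re_sum]
    ring
  · intro x u
    simp only [hup, hc]

end Circuits

section Registers

variable {A B P Q R : Type} [Fintype A] [DecidableEq A] [Fintype B] [DecidableEq B]
  [Fintype P] [DecidableEq P] [Fintype Q] [DecidableEq Q] [Fintype R] [DecidableEq R]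

lemma map_sum_of_isLinearMap {ι κ : Type} {Φ : Matrix ι ι ℂ → Matrix κ κ ℂ}
    (hΦ : IsLinearMap ℂ Φ) {σ : Type} (s : Finset σ) (M : σ → Matrix ι ι ℂ) :
    Φ (∑ r ∈ s, M r) = ∑ r ∈ s, Φ (M r) := by
  exact map_sum (hΦ.mk' Φ) M s

lemma extend_trans_glue (f : A ↪ B) (e : B ↪ Q) (c : A → Bool)
    (p : (B → Bool) × (Rest e → Bool)) :
    Function.extend (f.trans e) c (glue e p) = glue e (Function.extend f c p.1, p.2) := by
  apply eq_glue
  · intro b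
    by_cases hb : b ∈ Set.range f
    · obtain ⟨a, rfl⟩ := hb
      exact ((f.trans e).injective.extend_apply _ _ a).trans (f.injective.extend_apply _ _ a).symm
    · change _ = Function.extend f c p.1 b
      rw [Function.extend_apply' _ _ _ (fun h => hb h), Function.extend_apply', glue_apply_emb]
      rintro ⟨a, ha⟩
      exact hb ⟨a, e.injective ha⟩
  · intro i
    rw [Function.extend_apply', glue_apply_rest]
    rintro ⟨a, ha⟩
    exact i.2 ⟨f a, ha⟩

lemma extend_extend (f : A ↪ B) (e : B ↪ Q) (c : A → Bool) (x : Q → Bool) :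
    Function.extend e (Function.extend f c (x ∘ e)) x = Function.extend (f.trans e) c x := by
  obtain ⟨p, rfl⟩ := (glue e).surjective x
  rw [extend_trans_glue, extend_glue, glue_comp]

lemma extend_inl (c : A → Bool) (x : A ⊕ B → Bool) :
    Function.extend (Function.Embedding.inl : A ↪ A ⊕ B) c x = Sum.elim c (x ∘ Sum.inr) := by
  ext i
  rcases i with i | i
  · exact (Function.Embedding.inl : A ↪ A ⊕ B).injective.extend_apply c x i
  · rw [Function.extend_apply']
    · rfl
    · rintro ⟨a, ha⟩; cases ha

lemma extend_inr (c : B → Bool) (x : A ⊕ B → Bool) :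
    Function.extend (Function.Embedding.inr : B ↪ A ⊕ B) c x = Sum.elim (x ∘ Sum.inl) c := by
  ext i
  rcases i with i | i
  · rw [Function.extend_apply']
    · rfl
    · rintro ⟨a, ha⟩; cases ha
  · exact (Function.Embedding.inr : B ↪ A ⊕ B).injective.extend_apply c x i

lemma extend_trans_inl (f : P ↪ A) (c : P → Bool) (x : A ⊕ B → Bool) :
    Function.extend (f.trans Function.Embedding.inl) c x
      = Sum.elim (Function.extend f c (x ∘ Sum.inl)) (x ∘ Sum.inr) := by
  rw [← extend_extend, extend_inl]; rfl

lemma sum_sumArrow {M : Type*} [AddCommMonoid M] (g : (A ⊕ B → Bool) → M) :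
    ∑ x, g x = ∑ a, ∑ b, g (Sum.elim a b) := by
  rw [← (Equiv.sumArrowEquivProdArrow A B Bool).symm.sum_comp, Fintype.sum_prod_type]
  rfl

/-- The expectation of the exchange of the two registers. -/
def swapValue (X : Op (A ⊕ A)) : ℂ := ∑ a, ∑ b, X (Sum.elim a b) (Sum.elim b a)

lemma swapValue_tensor (X Y : Op A) : swapValue (tensor X Y) = (X * Y).trace := by
  simp only [swapValue, tensor, Matrix.trace, Matrix.diag_apply, Matrix.mul_apply, Matrix.of_apply]
  rfl

/-- Expectations of a permutation of qubits that exchanges two registers. -/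
lemma sum_perm_eq_swapValue (e : A ⊕ A ↪ Q) {σ : Equiv.Perm Q}
    (h1 : ∀ i, σ (e (Sum.inl i)) = e (Sum.inr i)) (h2 : ∀ i, σ (e (Sum.inr i)) = e (Sum.inl i))
    (h3 : ∀ x, x ∉ Set.range e → σ x = x) (X : Op Q) :
    ∑ x, X x (x ∘ σ) = swapValue (reduce e X) := by
  have hg : ∀ p, glue e p ∘ σ = glue e (p.1 ∘ Sum.swap, p.2) := by
    intro p
    apply eq_glue
    · rintro (a | a)
      · simp [h1]
      · simp [h2]
    · intro i; simp [h3 i.1 i.2]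
  rw [sum_glue e]
  simp only [hg, swapValue, reduce_apply]
  rw [Finset.sum_comm, sum_sumArrow]
  refine Finset.sum_congr rfl fun a _ => Finset.sum_congr rfl fun b _ =>
    Finset.sum_congr rfl fun r _ => ?_
  congr 2
  rw [Prod.mk.injEq]; refine ⟨?_, rfl⟩
  ext (i | i) <;> rfl

lemma reduce_applyOn_inr (e : P ⊕ A ↪ Q) {Φ : Op A → Op A} (hΦ : IsLinearMap ℂ Φ) (X : Op Q) :
    reduce e (applyOn (Function.Embedding.inr.trans e) Φ X) = applyRight Φ (reduce e X) := by
  ext x y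
  rw [reduce_apply]
  simp only [applyOn, applyRight, Matrix.of_apply, extend_trans_glue, extend_inr]
  have h := congrFun (congrFun (map_sum_of_isLinearMap hΦ Finset.univ fun r => Matrix.of fun a b =>
    X (glue e (Sum.elim (x ∘ Sum.inl) a, r)) (glue e (Sum.elim (y ∘ Sum.inl) b, r)))
    (x ∘ Sum.inr)) (y ∘ Sum.inr)
  rw [Matrix.sum_apply] at h
  convert h.symm using 2
  · congr 1
    · ext i; simp
    · ext i; simp
  · ext a b
    simp [reduce_apply, Matrix.sum_apply]

lemma reduce_eq_sum_ite (e : A ↪ Q) (X : Op Q) (a b : A → Bool) :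
    reduce e X a b = ∑ x : Q → Bool, if x ∘ e = a then X x (Function.extend e b x) else 0 := by
  simp only [reduce, Matrix.of_apply]
  congr!

lemma reduce_reduce (f : A ↪ B) (e : B ↪ Q) (X : Op Q) :
    reduce f (reduce e X) = reduce (f.trans e) X := by
  ext a b
  simp only [reduce_eq_sum_ite, ← extend_extend f e]
  have h : ∀ c : B → Bool, (if c ∘ f = a then ∑ x : Q → Bool, (if x ∘ e = c then
      X x (Function.extend e (Function.extend f b c) x) else 0) else 0)
      = ∑ x : Q → Bool, if x ∘ e = c then (if c ∘ f = a then
        X x (Function.extend e (Function.extend f b c) x) else 0) else 0 := by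
    intro c
    split_ifs <;> simp
  simp only [h]
  rw [Finset.sum_comm]
  simp only [Finset.sum_ite_eq, Finset.mem_univ, if_true]
  rfl

lemma reduce_initZero (e : A ↪ Q) (X : Op A) : reduce e (initZero e X) = X := by
  ext a b
  simp only [reduce_apply, initZero_glue, ← Finset.mul_sum]
  have := trace_basisState (fun _ : Rest e => false)
  simp only [Matrix.trace, Matrix.diag_apply] at this
  rw [this, mul_one]

lemma applyOn_initZero (f : A ↪ B) (e : B ↪ Q) {Φ : Op A → Op A} (hΦ : IsLinearMap ℂ Φ)
    (X : Op B) :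
    applyOn (f.trans e) Φ (initZero e X) = initZero e (applyOn f Φ X) := by
  refine op_ext e fun p p' => ?_
  rw [initZero_glue, mul_comm, ← smul_eq_mul]
  simp only [applyOn, Matrix.of_apply, extend_trans_glue, initZero_glue]
  rw [← Matrix.smul_apply, ← hΦ.map_smul]
  have : (Matrix.of fun a b => initZero e X (glue e (Function.extend f a p.1, p.2))
      (glue e (Function.extend f b p'.1, p'.2)))
      = basisState (fun _ => false) p.2 p'.2 • Matrix.of fun a b =>
        X (Function.extend f a p.1) (Function.extend f b p'.1) := by
    ext a b; simp [initZero_glue, mul_comm]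
  have h1 : ∀ p : (B → Bool) × (Rest e → Bool), glue e p ∘ f.trans e = p.1 ∘ f := by
    intro p; ext i; simp
  simp only [initZero_glue] at this
  rw [this, h1, h1]

lemma applyOn_tensor (f : A ↪ P) {Φ : Op A → Op A} (hΦ : IsLinearMap ℂ Φ) (X : Op P) (Y : Op R) :
    applyOn (f.trans Function.Embedding.inl) Φ (tensor X Y) = tensor (applyOn f Φ X) Y := by
  ext x y
  simp only [applyOn, tensor, Matrix.of_apply, extend_trans_inl]
  rw [mul_comm, ← smul_eq_mul, ← Matrix.smul_apply, ← hΦ.map_smul]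
  congr 2
  ext a b; simp [mul_comm]

/-- The `i`-th register of a family. -/
def slot {q : ℕ} (n : ℕ) (i : Fin q) : Fin n ↪ Fin q × Fin n :=
  ⟨fun j => (i, j), fun _ _ h => (Prod.mk.inj h).2⟩

lemma extend_slot {q n : ℕ} (i : Fin q) (c : Fin n → Bool) (x : Fin q × Fin n → Bool)
    (i' : Fin q) (j : Fin n) :
    Function.extend (slot n i) c x (i', j) = if i' = i then c j else x (i', j) := by
  split_ifs with h
  · subst h; exact (slot n i').injective.extend_apply c x j
  · rw [Function.extend_apply']
    rintro ⟨a, ha⟩; exact h (Prod.mk.inj ha).1.symm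

lemma applyOn_tensorFamily {q n : ℕ} (i : Fin q) {Φ : Op (Fin n) → Op (Fin n)}
    (hΦ : IsLinearMap ℂ Φ) (ρ : Fin q → Op (Fin n)) :
    applyOn (slot n i) Φ (tensorFamily ρ) = tensorFamily (Function.update ρ i (Φ (ρ i))) := by
  ext x y
  simp only [applyOn, tensorFamily, Matrix.of_apply, extend_slot]
  rw [← Finset.mul_prod_erase _ _ (Finset.mem_univ i), Function.update_self, mul_comm,
    ← smul_eq_mul, ← Matrix.smul_apply, ← hΦ.map_smul]
  congr 2
  ext a b
  simp only [Matrix.of_apply, Matrix.smul_apply, smul_eq_mul]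
  rw [← Finset.mul_prod_erase _ _ (Finset.mem_univ i), mul_comm]
  simp only [if_true]
  congr 1
  refine Finset.prod_congr rfl fun j hj => ?_
  have : j ≠ i := (Finset.mem_erase.1 hj).1
  simp [this]

lemma reduce_tensor_inl (X : Op A) (Y : Op B) :
    reduce Function.Embedding.inl (tensor X Y) = Y.trace • X := by
  classical
  ext a b
  simp only [reduce, Matrix.of_apply, extend_inl]
  rw [sum_sumArrow, Finset.sum_eq_single a]
  · simp only [tensor, Matrix.of_apply, Matrix.trace, Matrix.smul_apply, smul_eq_mul,
      Finset.sum_mul, Matrix.diag_apply]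
    refine Finset.sum_congr rfl fun c _ => ?_
    rw [if_pos (by ext i; rfl), mul_comm]; rfl
  · intro c _ h
    refine Finset.sum_eq_zero fun d _ => if_neg fun h' => h ?_
    rw [← h']; ext i; rfl
  · simp

lemma reduce_tensor_inr (X : Op A) (Y : Op B) :
    reduce Function.Embedding.inr (tensor X Y) = X.trace • Y := by
  classical
  ext a b
  simp only [reduce, Matrix.of_apply, extend_inr]
  rw [sum_sumArrow, Finset.sum_comm, Finset.sum_eq_single a]
  · simp only [tensor, Matrix.of_apply, Matrix.trace, Matrix.smul_apply, smul_eq_mul,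
      Finset.sum_mul, Matrix.diag_apply]
    refine Finset.sum_congr rfl fun c _ => ?_
    rw [if_pos (by ext i; rfl)]; rfl
  · intro c _ h
    refine Finset.sum_eq_zero fun d _ => if_neg fun h' => h ?_
    rw [← h']; ext i; rfl
  · simp

lemma extend_sumMap (f : A ↪ P) (g : B ↪ Q) (c : A ⊕ B → Bool) (x : P ⊕ Q → Bool) :
    Function.extend (f.sumMap g) c x = Sum.elim (Function.extend f (c ∘ Sum.inl) (x ∘ Sum.inl))
      (Function.extend g (c ∘ Sum.inr) (x ∘ Sum.inr)) := by
  ext (i | i)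
  · by_cases hi : i ∈ Set.range f
    · obtain ⟨a, rfl⟩ := hi
      exact ((f.sumMap g).injective.extend_apply c x (Sum.inl a)).trans
        (f.injective.extend_apply (c ∘ Sum.inl) (x ∘ Sum.inl) a).symm
    · rw [Sum.elim_inl, Function.extend_apply' _ _ _ (fun h => hi h), Function.extend_apply']
      · rfl
      · rintro ⟨(a | a), ha⟩
        · exact hi ⟨a, Sum.inl.inj ha⟩
        · cases ha
  · by_cases hi : i ∈ Set.range g
    · obtain ⟨a, rfl⟩ := hi
      exact ((f.sumMap g).injective.extend_apply c x (Sum.inr a)).trans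
        (g.injective.extend_apply (c ∘ Sum.inr) (x ∘ Sum.inr) a).symm
    · rw [Sum.elim_inr, Function.extend_apply' _ _ _ (fun h => hi h), Function.extend_apply']
      · rfl
      · rintro ⟨(a | a), ha⟩
        · cases ha
        · exact hi ⟨a, Sum.inr.inj ha⟩

lemma sumElim_comp_sumMap_eq_iff (f : A ↪ P) (g : B ↪ Q) (p : P → Bool) (q : Q → Bool)
    (a : A ⊕ B → Bool) :
    Sum.elim p q ∘ f.sumMap g = a ↔ p ∘ f = a ∘ Sum.inl ∧ q ∘ g = a ∘ Sum.inr := by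
  simp [funext_iff]

lemma reduce_tensor (f : A ↪ P) (g : B ↪ Q) (X : Op P) (Y : Op Q) :
    reduce (f.sumMap g) (tensor X Y) = tensor (reduce f X) (reduce g Y) := by
  classical
  ext a b
  simp only [reduce, Matrix.of_apply, tensor, sum_sumArrow, extend_sumMap,
    sumElim_comp_sumMap_eq_iff, Finset.sum_mul_sum]
  refine Finset.sum_congr rfl fun p _ => Finset.sum_congr rfl fun q _ => ?_
  by_cases h1 : p ∘ f = a ∘ Sum.inl
  · by_cases h2 : q ∘ g = a ∘ Sum.inr
    · simp [h1, h2]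
    · simp [h2]
  · simp [h1]

lemma reduce_applyRight {C : Type} [Fintype C] [DecidableEq C] (g : C ↪ B) (Φ : Op A → Op B)
    (X : Op (P ⊕ A)) :
    reduce ((Function.Embedding.refl P).sumMap g) (applyRight Φ X)
      = applyRight (fun Y => reduce g (Φ Y)) X := by
  classical
  ext a b
  simp only [reduce, Matrix.of_apply, applyRight, sum_sumArrow, extend_sumMap,
    sumElim_comp_sumMap_eq_iff]
  rw [Finset.sum_eq_single (a ∘ Sum.inl)]
  · refine Finset.sum_congr rfl fun q _ => ?_
    have h : Function.extend (Function.Embedding.refl P) (b ∘ Sum.inl) (a ∘ Sum.inl)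
        = b ∘ Sum.inl := by
      ext i; exact (Function.Embedding.refl P).injective.extend_apply _ _ i
    simp only [Sum.elim_comp_inl, Sum.elim_comp_inr, h]
    by_cases h2 : q ∘ g = a ∘ Sum.inr
    · rw [if_pos ⟨rfl, h2⟩, if_pos h2]
    · rw [if_neg (fun h => h2 h.2), if_neg h2]
  · intro c _ h
    refine Finset.sum_eq_zero fun d _ => if_neg fun h' => h h'.1
  · simp

end Registers

section PermutationTest

variable {d : Type} [Fintype d] [DecidableEq d] {s : ℕ}

lemma symProj_mulVec (v : EuclideanSpace ℂ (Fin s → d)) (x : Fin s → d) :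
    (symProj d s *ᵥ v) x = (symSubspace d s).starProjection v x := by
  have hv : v = ∑ y, v y • EuclideanSpace.single y (1 : ℂ) := by
    ext z; simp [Pi.single_apply]
  conv_rhs => rw [hv]
  simp [Matrix.mulVec, dotProduct, symProj, mul_comm]

lemma inner_starProjection_self {E : Type*} [NormedAddCommGroup E] [InnerProductSpace ℂ E]
    (K : Submodule ℂ E) [K.HasOrthogonalProjection] (v : E) :
    inner ℂ (K.starProjection v) v = ((‖K.starProjection v‖ ^ 2 : ℝ) : ℂ) := by
  have h := K.inner_starProjection_left_eq_right (K.starProjection v) v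
  rw [K.starProjection_eq_self_iff.2 (K.starProjection_apply_mem v)] at h
  rw [h, inner_self_eq_norm_sq_to_K]; simp

lemma permTestProb_vecMulVec (v : EuclideanSpace ℂ (Fin s → d)) :
    permTestProb (Matrix.vecMulVec (v : (Fin s → d) → ℂ) (star (v : (Fin s → d) → ℂ)))
      = ‖(symSubspace d s).starProjection v‖ ^ 2 := by
  have h1 : (symProj d s * Matrix.vecMulVec (v : (Fin s → d) → ℂ) (star (v : (Fin s → d) → ℂ))).trace
      = inner ℂ v ((symSubspace d s).starProjection v) := by
    rw [Matrix.mul_vecMulVec, Matrix.trace_vecMulVec, PiLp.inner_apply]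
    simp only [dotProduct, symProj_mulVec]
    rfl
  rw [permTestProb, h1, ← inner_conj_symm, inner_starProjection_self, Complex.conj_ofReal,
    Complex.ofReal_re]

/-- The product vector `u₀ ⊗ ⋯ ⊗ u_{s-1}`. -/
noncomputable def prodVec (u : Fin s → EuclideanSpace ℂ d) : EuclideanSpace ℂ (Fin s → d) :=
  WithLp.toLp 2 fun x => ∏ i, u i (x i)

lemma inner_prodVec (u v : Fin s → EuclideanSpace ℂ d) :
    inner ℂ (prodVec u) (prodVec v) = ∏ i, inner ℂ (u i) (v i) := by
  simp only [PiLp.inner_apply, prodVec, Finset.prod_univ_sum, Fintype.piFinset_univ]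
  refine Finset.sum_congr rfl fun x _ => ?_
  simp [Finset.prod_mul_distrib]

lemma prod_update_const {M : Type*} [CommMonoid M] {β : Type*} (j : Fin s) (a b : β) (g : β → M) :
    ∏ i, g (Function.update (fun _ => a) j b i) = g b * g a ^ (s - 1) := by
  rw [← Finset.mul_prod_erase _ _ (Finset.mem_univ j), Function.update_self]
  congr 1
  rw [Finset.prod_congr rfl (g := fun _ => g a)]
  · simp
  · intro i hi; rw [Function.update_of_ne (Finset.ne_of_mem_erase hi)]

lemma inner_symSubspace_prodVec {u : EuclideanSpace ℂ (Fin s → d)} (hu : u ∈ symSubspace d s)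
    (ψ φ : EuclideanSpace ℂ d) (j k : Fin s) :
    inner ℂ u (prodVec (Function.update (fun _ => ψ) j φ))
      = inner ℂ u (prodVec (Function.update (fun _ => ψ) k φ)) := by
  induction hu using Submodule.span_induction with
  | mem v hv =>
    obtain ⟨ξ, hξ⟩ := hv
    have : v = prodVec fun _ => ξ := by ext x; simp [prodVec, hξ]
    rw [this, inner_prodVec, inner_prodVec, prod_update_const j ψ φ fun v => inner ℂ ξ v,
      prod_update_const k ψ φ fun v => inner ℂ ξ v]
  | zero => simp
  | add x y _ _ hx hy => rw [inner_add_left, inner_add_left, hx, hy]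
  | smul c x _ hx => rw [inner_smul_left, inner_smul_left, hx]

/-- The permutation test on `ψ ⊗ ⋯ ⊗ ψ ⊗ φ`. -/
lemma norm_starProjection_prodVec_le {t : ℕ} {ψ : EuclideanSpace ℂ d} (hψ : ‖ψ‖ = 1)
    (φ : EuclideanSpace ℂ d) (k : Fin (t + 1)) :
    ‖(symSubspace d (t + 1)).starProjection (prodVec (Function.update (fun _ => ψ) k φ))‖ ^ 2
      ≤ (‖φ‖ ^ 2 + t * ‖inner ℂ ψ φ‖ ^ 2) / (t + 1) := by
  set v : Fin (t + 1) → EuclideanSpace ℂ (Fin (t + 1) → d) :=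
    fun j => prodVec (Function.update (fun _ => ψ) j φ) with hv
  set p := (symSubspace d (t + 1)).starProjection (v k) with hp
  have hpm : p ∈ symSubspace d (t + 1) := Submodule.starProjection_apply_mem _ _
  have hT : (0 : ℝ) < t + 1 := by positivity
  have hψψ : inner ℂ ψ ψ = (1 : ℂ) := by rw [inner_self_eq_norm_sq_to_K, hψ]; simp
  have hvv : ∀ i j, inner ℂ (v i) (v j) = if i = j then ((‖φ‖ ^ 2 : ℝ) : ℂ) else
      ((‖(inner ℂ ψ φ : ℂ)‖ ^ 2 : ℝ) : ℂ) := by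
    intro i j
    rw [hv, inner_prodVec]
    split_ifs with h
    · subst h
      rw [Finset.prod_eq_single i]
      · simp [inner_self_eq_norm_sq_to_K]
      · intro l _ hl; simp only [Function.update_of_ne hl, hψψ]
      · simp
    · rw [← Finset.mul_prod_erase _ _ (Finset.mem_univ i),
        ← Finset.mul_prod_erase _ _ (Finset.mem_erase.2 ⟨Ne.symm h, Finset.mem_univ j⟩),
        Finset.prod_eq_one]
      · simp only [Function.update_self, Function.update_of_ne h, Function.update_of_ne (Ne.symm h)]
        rw [mul_one, ← inner_conj_symm, RCLike.conj_mul]; simp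
      · intro l hl
        simp only [Finset.mem_erase] at hl
        simp only [Function.update_of_ne hl.1, Function.update_of_ne hl.2.1, hψψ]
  have h1 : ((‖p‖ ^ 2 : ℝ) : ℂ) = inner ℂ p (v k) :=
    (inner_starProjection_self _ _).symm
  have h2 : ((t + 1 : ℝ) * ‖p‖ ^ 2 : ℝ) = ‖(inner ℂ p (∑ j, v j) : ℂ)‖ := by
    rw [inner_sum, Finset.sum_congr rfl fun j _ => inner_symSubspace_prodVec hpm ψ φ j k]
    have h1' : inner ℂ p (prodVec (Function.update (fun _ => ψ) k φ)) = ((‖p‖ ^ 2 : ℝ) : ℂ) :=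
      h1.symm
    rw [Finset.sum_const, h1', Finset.card_univ, Fintype.card_fin, nsmul_eq_mul, norm_mul,
      Complex.norm_real, Complex.norm_natCast, Real.norm_of_nonneg (by positivity)]
    push_cast; ring
  have h3 : ‖∑ j, v j‖ ^ 2 = (t + 1) * (‖φ‖ ^ 2 + t * ‖(inner ℂ ψ φ : ℂ)‖ ^ 2) := by
    have : ((‖∑ j, v j‖ ^ 2 : ℝ) : ℂ)
        = (((t + 1) * (‖φ‖ ^ 2 + t * ‖(inner ℂ ψ φ : ℂ)‖ ^ 2) : ℝ) : ℂ) := by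
      rw [Complex.ofReal_pow, ← Complex.coe_algebraMap, ← inner_self_eq_norm_sq_to_K (𝕜 := ℂ), sum_inner]
      simp only [inner_sum, hvv]
      have : ∀ i : Fin (t + 1), ∑ j, (if i = j then ((‖φ‖ ^ 2 : ℝ) : ℂ) else
          ((‖(inner ℂ ψ φ : ℂ)‖ ^ 2 : ℝ) : ℂ)) = ((‖φ‖ ^ 2 : ℝ) : ℂ) + t *
          ((‖(inner ℂ ψ φ : ℂ)‖ ^ 2 : ℝ) : ℂ) := by
        intro i
        rw [← Finset.add_sum_erase _ _ (Finset.mem_univ i), if_pos rfl,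
          Finset.sum_congr rfl (g := fun _ => ((‖(inner ℂ ψ φ : ℂ)‖ ^ 2 : ℝ) : ℂ))]
        · simp
        · intro j hj; rw [if_neg (Finset.ne_of_mem_erase hj).symm]
      simp only [this, Finset.sum_const, Finset.card_univ, Fintype.card_fin]
      push_cast; simp; ring
    exact_mod_cast this
  have h4 : ‖(inner ℂ p (∑ j, v j) : ℂ)‖ ≤ ‖p‖ * ‖∑ j, v j‖ := norm_inner_le_norm _ _
  have h5 : ((t + 1) * ‖p‖ ^ 2) ^ 2 ≤ ‖p‖ ^ 2 * ((t + 1) * (‖φ‖ ^ 2 + t * ‖(inner ℂ ψ φ : ℂ)‖ ^ 2)) := by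
    rw [← h3, ← mul_pow]
    exact pow_le_pow_left₀ (by positivity) (h2.trans_le h4) 2
  rw [le_div_iff₀ hT]
  rcases (sq_nonneg ‖p‖).eq_or_lt with h0 | h0
  · rw [← h0]; simp; positivity
  · refine le_of_mul_le_mul_left ?_ (mul_pos h0 hT)
    nlinarith [h5]

lemma permTestProb_sum {ι : Type*} (S : Finset ι) (M : ι → Matrix (Fin s → d) (Fin s → d) ℂ) :
    permTestProb (∑ i ∈ S, M i) = ∑ i ∈ S, permTestProb (M i) := by
  simp [permTestProb, Matrix.mul_sum, Matrix.trace_sum]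

/-- The permutation test on `ψ ⊗ ⋯ ⊗ ψ ⊗ σ`. -/
lemma permTestProb_le {t : ℕ} {ψ : EuclideanSpace ℂ d} (hψ : ‖ψ‖ = 1) {σ : Matrix d d ℂ}
    (hσ : σ.PosSemidef) :
    permTestProb (s := t + 1) (Matrix.of fun x y =>
      (∏ i : Fin t, ψ (x i.castSucc) * star (ψ (y i.castSucc))) * σ (x (Fin.last t)) (y (Fin.last t)))
      ≤ (σ.trace.re + t * (∑ a, ∑ b, star (ψ a) * σ a b * ψ b).re) / (t + 1) := by
  obtain ⟨m, v, rfl⟩ := Matrix.posSemidef_iff_eq_sum_vecMulVec.1 hσ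
  set φ : Fin m → EuclideanSpace ℂ d := fun i => WithLp.toLp 2 (v i) with hφ
  have e1 : (Matrix.of fun x y : Fin (t + 1) → d =>
      (∏ i : Fin t, ψ (x i.castSucc) * star (ψ (y i.castSucc))) *
        (∑ i, Matrix.vecMulVec (v i) (star (v i))) (x (Fin.last t)) (y (Fin.last t)))
      = ∑ l, Matrix.vecMulVec
        (prodVec (Function.update (fun _ => ψ) (Fin.last t) (φ l)) : (Fin (t + 1) → d) → ℂ)
        (star (prodVec (Function.update (fun _ => ψ) (Fin.last t) (φ l)) : (Fin (t + 1) → d) → ℂ)) := by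
    ext x y
    simp only [Matrix.of_apply, Matrix.sum_apply, Matrix.vecMulVec_apply, Finset.mul_sum]
    refine Finset.sum_congr rfl fun l _ => ?_
    simp [prodVec, Fin.prod_univ_castSucc, (Fin.castSucc_lt_last _).ne, Finset.prod_mul_distrib, hφ]
    ring
  have e2 : (∑ i, Matrix.vecMulVec (v i) (star (v i))).trace.re = ∑ l, ‖φ l‖ ^ 2 := by
    rw [Matrix.trace_sum, Complex.re_sum]
    refine Finset.sum_congr rfl fun l _ => ?_
    rw [Matrix.trace_vecMulVec, EuclideanSpace.norm_sq_eq]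
    simp [dotProduct, hφ, Complex.mul_conj, Complex.normSq_eq_norm_sq, -Complex.ofReal_pow]
  have e3 : (∑ a, ∑ b, star (ψ a) * (∑ i, Matrix.vecMulVec (v i) (star (v i))) a b * ψ b).re
      = ∑ l, ‖(inner ℂ ψ (φ l) : ℂ)‖ ^ 2 := by
    have : (∑ a, ∑ b, star (ψ a) * (∑ i, Matrix.vecMulVec (v i) (star (v i))) a b * ψ b)
        = ∑ l, (inner ℂ ψ (φ l) : ℂ) * inner ℂ (φ l) ψ := by
      simp only [Matrix.sum_apply, Matrix.vecMulVec_apply, Finset.mul_sum, Finset.sum_mul,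
        PiLp.inner_apply, RCLike.inner_apply]
      simp only [hφ, Pi.star_apply]
      rw [Finset.sum_congr rfl fun a _ => Finset.sum_comm, Finset.sum_comm]
      refine Finset.sum_congr rfl fun l _ => ?_
      rw [Finset.sum_comm]
      refine Finset.sum_congr rfl fun b _ => Finset.sum_congr rfl fun a _ => ?_
      simp only [RCLike.star_def]
      ring
    rw [this, Complex.re_sum]
    refine Finset.sum_congr rfl fun l _ => ?_
    rw [← inner_conj_symm ψ (φ l), RCLike.conj_mul, RCLike.norm_conj]
    simp [← Complex.ofReal_pow]
  rw [e1, permTestProb_sum, e2, e3, Finset.mul_sum, ← Finset.sum_add_distrib, Finset.sum_div]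
  refine Finset.sum_le_sum fun l _ => ?_
  rw [permTestProb_vecMulVec]
  exact norm_starProjection_prodVec_le hψ (φ l) (Fin.last t)

end PermutationTest

section Forgeries

variable {A B P Q R : Type} [Fintype A] [DecidableEq A] [Fintype B] [DecidableEq B]
  [Fintype P] [DecidableEq P] [Fintype Q] [DecidableEq Q] [Fintype R] [DecidableEq R]

lemma trace_pureState {ψ : Ket Q} (hψ : ‖ψ‖ = 1) : (pureState ψ).trace = 1 := by
  have : (pureState ψ).trace = inner ℂ ψ ψ := by
    rw [PiLp.inner_apply]
    rfl
  rw [this, inner_self_eq_norm_sq_to_K, hψ]; simp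

lemma trace_pureState_mul (ψ : Ket Q) (X : Op Q) :
    (pureState ψ * X).trace = ∑ a, ∑ b, star (ψ a) * X a b * ψ b := by
  simp only [Matrix.trace, Matrix.diag_apply, Matrix.mul_apply, pureState, Matrix.of_apply]
  rw [Finset.sum_comm]
  refine Finset.sum_congr rfl fun a _ => Finset.sum_congr rfl fun b _ => ?_
  ring

lemma applyRight_tensor {Φ : Op A → Op B} (hΦ : IsLinearMap ℂ Φ) (X : Op P) (Y : Op A) :
    applyRight Φ (tensor X Y) = tensor X (Φ Y) := by
  ext x y
  simp only [applyRight, tensor, Matrix.of_apply]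
  rw [← smul_eq_mul, ← Matrix.smul_apply, ← hΦ.map_smul]
  rfl

lemma reduce_slot_tensorFamily {t n : ℕ} (i : Fin t) (ρ : Fin t → Op (Fin n))
    (hρ : ∀ j, (ρ j).trace = 1) : reduce (slot n i) (tensorFamily ρ) = ρ i := by
  ext a b
  rw [reduce_eq_sum_ite, ← (Equiv.curry (Fin t) (Fin n) Bool).symm.sum_comp]
  have h : ∀ x : Fin t → Fin n → Bool,
      (if (Equiv.curry (Fin t) (Fin n) Bool).symm x ∘ slot n i = a then
        tensorFamily ρ ((Equiv.curry (Fin t) (Fin n) Bool).symm x) (Function.extend (slot n i) b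
          ((Equiv.curry (Fin t) (Fin n) Bool).symm x)) else 0)
      = ∏ j, if j = i then (if x j = a then ρ j (x j) b else 0) else ρ j (x j) (x j) := by
    intro x
    have h1 : (Equiv.curry (Fin t) (Fin n) Bool).symm x ∘ slot n i = x i := rfl
    rw [h1, ← Finset.mul_prod_erase _ _ (Finset.mem_univ i), if_pos rfl]
    simp only [tensorFamily, Matrix.of_apply, extend_slot]
    rw [← Finset.mul_prod_erase _ _ (Finset.mem_univ i), ite_mul, zero_mul]
    simp only [if_true]
    congr 1
    congr 1
    refine Finset.prod_congr rfl fun j hj => ?_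
    simp [Finset.ne_of_mem_erase hj]
  rw [Finset.sum_congr rfl fun x _ => h x, ← Fintype.piFinset_univ,
    ← Finset.prod_univ_sum (fun _ => Finset.univ) fun j (y : Fin n → Bool) =>
      if j = i then (if y = a then ρ j y b else 0) else ρ j y y]
  rw [Finset.prod_eq_single i]
  · simp
  · intro j _ hj
    simp only [hj, if_false]; exact hρ j
  · simp

/-- The first message copy together with the tag. -/
def firstCopy {t n s : ℕ} (i : Fin t) : Fin n ⊕ Fin s ↪ (Fin t × Fin n) ⊕ Fin s :=
  (slot n i).sumMap (Function.Embedding.refl _)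

lemma reduce_refl (X : Op A) : reduce (Function.Embedding.refl A) X = X := by
  ext a b
  have h : ∀ x, Function.extend (Function.Embedding.refl A) b x = b := by
    intro x; ext i; exact (Function.Embedding.refl A).injective.extend_apply _ _ i
  have h' : ∀ x : A → Bool, x ∘ Function.Embedding.refl A = x := fun _ => rfl
  simp [reduce_eq_sum_ite, h, h']

lemma reduce_firstCopy_tensor {t n s : ℕ} (i : Fin t) {ψ : Ket (Fin n)} (hψ : ‖ψ‖ = 1)
    (Y : Op (Fin s)) :
    reduce (firstCopy i) (tensor (tensorFamily fun _ : Fin t => pureState ψ) Y)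
      = tensor (pureState ψ) Y := by
  rw [firstCopy, reduce_tensor, reduce_refl, reduce_slot_tensorFamily i _ fun _ => trace_pureState hψ]

variable {t n s q : ℕ} {Φ : Op (Fin s) → Op (Fin n)} {msg : Fin q → Ket (Fin n)}

lemma permTestProb_collect_tensor_le (hΦ : IsLinearMap ℂ Φ) (htr : ∀ X, (Φ X).trace = X.trace)
    (hpos : ∀ X, X.PosSemidef → (Φ X).PosSemidef) {ψ : Ket (Fin n)} {φ : Ket (Fin s)}
    (hψ : ‖ψ‖ = 1) (hφ : ‖φ‖ = 1) :
    permTestProb (collect (applyRight Φ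
      (tensor (tensorFamily fun _ : Fin t => pureState ψ) (pureState φ))))
      ≤ (1 + t * ((pureState ψ * Φ (pureState φ)).trace).re) / (t + 1) := by
  rw [applyRight_tensor hΦ]
  have h := permTestProb_le (t := t) hψ (hpos _ (posSemidef_pureState φ))
  rw [htr, trace_pureState hφ, Complex.one_re, ← trace_pureState_mul] at h
  exact h

lemma isLinearMap_collect : IsLinearMap ℂ (collect (t := t) (n := n)) where
  map_add _ _ := rfl
  map_smul _ _ := rfl

/-- The message copy `i` and the verified tag. -/
noncomputable def verifiedPair (Φ : Op (Fin s) → Op (Fin n)) (i : Fin t) (X : Op ((Fin t × Fin n) ⊕ Fin s)) :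
    Op (Fin n ⊕ Fin n) :=
  applyRight Φ (reduce (firstCopy i) X)

lemma isLinearMap_verifiedPair (hΦ : IsLinearMap ℂ Φ) (i : Fin t) :
    IsLinearMap ℂ (verifiedPair (n := n) Φ i) where
  map_add X Y := by
    rw [verifiedPair, (isLinearMap_reduce _).map_add, (isLinearMap_applyRight hΦ).map_add]; rfl
  map_smul c X := by
    rw [verifiedPair, (isLinearMap_reduce _).map_smul, (isLinearMap_applyRight hΦ).map_smul]; rfl

lemma verifiedPair_tensor (hΦ : IsLinearMap ℂ Φ) (i : Fin t) {ψ : Ket (Fin n)} (hψ : ‖ψ‖ = 1)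
    (Y : Op (Fin s)) :
    verifiedPair Φ i (tensor (tensorFamily fun _ : Fin t => pureState ψ) Y)
      = tensor (pureState ψ) (Φ Y) := by
  rw [verifiedPair, reduce_firstCopy_tensor i hψ, applyRight_tensor hΦ]

lemma real_smul_eq {ι : Type} (a : ℝ) (X : Matrix ι ι ℂ) : a • X = (a : ℂ) • X := by
  ext i j; simp

lemma permTestProb_collect_combo (hΦ : IsLinearMap ℂ Φ) (X Y : Op ((Fin t × Fin n) ⊕ Fin s))
    (a b : ℝ) : permTestProb (collect (applyRight Φ (a • X + b • Y)))
      = a * permTestProb (collect (applyRight Φ X)) + b * permTestProb (collect (applyRight Φ Y)) := by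
  rw [real_smul_eq, real_smul_eq, (isLinearMap_applyRight hΦ).map_add,
    (isLinearMap_applyRight hΦ).map_smul, (isLinearMap_applyRight hΦ).map_smul,
    isLinearMap_collect.map_add, isLinearMap_collect.map_smul, isLinearMap_collect.map_smul]
  simp [permTestProb, Matrix.mul_add, Matrix.trace_add, Matrix.trace_smul]

lemma isLinearMap_swapValue : IsLinearMap ℂ (swapValue (A := A)) where
  map_add X Y := by simp [swapValue, Finset.sum_add_distrib]
  map_smul c X := by simp [swapValue, Finset.mul_sum]

/-- A forger wins with probability at most one. -/
lemma permTestProb_le_one_of_zero (hΦ : IsLinearMap ℂ Φ) (htr : ∀ X, (Φ X).trace = X.trace)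
    (hpos : ∀ X, X.PosSemidef → (Φ X).PosSemidef) (ht : t = 0) {X : Op ((Fin t × Fin n) ⊕ Fin s)}
    (hX : X ∈ convexHull ℝ (forgeries t msg)) :
    permTestProb (collect (applyRight Φ X)) ≤ 1 := by
  refine convexHull_min (t := {X | permTestProb (collect (applyRight Φ X)) ≤ 1}) ?_ ?_ hX
  · rintro _ ⟨ψ, φ, hψ, hφ, -, rfl⟩
    have := permTestProb_collect_tensor_le (t := t) hΦ htr hpos hψ hφ
    subst ht
    simpa using this
  · intro X hX Y hY a b ha hb hab
    simp only [Set.mem_ofPred_eq] at *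
    rw [permTestProb_collect_combo hΦ]
    nlinarith [mul_le_mul_of_nonneg_left hX ha, mul_le_mul_of_nonneg_left hY hb]

/-- The winning probability of a forger is governed by the overlap of a single copy of the forged
message with the verified tag. -/
lemma permTestProb_le_swapValue (hΦ : IsLinearMap ℂ Φ) (htr : ∀ X, (Φ X).trace = X.trace)
    (hpos : ∀ X, X.PosSemidef → (Φ X).PosSemidef) (i : Fin t) {X : Op ((Fin t × Fin n) ⊕ Fin s)}
    (hX : X ∈ convexHull ℝ (forgeries t msg)) :
    permTestProb (collect (applyRight Φ X)) ≤ (1 + t * (swapValue (verifiedPair Φ i X)).re) / (t + 1) := by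
  refine convexHull_min (t := {X | permTestProb (collect (applyRight Φ X))
    ≤ (1 + t * (swapValue (verifiedPair Φ i X)).re) / (t + 1)}) ?_ ?_ hX
  · rintro _ ⟨ψ, φ, hψ, hφ, -, rfl⟩
    rw [Set.mem_ofPred_eq, verifiedPair_tensor hΦ i hψ, swapValue_tensor]
    exact permTestProb_collect_tensor_le hΦ htr hpos hψ hφ
  · intro X hX Y hY a b ha hb hab
    simp only [Set.mem_ofPred_eq] at *
    rw [permTestProb_collect_combo hΦ, real_smul_eq, real_smul_eq,
      (isLinearMap_verifiedPair hΦ i).map_add, (isLinearMap_verifiedPair hΦ i).map_smul,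
      (isLinearMap_verifiedPair hΦ i).map_smul, isLinearMap_swapValue.map_add,
      isLinearMap_swapValue.map_smul, isLinearMap_swapValue.map_smul]
    have e : (1 + t * ((a : ℂ) • swapValue (verifiedPair Φ i X)
        + (b : ℂ) • swapValue (verifiedPair Φ i Y)).re) / ((t : ℝ) + 1)
        = a * ((1 + t * (swapValue (verifiedPair Φ i X)).re) / (t + 1))
          + b * ((1 + t * (swapValue (verifiedPair Φ i Y)).re) / (t + 1)) := by
      have : (1 : ℝ) = a + b := hab.symm
      simp only [smul_eq_mul, Complex.add_re, Complex.re_ofReal_mul]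
      field_simp
      linear_combination this
    rw [e]
    exact add_le_add (mul_le_mul_of_nonneg_left hX ha) (mul_le_mul_of_nonneg_left hY hb)

/-- The forged message is orthogonal to the queried messages. -/
lemma swapValue_forgery_eq_zero (hΦ : IsLinearMap ℂ Φ) (i : Fin t) {τ : Op (Fin n)}
    (hτ : ∀ ψ : Ket (Fin n), (∀ j, inner ℂ (msg j) ψ = 0) → (pureState ψ * τ).trace = 0)
    {X : Op ((Fin t × Fin n) ⊕ Fin s)} (hX : X ∈ convexHull ℝ (forgeries t msg)) :
    swapValue (tensor (reduce Function.Embedding.inl (verifiedPair Φ i X)) τ) = 0 := by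
  have hlin : ∀ (a b : ℝ) (X Y : Op ((Fin t × Fin n) ⊕ Fin s)),
      swapValue (tensor (reduce Function.Embedding.inl (verifiedPair Φ i (a • X + b • Y))) τ)
      = a * swapValue (tensor (reduce Function.Embedding.inl (verifiedPair Φ i X)) τ)
      + b * swapValue (tensor (reduce Function.Embedding.inl (verifiedPair Φ i Y)) τ) := by
    intro a b X Y
    rw [real_smul_eq, real_smul_eq,
      (isLinearMap_verifiedPair hΦ i).map_add, (isLinearMap_verifiedPair hΦ i).map_smul,
      (isLinearMap_verifiedPair hΦ i).map_smul, (isLinearMap_reduce _).map_add,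
      (isLinearMap_reduce _).map_smul, (isLinearMap_reduce _).map_smul]
    simp [swapValue_tensor, Matrix.add_mul, Matrix.trace_add, Matrix.trace_smul]
  refine convexHull_min (t := {X | swapValue (tensor (reduce Function.Embedding.inl
    (verifiedPair Φ i X)) τ) = 0}) ?_ ?_ hX
  · rintro _ ⟨ψ, φ, hψ, hφ, h, rfl⟩
    rw [Set.mem_ofPred_eq, verifiedPair_tensor hΦ i hψ, reduce_tensor_inl, swapValue_tensor,
      Matrix.smul_mul, Matrix.trace_smul, hτ ψ h, smul_zero]
  · intro X hX Y hY a b ha hb hab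
    simp only [Set.mem_ofPred_eq] at *
    rw [hlin, hX, hY]; simp

end Forgeries

section OracleCircuits

lemma trace_tensorFamily {q n : ℕ} (ρ : Fin q → Op (Fin n)) :
    (tensorFamily ρ).trace = ∏ i, (ρ i).trace := by
  simp only [Matrix.trace, Matrix.diag_apply, Finset.prod_univ_sum, Fintype.piFinset_univ]
  exact (Equiv.sum_comp (Equiv.curry (Fin q) (Fin n) Bool).symm _).symm

lemma tensorFamily_pureState {q n : ℕ} (χ : Fin q → Ket (Fin n)) :
    tensorFamily (fun i => pureState (χ i))
      = pureState (WithLp.toLp 2 fun x => ∏ i, χ i fun j => x (i, j)) := by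
  ext x y
  simp [tensorFamily, pureState, Finset.prod_mul_distrib]

lemma withAux_eq_initZero {n m : ℕ} (X : Op (Fin n)) :
    withAux (m := m) X = initZero (Fin.castAddEmb m) X := by
  ext x y
  have h : (AuxZero x ∧ AuxZero y) ↔
      ∀ i, i ∉ Set.range (Fin.castAddEmb (n := n) m) → x i = false ∧ y i = false := by
    constructor
    · rintro ⟨hx, hy⟩ i hi
      induction i using Fin.addCases with
      | left i => exact absurd ⟨i, rfl⟩ hi
      | right i => exact ⟨hx i, hy i⟩
    · intro h
      have : ∀ j : Fin m, Fin.natAdd n j ∉ Set.range (Fin.castAddEmb (n := n) m) := by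
        rintro j ⟨i, hi⟩
        have := congrArg Fin.val hi
        simp at this; omega
      exact ⟨fun j => (h _ (this j)).1, fun j => (h _ (this j)).2⟩
  simp only [withAux, initZero, Matrix.of_apply]
  by_cases h' : AuxZero x ∧ AuxZero y
  · rw [if_pos h', if_pos (h.1 h')]; rfl
  · rw [if_neg h', if_neg (fun h'' => h' (h.2 h''))]

lemma traceAux_eq_reduce {n m : ℕ} (X : Op (Fin (n + m))) :
    traceAux X = reduce (Fin.castAddEmb m) X := by
  ext a b
  have hx : ∀ (a : Fin n → Bool) (z : Fin m → Bool), Fin.append a z ∘ Fin.castAddEmb m = a := by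
    intro a z; ext i; simp
  have he : ∀ z : Fin m → Bool, Function.extend (Fin.castAddEmb m) b (Fin.append a z)
      = Fin.append b z := by
    intro z; ext i
    induction i using Fin.addCases with
    | left i =>
      rw [Fin.append_left]; exact (Fin.castAddEmb (n := n) m).injective.extend_apply b _ i
    | right i =>
      rw [Function.extend_apply', Fin.append_right, Fin.append_right]
      rintro ⟨j, hj⟩
      have := congrArg Fin.val hj
      simp at this; omega
  rw [reduce_eq_sum_ite, ← (Fin.appendEquiv n m).sum_comp, Fintype.sum_prod_type,
    Finset.sum_eq_single a]
  · simp only [traceAux, Matrix.of_apply]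
    refine Finset.sum_congr rfl fun z _ => ?_
    change _ = if Fin.append a z ∘ Fin.castAddEmb m = a then X (Fin.append a z)
      (Function.extend (Fin.castAddEmb m) b (Fin.append a z)) else 0
    rw [hx, he, if_pos rfl]
  · intro c _ hc
    refine Finset.sum_eq_zero fun z _ => if_neg fun h => hc ?_
    rw [← h]; exact (hx c z).symm
  · simp

lemma traceAux_withAux {n m : ℕ} (X : Op (Fin n)) : traceAux (withAux (m := m) X) = X := by
  rw [withAux_eq_initZero, traceAux_eq_reduce, reduce_initZero]

lemma isLinearMap_traceAux {n m : ℕ} : IsLinearMap ℂ (traceAux (n := n) (m := m)) := by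
  have : traceAux (n := n) (m := m) = reduce (Fin.castAddEmb m) := funext traceAux_eq_reduce
  rw [this]; exact isLinearMap_reduce _

lemma isLinearMap_withAux {n m : ℕ} : IsLinearMap ℂ (withAux (n := n) (m := m)) := by
  have : withAux (n := n) (m := m) = initZero (Fin.castAddEmb m) := funext withAux_eq_initZero
  rw [this]; exact isLinearMap_initZero _

lemma isLinearMap_comp {A B C : Type} {Φ : Op A → Op B} {Ψ : Op B → Op C}
    (hΨ : IsLinearMap ℂ Ψ) (hΦ : IsLinearMap ℂ Φ) : IsLinearMap ℂ fun X => Ψ (Φ X) where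
  map_add X Y := by rw [hΦ.map_add, hΨ.map_add]
  map_smul c X := by rw [hΦ.map_smul, hΨ.map_smul]

lemma withAux_pureState {n m : ℕ} (ψ : Ket (Fin n)) :
    ∃ χ : Ket (Fin (n + m)), withAux (pureState ψ) = pureState χ := by
  refine ⟨WithLp.toLp 2 fun x => if AuxZero x then ψ (x ∘ Fin.castAdd m) else 0, ?_⟩
  ext x y
  by_cases hx : AuxZero x <;> by_cases hy : AuxZero y <;> simp [withAux, pureState, hx, hy]

/-- An oracle circuit for a single value of the security parameter. -/
structure OracleCircuit (𝒢 : GateSet) (n m : ℕ) where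
  wires : ℕ
  advice : Op (Fin wires)
  advice_density : IsDensity advice
  steps : List (OracleStep 𝒢 n m wires)
  out : Fin wires

/-- The number of steps plus the number of wires. -/
def OracleCircuit.size {𝒢 : GateSet} {n m : ℕ} (D : OracleCircuit 𝒢 n m) : ℕ :=
  D.steps.length + D.wires

/-- Probability that the output wire is measured as `1`. -/
noncomputable def OracleCircuit.prob {𝒢 : GateSet} {n m : ℕ} (D : OracleCircuit 𝒢 n m)
    (O : Oracles n m) : ℝ :=
  let ρ := D.steps.foldl (fun X s => s.run O X) D.advice
  ∑ x : Fin D.wires → Bool, if x D.out = true then (ρ x x).re else 0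

/-- The state `|+⟩⟨+|`. -/
noncomputable def plusState : Op (Fin 1) := Matrix.of fun _ _ => 1 / 2

lemma isDensity_plusState : IsDensity plusState := by
  constructor
  · have : plusState = (1 / 2 : ℂ) • Matrix.vecMulVec (1 : (Fin 1 → Bool) → ℂ) (star 1) := by
      ext x y; simp [plusState]
    rw [this]
    exact (Matrix.posSemidef_vecMulVec_self_star _).smul (by simp)
  · simp [Matrix.trace, plusState]

/-- Place a gate on the wires of a larger circuit. -/
def Gate.map {𝒢 : GateSet} {w w' : ℕ} (f : Fin w ↪ Fin w') (g : Gate 𝒢 w) : Gate 𝒢 w' :=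
  ⟨g.op, g.mem, g.wires.trans f⟩

variable {𝒢 : GateSet} {n m w w' : ℕ} {R : Type} [Fintype R] [DecidableEq R]

lemma foldl_map_gate (f : Fin w ⊕ R ↪ Fin w') (L : List (Gate 𝒢 w)) (X : Op (Fin w)) (Y : Op R) :
    (L.map (Gate.map (Function.Embedding.inl.trans f))).foldl (fun Y g => g.run Y)
      (initZero f (tensor X Y)) = initZero f (tensor (L.foldl (fun Y g => g.run Y) X) Y) := by
  induction L generalizing X with
  | nil => rfl
  | cons g L ih =>
    rw [List.map_cons, List.foldl_cons, List.foldl_cons, ← ih]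
    congr 1
    have h := isLinearMap_conj (g.op.2)
    change _ = initZero f (tensor (applyOn g.wires (fun X => g.op.2 * X * g.op.2ᴴ) X) Y)
    rw [← applyOn_tensor g.wires h, ← applyOn_initZero _ f h]
    rfl

lemma foldl_gate_steps (O : Oracles n m) (L : List (Gate 𝒢 w)) (X : Op (Fin w)) :
    (L.map (OracleStep.gate (n := n) (m := m))).foldl (fun X s => s.run O X) X
      = L.foldl (fun Y g => g.run Y) X := by
  rw [List.foldl_map]; rfl

lemma foldl_applyOn_slot {q k : ℕ} {Ψ : Op (Fin k) → Op (Fin k)} (hΨ : IsLinearMap ℂ Ψ)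
    (L : List (Fin q)) (hL : L.Nodup) (ρ : Fin q → Op (Fin k)) :
    L.foldl (fun X i => applyOn (slot k i) Ψ X) (tensorFamily ρ)
      = tensorFamily fun i => if i ∈ L then Ψ (ρ i) else ρ i := by
  induction L generalizing ρ with
  | nil => simp
  | cons i L ih =>
    rw [List.foldl_cons, applyOn_tensorFamily i hΨ, ih (List.nodup_cons.1 hL).2]
    congr 1
    ext j : 1
    by_cases hj : j = i
    · subst hj; simp [(List.nodup_cons.1 hL).1]
    · simp [hj]

lemma foldl_initZero_tensor {q k : ℕ} {M Q : Type} [Fintype M] [DecidableEq M] [Fintype Q]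
    [DecidableEq Q] {Ψ : Op (Fin k) → Op (Fin k)} (hΨ : IsLinearMap ℂ Ψ)
    (e : (Fin q × Fin k) ⊕ M ↪ Q) (μ : Op M) (L : List (Fin q)) (X : Op (Fin q × Fin k)) :
    L.foldl (fun X i => applyOn (((slot k i).trans Function.Embedding.inl).trans e) Ψ X)
      (initZero e (tensor X μ))
      = initZero e (tensor (L.foldl (fun X i => applyOn (slot k i) Ψ X) X) μ) := by
  induction L generalizing X with
  | nil => rfl
  | cons i L ih =>
    rw [List.foldl_cons, List.foldl_cons, applyOn_initZero _ _ hΨ, applyOn_tensor _ hΨ, ih]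

/-- The state of the signature game after the queries and the second stage. -/
noncomputable def gameState {q t r : ℕ}
    (C : Circuit 𝒢 ((Fin q × Fin (n + m)) ⊕ Fin r) ((Fin t × Fin n) ⊕ Fin (n + m)))
    (msg : Fin q → Ket (Fin n)) (μ : Op (Fin r)) (O : Oracles n m) : Op (Fin C.wires) :=
  C.gates.foldl (fun Y g => g.run Y)
    (initZero C.inp (tensor (tensorFamily fun i => O.fwd (pureState (msg i))) μ))

/-- The signature game followed by the verification of the tag and a swap test of the two registers
selected by `e` can be run by a small oracle circuit. -/
lemma exists_oracleCircuit {q t r : ℕ}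
    (C : Circuit 𝒢 ((Fin q × Fin (n + m)) ⊕ Fin r) ((Fin t × Fin n) ⊕ Fin (n + m)))
    (msg : Fin q → Ket (Fin n)) (hmsg : ∀ i, ‖msg i‖ = 1) {μ : Op (Fin r)} (hμ : IsDensity μ)
    {τ : Op (Fin n)} (hτ : IsDensity τ) (e : Fin n ⊕ Fin n ↪ Fin C.wires ⊕ (Fin n ⊕ Fin 1))
    (he : ∀ i, e i ≠ Sum.inr (Sum.inr 0)) :
    ∃ D : OracleCircuit 𝒢 n m, D.size ≤ q + C.size + 85 * n + 3 ∧
      ∀ O : Oracles n m, IsLinearMap ℂ O.fwd → IsLinearMap ℂ O.bwd →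
        D.prob O = (((applyOn (Function.Embedding.inr.trans C.out) (fun X => withAux (O.bwd X))
            (gameState C msg μ O)).trace).re
          - (swapValue (reduce e (tensor (applyOn (Function.Embedding.inr.trans C.out)
            (fun X => withAux (O.bwd X)) (gameState C msg μ O)) (tensor τ plusState)))).re) / 2 := by
  classical
  set f : Fin C.wires ⊕ (Fin n ⊕ Fin 1) ↪ Fin (C.wires + (n + 1)) :=
    (((Equiv.refl _).sumCongr finSumFinEquiv).trans finSumFinEquiv).toEmbedding with hf
  set c := f (Sum.inr (Sum.inr 0)) with hc
  obtain ⟨σ, h1, h2, h3, Lσ, hLσ, hσ⟩ := implements_cswap_registers (𝒢 := 𝒢) c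
    (fun i => f (e (Sum.inl i))) (fun i => f (e (Sum.inr i)))
    (fun i j h => Sum.inl.inj (e.injective (f.injective h)))
    (fun i j h => Sum.inr.inj (e.injective (f.injective h)))
    (fun i j h => by cases e.injective (f.injective h))
    (fun i h => he _ (f.injective h).symm) (fun i h => he _ (f.injective h).symm)
  obtain ⟨LH, hLH, hH⟩ := implements_hadamard (𝒢 := 𝒢) c
  have hadv : IsDensity (initZero f (tensor (initZero C.inp (tensor
      (tensorFamily fun i => withAux (pureState (msg i))) μ)) (tensor τ plusState))) := by
    constructor
    · refine posSemidef_initZero _ (posSemidef_tensor (posSemidef_initZero _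
        (posSemidef_tensor ?_ hμ.1)) (posSemidef_tensor hτ.1 isDensity_plusState.1))
      choose χ hχ using fun i => withAux_pureState (m := m) (msg i)
      simp only [hχ, tensorFamily_pureState]
      exact posSemidef_pureState _
    · simp only [trace_initZero, trace_tensor, trace_tensorFamily, hμ.2, hτ.2,
        isDensity_plusState.2, withAux_eq_initZero, trace_pureState (hmsg _)]
      simp
  refine ⟨⟨C.wires + (n + 1), _, hadv,
    (List.finRange q).map (fun i => OracleStep.fwd ((((slot (n + m) i).trans
      Function.Embedding.inl).trans C.inp).trans (Function.Embedding.inl.trans f)))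
    ++ ((C.gates.map (Gate.map (Function.Embedding.inl.trans f))).map OracleStep.gate
    ++ (OracleStep.bwd ((Function.Embedding.inr.trans C.out).trans
      (Function.Embedding.inl.trans f)) ::
      ((Lσ ++ LH).map OracleStep.gate))), c⟩, ?_, ?_⟩
  · simp only [OracleCircuit.size, List.length_append, List.length_map, List.length_cons,
      List.length_finRange, Circuit.size]
    omega
  · intro O hF hB
    have hΨ : IsLinearMap ℂ fun X : Op (Fin (n + m)) => O.fwd (traceAux X) := isLinearMap_comp hF isLinearMap_traceAux
    have hΨ' : IsLinearMap ℂ fun X => withAux (m := m) (O.bwd X) :=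
      isLinearMap_comp isLinearMap_withAux hB
    have s1 : ((List.finRange q).map (fun i => OracleStep.fwd (𝒢 := 𝒢) ((((slot (n + m) i).trans
        Function.Embedding.inl).trans C.inp).trans (Function.Embedding.inl.trans f)))).foldl
        (fun X s => s.run O X) (initZero f (tensor (initZero C.inp (tensor
        (tensorFamily fun i => withAux (pureState (msg i))) μ)) (tensor τ plusState)))
        = initZero f (tensor (initZero C.inp (tensor (tensorFamily fun i =>
          O.fwd (pureState (msg i))) μ)) (tensor τ plusState)) := by
      have : ∀ (L : List (Fin q)) (X : Op (Fin C.wires)),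
          L.foldl (fun X i => applyOn ((((slot (n + m) i).trans
          Function.Embedding.inl).trans C.inp).trans (Function.Embedding.inl.trans f))
          (fun X => O.fwd (traceAux X)) X) (initZero f (tensor X (tensor τ plusState)))
          = initZero f (tensor (L.foldl (fun X i => applyOn (((slot (n + m) i).trans
          Function.Embedding.inl).trans C.inp) (fun X => O.fwd (traceAux X)) X) X)
            (tensor τ plusState)) := by
        intro L
        induction L with
        | nil => intro X; rfl
        | cons i L ih =>
          intro X
          rw [List.foldl_cons, List.foldl_cons, ← ih]
          congr 1
          rw [← applyOn_tensor _ hΨ, ← applyOn_initZero _ f hΨ]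
          rfl
      rw [List.foldl_map]
      refine (this _ _).trans ?_
      rw [foldl_initZero_tensor hΨ, foldl_applyOn_slot hΨ _ (List.nodup_finRange q)]
      simp [traceAux_withAux]
    have s3 : ∀ X : Op (Fin C.wires), (OracleStep.bwd (𝒢 := 𝒢)
        ((Function.Embedding.inr.trans C.out).trans (Function.Embedding.inl.trans f))).run O
        (initZero f (tensor X (tensor τ plusState))) = initZero f (tensor
        (applyOn (Function.Embedding.inr.trans C.out) (fun X => withAux (O.bwd X)) X)
        (tensor τ plusState)) := by
      intro X
      rw [← applyOn_tensor _ hΨ', ← applyOn_initZero _ f hΨ']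
      rfl
    simp only [OracleCircuit.prob, List.foldl_append, s1]
    rw [foldl_gate_steps, foldl_map_gate, List.foldl_cons, s3, foldl_gate_steps, List.foldl_append,
      hσ, hH]
    set T := tensor (applyOn (Function.Embedding.inr.trans C.out) (fun X => withAux (O.bwd X))
      (gameState C msg μ O)) (tensor τ plusState) with hT
    have hσc : σ c = c := h3 c (fun i h => he _ (f.injective h).symm)
      fun i h => he _ (f.injective h).symm
    have hσσ : ∀ i, σ (σ i) = i := by
      intro i
      by_cases hi : ∃ j, i = f (e (Sum.inl j))
      · obtain ⟨j, rfl⟩ := hi; rw [h1, h2]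
      by_cases hi' : ∃ j, i = f (e (Sum.inr j))
      · obtain ⟨j, rfl⟩ := hi'; rw [h2, h1]
      push Not at hi hi'
      rw [h3 i hi hi', h3 i hi hi']
    have hcc : ∀ x y u v, initZero f T (Function.update x c u) (Function.update y c v)
        = initZero f T x y := by
      intro x y u v
      have e1 : ∀ (x : Fin (C.wires + (n + 1)) → Bool) u i, i ∉ Set.range f →
          Function.update x c u i = x i := by
        intro x u i hi
        exact Function.update_of_ne (fun h => hi ⟨_, h.symm⟩) _ _
      have e2 : ∀ (x : Fin (C.wires + (n + 1)) → Bool) u,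
          Function.update x c u ∘ f = Function.update (x ∘ f) (Sum.inr (Sum.inr 0)) u := by
        intro x u
        exact Function.update_comp_eq_of_injective _ f.injective _ _
      have e3 : (∀ i, i ∉ Set.range f → Function.update x c u i = false ∧
          Function.update y c v i = false) ↔ ∀ i, i ∉ Set.range f → x i = false ∧ y i = false :=
        forall₂_congr fun i hi => by rw [e1 x u i hi, e1 y v i hi]
      simp only [initZero, Matrix.of_apply, e2, hT, tensor, plusState]
      by_cases h' : ∀ i, i ∉ Set.range f → x i = false ∧ y i = false
      · rw [if_pos h', if_pos (e3.2 h')]; rfl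
      · rw [if_neg h', if_neg (fun h'' => h' (e3.1 h''))]
    have := swap_test (X := initZero f T) hcc hσc hσσ
    refine this.trans ?_
    have e4 : ∀ x, x ∉ Set.range (e.trans f) → σ x = x := fun x hx =>
      h3 x (fun i h => hx ⟨_, h.symm⟩) fun i h => hx ⟨_, h.symm⟩
    rw [sum_perm_eq_swapValue (e.trans f) h1 h2 e4, ← reduce_reduce, reduce_initZero,
      trace_initZero, hT, trace_tensor, trace_tensor, hτ.2, isDensity_plusState.2, mul_one, mul_one]

/-- The message copy `i` and the first part of the tag, as wires of the second stage. -/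
def pairWires {q t r : ℕ}
    (C : Circuit 𝒢 ((Fin q × Fin (n + m)) ⊕ Fin r) ((Fin t × Fin n) ⊕ Fin (n + m))) (i : Fin t) :
    Fin n ⊕ Fin n ↪ Fin C.wires :=
  (((Function.Embedding.refl _).sumMap (Fin.castAddEmb m)).trans (firstCopy i)).trans C.out

lemma reduce_pairWires {q t r : ℕ}
    (C : Circuit 𝒢 ((Fin q × Fin (n + m)) ⊕ Fin r) ((Fin t × Fin n) ⊕ Fin (n + m))) (i : Fin t)
    {Φ : Op (Fin (n + m)) → Op (Fin n)} (hΦ : IsLinearMap ℂ Φ) (Y : Op (Fin C.wires)) :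
    reduce (pairWires C i) (applyOn (Function.Embedding.inr.trans C.out)
      (fun X => withAux (Φ X)) Y) = verifiedPair Φ i (reduce C.out Y) := by
  have h : (Function.Embedding.inr.trans C.out : Fin (n + m) ↪ Fin C.wires)
      = Function.Embedding.inr.trans ((firstCopy i).trans C.out) := rfl
  have h' : pairWires C i = ((Function.Embedding.refl _).sumMap (Fin.castAddEmb m)).trans
      ((firstCopy i).trans C.out) := rfl
  rw [h, h', ← reduce_reduce, reduce_applyOn_inr _ (isLinearMap_comp isLinearMap_withAux hΦ),
    reduce_applyRight, verifiedPair, reduce_reduce]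
  simp only [withAux_eq_initZero, reduce_initZero]

/-- The output of the second stage in the game with oracles `O`. -/
noncomputable def gameOutput {q t r : ℕ}
    (C : Circuit 𝒢 ((Fin q × Fin (n + m)) ⊕ Fin r) ((Fin t × Fin n) ⊕ Fin (n + m)))
    (msg : Fin q → Ket (Fin n)) (μ : Op (Fin r)) (O : Oracles n m) :
    Op ((Fin t × Fin n) ⊕ Fin (n + m)) :=
  C.run (tensor (tensorFamily fun i => O.fwd (pureState (msg i))) μ)

section Tests

variable {q t r : ℕ}
  (C : Circuit 𝒢 ((Fin q × Fin (n + m)) ⊕ Fin r) ((Fin t × Fin n) ⊕ Fin (n + m)))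
  (msg : Fin q → Ket (Fin n)) {μ : Op (Fin r)} {τ : Op (Fin n)} (i : Fin t)

lemma trace_verified_gameState (hmsg : ∀ i, ‖msg i‖ = 1) (hμ : IsDensity μ) {O : Oracles n m} (hF : ∀ X, (O.fwd X).trace = X.trace)
    (hB : ∀ X, (O.bwd X).trace = X.trace) :
    ((applyOn (Function.Embedding.inr.trans C.out) (fun X => withAux (O.bwd X))
            (gameState C msg μ O)).trace) = 1 := by
  rw [trace_applyOn _ (fun X => by rw [withAux_eq_initZero, trace_initZero, hB]), gameState,
    trace_foldl_run, trace_initZero, trace_tensor, trace_tensorFamily, hμ.2]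
  simp [hF, trace_pureState (hmsg _)]

/-- The swap test of the forged message with the verified tag. -/
lemma exists_tag_test (hmsg : ∀ i, ‖msg i‖ = 1) (hμ : IsDensity μ) :
    ∃ D : OracleCircuit 𝒢 n m, D.size ≤ q + C.size + 85 * n + 3 ∧
      ∀ O : Oracles n m, IsLinearMap ℂ O.fwd → IsLinearMap ℂ O.bwd →
        (∀ X, (O.fwd X).trace = X.trace) → (∀ X, (O.bwd X).trace = X.trace) →
        D.prob O = (1 - (swapValue (verifiedPair O.bwd i (gameOutput C msg μ O))).re) / 2 := by
  have hτ : IsDensity (basisState fun _ : Fin n => false) :=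
    ⟨posSemidef_basisState _, trace_basisState _⟩
  obtain ⟨D, hD, h⟩ := exists_oracleCircuit C msg hmsg hμ hτ
    ((pairWires C i).trans Function.Embedding.inl) (fun i h => by cases h)
  refine ⟨D, hD, fun O hF hB hF' hB' => ?_⟩
  rw [h O hF hB, trace_verified_gameState C msg hmsg hμ hF' hB', ← reduce_reduce, reduce_tensor_inl,
    trace_tensor, hτ.2, isDensity_plusState.2, mul_one, one_smul, reduce_pairWires C i hB]
  rfl

/-- The swap test of the forged message with the state `τ`. -/
lemma exists_overlap_test (hmsg : ∀ i, ‖msg i‖ = 1) (hμ : IsDensity μ) (hτ : IsDensity τ) :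
    ∃ D : OracleCircuit 𝒢 n m, D.size ≤ q + C.size + 85 * n + 3 ∧
      ∀ O : Oracles n m, IsLinearMap ℂ O.fwd → IsLinearMap ℂ O.bwd →
        (∀ X, (O.fwd X).trace = X.trace) → (∀ X, (O.bwd X).trace = X.trace) →
        D.prob O = (1 - (swapValue (tensor (reduce Function.Embedding.inl
          (verifiedPair O.bwd i (gameOutput C msg μ O))) τ)).re) / 2 := by
  obtain ⟨D, hD, h⟩ := exists_oracleCircuit C msg hmsg hμ hτ
    ((Function.Embedding.inl.trans (pairWires C i)).sumMap Function.Embedding.inl)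
    (fun i h => by rcases i with i | i <;> cases h)
  refine ⟨D, hD, fun O hF hB hF' hB' => ?_⟩
  rw [h O hF hB, trace_verified_gameState C msg hmsg hμ hF' hB', reduce_tensor, reduce_tensor_inl,
    ← reduce_reduce, reduce_pairWires C i hB, isDensity_plusState.2, one_smul]
  rfl

end Tests

end OracleCircuits

section Haar

variable {ι : Type} [Fintype ι] [DecidableEq ι]

instance : IsProbabilityMeasure (haarUnitary ι) :=
  ⟨by simpa [haarUnitary] using Measure.haarMeasure_self (K₀ := (⊤ : TopologicalSpace.PositiveCompacts
    (Matrix.unitaryGroup ι ℂ)))⟩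

instance : (haarUnitary ι).IsHaarMeasure := by unfold haarUnitary; infer_instance

instance : (haarUnitary ι).IsMulRightInvariant where
  map_mul_right_eq_self g := by
    have : IsProbabilityMeasure (Measure.map (· * g) (haarUnitary ι)) :=
      Measure.isProbabilityMeasure_map (by fun_prop)
    exact Measure.isHaarMeasure_eq_of_isProbabilityMeasure _ _

lemma integrable_haarUnitary {E : Type*} [NormedAddCommGroup E] {f : Matrix.unitaryGroup ι ℂ → E}
    (hf : Continuous f) : Integrable f (haarUnitary ι) :=
  hf.integrable_of_hasCompactSupport (HasCompactSupport.of_compactSpace f)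

lemma continuous_of_isLinearMap {κ : Type} [Fintype κ] {Φ : Matrix ι ι ℂ → Matrix κ κ ℂ}
    (hΦ : IsLinearMap ℂ Φ) : Continuous Φ :=
  (hΦ.mk' Φ).continuous_of_finiteDimensional

lemma posSemidef_integral {κ : Type} [Fintype κ] {M : Matrix.unitaryGroup ι ℂ → Matrix κ κ ℂ}
    (hM : Continuous M) (hpos : ∀ S, (M S).PosSemidef) :
    (Matrix.of fun a b => ∫ S, M S a b ∂haarUnitary ι).PosSemidef := by
  have hc : ∀ a b, Continuous fun S => M S a b := fun a b => hM.matrix_elem a b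
  refine Matrix.PosSemidef.of_dotProduct_mulVec_nonneg ?_ fun x => ?_
  · ext a b
    simp only [Matrix.conjTranspose_apply, Matrix.of_apply]
    rw [RCLike.star_def, ← integral_conj]
    refine integral_congr_ae (Eventually.of_forall fun S => ?_)
    exact (hpos S).1.apply a b
  · have h : star x ⬝ᵥ ((Matrix.of fun a b => ∫ S, M S a b ∂haarUnitary ι) *ᵥ x)
        = ∫ S, star x ⬝ᵥ (M S *ᵥ x) ∂haarUnitary ι := by
      simp only [dotProduct, Matrix.mulVec, Matrix.of_apply]
      rw [integral_finsetSum]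
      · refine Finset.sum_congr rfl fun a _ => ?_
        rw [integral_const_mul, integral_finsetSum]
        · simp only [integral_mul_const]
        · intro b _
          exact (integrable_haarUnitary (hc a b)).mul_const _
      · intro a _
        refine integrable_haarUnitary ?_
        exact continuous_const.mul (continuous_finsetSum _ fun b _ => (hc a b).mul continuous_const)
    rw [h]
    have h2 : ∀ S, star x ⬝ᵥ (M S *ᵥ x) = (((star x ⬝ᵥ (M S *ᵥ x)).re : ℝ) : ℂ) := fun S =>
      (Complex.eq_re_of_ofReal_le (r := 0) (by simpa using (hpos S).dotProduct_mulVec_nonneg x))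
    rw [integral_congr_ae (Eventually.of_forall h2),
      show (∫ S, (((star x ⬝ᵥ (M S *ᵥ x)).re : ℝ) : ℂ) ∂haarUnitary ι)
        = ((∫ S, (star x ⬝ᵥ (M S *ᵥ x)).re ∂haarUnitary ι : ℝ) : ℂ) from integral_ofReal]
    have : 0 ≤ ∫ S, (star x ⬝ᵥ (M S *ᵥ x)).re ∂haarUnitary ι :=
      integral_nonneg fun S => (Complex.le_def.1 ((hpos S).dotProduct_mulVec_nonneg x)).1
    exact_mod_cast this

end Haar

section InverseIsometry

variable {n m : ℕ}

/-- The basis states of `n + m` qubits are those whose last `m` qubits are zero and the others. -/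
def auxSplit (n m : ℕ) : {x : Fin (n + m) → Bool // AuxZero x} ⊕ {x : Fin (n + m) → Bool // ¬ AuxZero x}
    ≃ (Fin (n + m) → Bool) := Equiv.sumCompl AuxZero

lemma extendById_eq (S : Matrix.unitaryGroup {x : Fin (n + m) → Bool // ¬ AuxZero x} ℂ) :
    extendById S = (Matrix.fromBlocks 1 0 0 S.1).submatrix (auxSplit n m).symm (auxSplit n m).symm := by
  ext x y
  obtain ⟨p, rfl⟩ := (auxSplit n m).surjective x
  obtain ⟨p', rfl⟩ := (auxSplit n m).surjective y
  rw [Matrix.submatrix_apply, Equiv.symm_apply_apply, Equiv.symm_apply_apply]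
  rcases p with ⟨a, ha⟩ | ⟨a, ha⟩ <;> rcases p' with ⟨b, hb⟩ | ⟨b, hb⟩ <;>
    simp [extendById, auxSplit, ha, hb, Matrix.one_apply]
  · rintro rfl; exact hb ha
  · rintro rfl; exact ha hb

lemma extendById_mul (S S' : Matrix.unitaryGroup {x : Fin (n + m) → Bool // ¬ AuxZero x} ℂ) :
    extendById S * extendById S' = extendById (S * S') := by
  simp [extendById_eq, Matrix.submatrix_mul_equiv, Matrix.fromBlocks_multiply]

lemma extendById_mem (S : Matrix.unitaryGroup {x : Fin (n + m) → Bool // ¬ AuxZero x} ℂ) :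
    extendById S ∈ Matrix.unitaryGroup (Fin (n + m) → Bool) ℂ := by
  rw [Matrix.mem_unitaryGroup_iff, extendById_eq, Matrix.star_eq_conjTranspose,
    Matrix.conjTranspose_submatrix, Matrix.submatrix_mul_equiv, Matrix.fromBlocks_conjTranspose,
    Matrix.fromBlocks_multiply]
  have := Matrix.mem_unitaryGroup_iff.1 S.2
  rw [Matrix.star_eq_conjTranspose] at this
  simp [this]

lemma continuous_extendById : Continuous (extendById (n := n) (m := m)) := by
  refine continuous_matrix fun x y => ?_
  simp only [extendById, Matrix.of_apply]
  split_ifs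
  · exact (continuous_subtype_val.matrix_elem _ _)
  · exact continuous_const
  · exact continuous_const

/-- Two unitaries that are consistent with the same isometry differ by a unitary of the orthogonal
complement. -/
lemma exists_extendById {U U' : Op (Fin (n + m))}
    (hU : U ∈ Matrix.unitaryGroup (Fin (n + m) → Bool) ℂ)
    (hU' : U' ∈ Matrix.unitaryGroup (Fin (n + m) → Bool) ℂ) (h : isoOf U = isoOf U') :
    ∃ S, U' = U * extendById S := by
  have hW : Uᴴ * U' ∈ Matrix.unitaryGroup (Fin (n + m) → Bool) ℂ := mul_mem (Unitary.star_mem hU) hU'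
  have hcol : ∀ x y, AuxZero y → (Uᴴ * U') x y = (1 : Op (Fin (n + m))) x y := by
    intro x y hy
    have hy' : y = Fin.append (y ∘ Fin.castAdd m) fun _ => false := by
      ext i
      induction i using Fin.addCases with
      | left i => simp
      | right i => simp [hy i]
    have h1 := Matrix.mem_unitaryGroup_iff'.1 hU
    rw [← h1, Matrix.star_eq_conjTranspose, Matrix.mul_apply, Matrix.mul_apply]
    refine Finset.sum_congr rfl fun z _ => ?_
    congr 1
    have := congrFun (congrFun h z) (y ∘ Fin.castAdd m)
    simp only [isoOf, Matrix.of_apply] at this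
    rw [hy', this]
  set W := (Uᴴ * U').submatrix (auxSplit n m) (auxSplit n m) with hWdef
  have hWu : Wᴴ * W = 1 := by
    rw [hWdef, Matrix.conjTranspose_submatrix, Matrix.submatrix_mul_equiv,
      ← Matrix.star_eq_conjTranspose, Matrix.mem_unitaryGroup_iff'.1 hW, Matrix.submatrix_one_equiv]
  have h11 : W.toBlocks₁₁ = 1 := by
    ext a b
    have := hcol (auxSplit n m (Sum.inl a)) (auxSplit n m (Sum.inl b)) b.2
    simpa [Matrix.toBlocks₁₁, hWdef, Matrix.one_apply, Subtype.ext_iff] using this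
  have h21 : W.toBlocks₂₁ = 0 := by
    ext a b
    have := hcol (auxSplit n m (Sum.inr a)) (auxSplit n m (Sum.inl b)) b.2
    simpa [Matrix.toBlocks₂₁, hWdef, Matrix.one_apply, Subtype.ext_iff] using this
  rw [← Matrix.fromBlocks_toBlocks W, h11, h21, Matrix.fromBlocks_conjTranspose,
    Matrix.fromBlocks_multiply, ← Matrix.fromBlocks_one, Matrix.fromBlocks_inj] at hWu
  obtain ⟨-, h12, -, h22⟩ := hWu
  simp only [Matrix.conjTranspose_one, Matrix.conjTranspose_zero, add_zero,
    Matrix.one_mul, Matrix.zero_mul] at h12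
  rw [h12] at h22
  simp only [Matrix.conjTranspose_zero, Matrix.zero_mul, zero_add] at h22
  refine ⟨⟨W.toBlocks₂₂, Matrix.mem_unitaryGroup_iff'.2 h22⟩, ?_⟩
  have hWW : extendById ⟨W.toBlocks₂₂, Matrix.mem_unitaryGroup_iff'.2 h22⟩ = Uᴴ * U' := by
    rw [extendById_eq, ← h11, ← h12, ← h21]
    simp only
    rw [Matrix.fromBlocks_toBlocks, hWdef]
    simp
  rw [hWW, ← mul_assoc, ← Matrix.star_eq_conjTranspose, Matrix.mem_unitaryGroup_iff.1 hU, one_mul]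

/-- The average of `Tr_Aux (S† Z S)` over the unitaries `S` of the orthogonal complement. -/
noncomputable def complementTwirl (Z : Op (Fin (n + m))) : Op (Fin n) :=
  Matrix.of fun a b => ∫ S, traceAux ((extendById S)ᴴ * Z * extendById S) a b
    ∂haarUnitary {x : Fin (n + m) → Bool // ¬ AuxZero x}

lemma continuous_traceAux_conj (Z : Op (Fin (n + m))) :
    Continuous fun S => traceAux (n := n) (m := m) ((extendById S)ᴴ * Z * extendById S) := by
  refine (continuous_of_isLinearMap isLinearMap_traceAux).comp ?_
  exact (continuous_extendById.matrix_conjTranspose.matrix_mul continuous_const).matrix_mul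
    continuous_extendById

lemma isLinearMap_complementTwirl : IsLinearMap ℂ (complementTwirl (n := n) (m := m)) where
  map_add X Y := by
    ext a b
    simp only [complementTwirl, Matrix.of_apply, Matrix.add_apply]
    rw [← integral_add]
    · simp only [Matrix.mul_add, Matrix.add_mul, isLinearMap_traceAux.map_add, Matrix.add_apply]
    · exact integrable_haarUnitary ((continuous_traceAux_conj X).matrix_elem a b)
    · exact integrable_haarUnitary ((continuous_traceAux_conj Y).matrix_elem a b)
  map_smul c X := by
    ext a b
    simp only [complementTwirl, Matrix.of_apply, Matrix.smul_apply, Matrix.mul_smul,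
      Matrix.smul_mul, isLinearMap_traceAux.map_smul, smul_eq_mul, integral_const_mul]

lemma inverseIso_isoOf {U : Op (Fin (n + m))} (hU : U ∈ Matrix.unitaryGroup (Fin (n + m) → Bool) ℂ)
    (X : Op (Fin (n + m))) : inverseIso (isoOf U) X = complementTwirl (Uᴴ * X * U) := by
  have h : ∃ U₀ ∈ Matrix.unitaryGroup (Fin (n + m) → Bool) ℂ, isoOf (n := n) (m := m) U₀ = isoOf U :=
    ⟨U, hU, rfl⟩
  obtain ⟨S₀, hS₀⟩ := exists_extendById h.choose_spec.1 hU h.choose_spec.2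
  rw [inverseIso, dif_pos h]
  ext a b
  simp only [complementTwirl, Matrix.of_apply]
  rw [← integral_mul_left_eq_self _ S₀]
  refine integral_congr_ae (Eventually.of_forall fun S => ?_)
  simp only
  congr 1
  have e : h.choose * extendById (S₀ * S) = U * extendById S := by
    rw [← extendById_mul, ← mul_assoc, ← hS₀]
  rw [e]
  simp only [Matrix.conjTranspose_mul, mul_assoc]

lemma isLinearMap_inverseIso_isoOf {U : Op (Fin (n + m))}
    (hU : U ∈ Matrix.unitaryGroup (Fin (n + m) → Bool) ℂ) :
    IsLinearMap ℂ (inverseIso (n := n) (m := m) (isoOf U)) where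
  map_add X Y := by
    simp only [inverseIso_isoOf hU, Matrix.mul_add, Matrix.add_mul, isLinearMap_complementTwirl.map_add]
  map_smul c X := by
    simp only [inverseIso_isoOf hU, Matrix.mul_smul, Matrix.smul_mul,
      isLinearMap_complementTwirl.map_smul]

lemma trace_conj_unitary' {ι : Type} [Fintype ι] [DecidableEq ι] {U : Matrix ι ι ℂ}
    (hU : U ∈ Matrix.unitaryGroup ι ℂ) (X : Matrix ι ι ℂ) : (Uᴴ * X * U).trace = X.trace := by
  have := trace_conj_unitary (Unitary.star_mem hU) X
  rwa [Matrix.star_eq_conjTranspose, Matrix.conjTranspose_conjTranspose] at this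

lemma trace_complementTwirl (Z : Op (Fin (n + m))) : (complementTwirl Z).trace = Z.trace := by
  have h : (complementTwirl Z).trace = ∫ S, (traceAux ((extendById S)ᴴ * Z * extendById S)).trace
      ∂haarUnitary {x : Fin (n + m) → Bool // ¬ AuxZero x} := by
    simp only [Matrix.trace, Matrix.diag_apply, complementTwirl, Matrix.of_apply]
    rw [integral_finsetSum]
    intro a _
    exact integrable_haarUnitary ((continuous_traceAux_conj Z).matrix_elem a a)
  rw [h]
  simp only [traceAux_eq_reduce, trace_reduce, trace_conj_unitary' (extendById_mem _)]
  simp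

lemma trace_inverseIso_isoOf {U : Op (Fin (n + m))}
    (hU : U ∈ Matrix.unitaryGroup (Fin (n + m) → Bool) ℂ) (X : Op (Fin (n + m))) :
    (inverseIso (isoOf U) X).trace = X.trace := by
  rw [inverseIso_isoOf hU, trace_complementTwirl, trace_conj_unitary' hU]

/-- The operator `W ⊗ 1` on `n + m` qubits. -/
def withId (m : ℕ) (W : Op (Fin n)) : Op (Fin (n + m)) :=
  Matrix.of fun x y => W (x ∘ Fin.castAdd m) (y ∘ Fin.castAdd m)
    * if x ∘ Fin.natAdd n = y ∘ Fin.natAdd n then 1 else 0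

open scoped Kronecker in
lemma withId_eq (W : Op (Fin n)) :
    withId m W = (W ⊗ₖ (1 : Op (Fin m))).submatrix (Fin.appendEquiv n m).symm
      (Fin.appendEquiv n m).symm := by
  ext x y
  simp only [withId, Matrix.of_apply, Matrix.submatrix_apply, Matrix.kroneckerMap_apply,
    Matrix.one_apply]
  rfl

lemma withId_mem {W : Op (Fin n)} (hW : W ∈ Matrix.unitaryGroup (Fin n → Bool) ℂ) :
    withId m W ∈ Matrix.unitaryGroup (Fin (n + m) → Bool) ℂ := by
  have := Matrix.mem_unitaryGroup_iff.1 hW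
  rw [Matrix.star_eq_conjTranspose] at this
  rw [Matrix.mem_unitaryGroup_iff, withId_eq, Matrix.star_eq_conjTranspose,
    Matrix.conjTranspose_submatrix, Matrix.submatrix_mul_equiv, Matrix.conjTranspose_kronecker,
    ← Matrix.mul_kronecker_mul, this]
  simp

lemma sum_withId_append (W : Op (Fin n)) (b : Fin n → Bool) (z : Fin m → Bool)
    (G : (Fin (n + m) → Bool) → ℂ → ℂ) (hG : ∀ x, G x 0 = 0) :
    ∑ x, G x (withId m W x (Fin.append b z)) = ∑ b', G (Fin.append b' z) (W b' b) := by
  rw [← (Fin.appendEquiv n m).sum_comp, Fintype.sum_prod_type]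
  refine Finset.sum_congr rfl fun b' _ => ?_
  have h : ∀ z', withId m W (Fin.append b' z') (Fin.append b z) = if z' = z then W b' b else 0 := by
    intro z'
    have h1 : ∀ (a : Fin n → Bool) (c : Fin m → Bool), Fin.append a c ∘ Fin.castAdd m = a := by
      intro a c; ext i; simp
    have h2 : ∀ (a : Fin n → Bool) (c : Fin m → Bool), Fin.append a c ∘ Fin.natAdd n = c := by
      intro a c; ext i; simp
    simp [withId, h1, h2]
  change ∑ z', G (Fin.append b' z') (withId m W (Fin.append b' z') (Fin.append b z)) = _
  simp only [h]
  rw [Finset.sum_eq_single z]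
  · simp
  · intro z' _ hz; simp [hz, hG]
  · simp

lemma isoOf_mul_withId (U : Op (Fin (n + m))) (W : Op (Fin n)) :
    isoOf (U * withId m W) = isoOf U * W := by
  ext x y
  simp only [isoOf, Matrix.of_apply, Matrix.mul_apply]
  exact sum_withId_append W y _ (fun z c => U x z * c) fun z => mul_zero _

lemma traceAux_withId_conj (W : Op (Fin n)) (Z : Op (Fin (n + m))) :
    traceAux ((withId m W)ᴴ * Z * withId m W) = Wᴴ * traceAux Z * W := by
  ext a b
  simp only [traceAux, Matrix.of_apply, Matrix.mul_apply, Matrix.conjTranspose_apply]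
  have h : ∀ z : Fin m → Bool, ∑ x, (∑ y, star (withId m W y (Fin.append a z)) * Z y x)
      * withId m W x (Fin.append b z)
      = ∑ b', (∑ a', star (W a' a) * Z (Fin.append a' z) (Fin.append b' z)) * W b' b := by
    intro z
    rw [sum_withId_append W b z (fun x c => (∑ y, star (withId m W y (Fin.append a z)) * Z y x) * c)
      fun x => mul_zero _]
    refine Finset.sum_congr rfl fun b' _ => ?_
    congr 1
    exact sum_withId_append W a z (fun y c => star c * Z y (Fin.append b' z)) (by simp)
  simp only [h]
  rw [Finset.sum_comm]
  refine Finset.sum_congr rfl fun b' _ => ?_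
  rw [← Finset.sum_mul, Finset.sum_comm]
  simp only [Finset.mul_sum]

/-- Conjugation by `W ⊗ 1` preserves the unitaries of the orthogonal complement. -/
lemma exists_withId_mul_extendById {W : Op (Fin n)}
    (hW : W ∈ Matrix.unitaryGroup (Fin n → Bool) ℂ) :
    ∃ B : Matrix.unitaryGroup {x : Fin (n + m) → Bool // ¬ AuxZero x} ℂ,
      ∀ S, withId m W * extendById S = extendById (B * S * B⁻¹) * withId m W := by
  set V := (withId m W).submatrix (auxSplit n m) (auxSplit n m) with hV
  have hz : ∀ x y : Fin (n + m) → Bool, ¬ (AuxZero x ↔ AuxZero y) → withId m W x y = 0 := by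
    intro x y hxy
    simp only [withId, Matrix.of_apply]
    rw [if_neg, mul_zero]
    intro h
    exact hxy (forall_congr' fun j => by rw [show x (Fin.natAdd n j) = y (Fin.natAdd n j) from
      congrFun h j])
  have h12 : V.toBlocks₁₂ = 0 := by
    ext a b
    exact hz _ _ fun h => b.2 (h.1 a.2)
  have h21 : V.toBlocks₂₁ = 0 := by
    ext a b
    exact hz _ _ fun h => a.2 (h.2 b.2)
  have hVu : Vᴴ * V = 1 := by
    rw [hV, Matrix.conjTranspose_submatrix, Matrix.submatrix_mul_equiv,
      ← Matrix.star_eq_conjTranspose, Matrix.mem_unitaryGroup_iff'.1 (withId_mem hW),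
      Matrix.submatrix_one_equiv]
  rw [← Matrix.fromBlocks_toBlocks V, h12, h21, Matrix.fromBlocks_conjTranspose,
    Matrix.fromBlocks_multiply, ← Matrix.fromBlocks_one, Matrix.fromBlocks_inj] at hVu
  obtain ⟨-, -, -, h22⟩ := hVu
  simp only [Matrix.conjTranspose_zero, Matrix.zero_mul, zero_add] at h22
  set B : Matrix.unitaryGroup {x : Fin (n + m) → Bool // ¬ AuxZero x} ℂ :=
    ⟨V.toBlocks₂₂, Matrix.mem_unitaryGroup_iff'.2 h22⟩ with hB
  have hV' : withId m W = (Matrix.fromBlocks V.toBlocks₁₁ 0 0 B.1).submatrix (auxSplit n m).symm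
      (auxSplit n m).symm := by
    rw [hB, ← h12]
    simp only
    rw [show (0 : Matrix {x : Fin (n + m) → Bool // ¬ AuxZero x}
      {x : Fin (n + m) → Bool // AuxZero x} ℂ) = V.toBlocks₂₁ from h21.symm,
      Matrix.fromBlocks_toBlocks, hV]
    simp
  refine ⟨B, fun S => ?_⟩
  rw [hV', extendById_eq, extendById_eq, Matrix.submatrix_mul_equiv, Matrix.submatrix_mul_equiv,
    Matrix.fromBlocks_multiply, Matrix.fromBlocks_multiply]
  have : (B.1 * S.1 : Matrix _ _ ℂ) = (B * S * B⁻¹ : Matrix.unitaryGroup _ ℂ).1 * B.1 := by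
    rw [← Submonoid.coe_mul, ← Submonoid.coe_mul]; simp
  rw [Matrix.zero_mul, Matrix.zero_mul, Matrix.zero_mul, Matrix.zero_mul, this]
  simp

lemma complementTwirl_withId {W : Op (Fin n)} (hW : W ∈ Matrix.unitaryGroup (Fin n → Bool) ℂ)
    (Z : Op (Fin (n + m))) :
    complementTwirl ((withId m W)ᴴ * Z * withId m W) = Wᴴ * complementTwirl Z * W := by
  obtain ⟨B, hB⟩ := exists_withId_mul_extendById (m := m) hW
  ext a b
  have h1 : ∀ S, traceAux ((extendById S)ᴴ * ((withId m W)ᴴ * Z * withId m W) * extendById S)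
      = Wᴴ * traceAux ((extendById (B * S * B⁻¹))ᴴ * Z * extendById (B * S * B⁻¹)) * W := by
    intro S
    rw [← traceAux_withId_conj]
    congr 1
    calc _ = (withId m W * extendById S)ᴴ * Z * (withId m W * extendById S) := by
          simp only [Matrix.conjTranspose_mul, mul_assoc]
      _ = _ := by rw [hB]; simp only [Matrix.conjTranspose_mul, mul_assoc]
  have h2 := fun g : Matrix.unitaryGroup {x : Fin (n + m) → Bool // ¬ AuxZero x} ℂ → ℂ =>
    (integral_mul_right_eq_self (μ := haarUnitary _) (fun S => g (B * S)) B⁻¹).trans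
      (integral_mul_left_eq_self (μ := haarUnitary _) g B)
  have h3 := fun c d => (continuous_traceAux_conj Z).matrix_elem c d
  simp only [complementTwirl, Matrix.of_apply, h1]
  simp only [← mul_assoc] at h2
  rw [h2 fun S => (Wᴴ * traceAux ((extendById S)ᴴ * Z * extendById S) * W) a b]
  simp only [Matrix.mul_apply (N := W), Matrix.mul_apply (M := Wᴴ), Matrix.of_apply]
  rw [integral_finsetSum]
  · refine Finset.sum_congr rfl fun d _ => ?_
    rw [integral_mul_const, integral_finsetSum]
    · simp only [integral_const_mul]
    · intro c _
      exact (integrable_haarUnitary (h3 c d)).const_mul _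
  · intro d _
    refine integrable_haarUnitary ?_
    exact (continuous_finsetSum _ fun c _ => continuous_const.mul (h3 c d)).mul continuous_const

lemma inverseIso_isoOf_mul {U : Op (Fin (n + m))}
    (hU : U ∈ Matrix.unitaryGroup (Fin (n + m) → Bool) ℂ) {W : Op (Fin n)}
    (hW : W ∈ Matrix.unitaryGroup (Fin n → Bool) ℂ) (X : Op (Fin (n + m))) :
    inverseIso (isoOf (U * withId m W)) X = Wᴴ * inverseIso (isoOf U) X * W := by
  rw [inverseIso_isoOf (mul_mem hU (withId_mem hW)), inverseIso_isoOf hU,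
    ← complementTwirl_withId hW]
  simp only [Matrix.conjTranspose_mul, mul_assoc]

lemma posSemidef_applyRight_conj {A B P : Type} [Fintype A] [DecidableEq A] [Fintype B]
    [DecidableEq B] [Fintype P] [DecidableEq P] (K : Matrix (B → Bool) (A → Bool) ℂ)
    {X : Op (P ⊕ A)} (hX : X.PosSemidef) :
    (applyRight (fun Y => K * Y * Kᴴ) X).PosSemidef := by
  set K' : Matrix (P ⊕ B → Bool) (P ⊕ A → Bool) ℂ := Matrix.of fun x y =>
    if x ∘ Sum.inl = y ∘ Sum.inl then K (x ∘ Sum.inr) (y ∘ Sum.inr) else 0 with hK'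
  have : applyRight (fun Y => K * Y * Kᴴ) X = K' * X * K'ᴴ := by
    ext x y
    simp only [applyRight, Matrix.of_apply, Matrix.mul_apply, Matrix.conjTranspose_apply, hK',
      sum_sumArrow, Sum.elim_comp_inl, Sum.elim_comp_inr]
    rw [Finset.sum_eq_single (y ∘ Sum.inl)]
    · refine Finset.sum_congr rfl fun d _ => ?_
      rw [Finset.sum_eq_single (x ∘ Sum.inl)]
      · simp
      · intro c _ hc; simp [Ne.symm hc]
      · simp
    · intro c _ hc; simp [Ne.symm hc]
    · simp
  rw [this]
  exact hX.mul_mul_conjTranspose_same _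

lemma posSemidef_applyRight_inverseIso {P : Type} [Fintype P] [DecidableEq P]
    {U : Op (Fin (n + m))} (hU : U ∈ Matrix.unitaryGroup (Fin (n + m) → Bool) ℂ)
    {X : Op (P ⊕ Fin (n + m))} (hX : X.PosSemidef) :
    (applyRight (inverseIso (isoOf U)) X).PosSemidef := by
  have h : applyRight (inverseIso (isoOf U)) X = Matrix.of fun a b => ∫ S,
      applyRight (fun Y => traceAux ((extendById S)ᴴ * (Uᴴ * Y * U) * extendById S)) X a b
      ∂haarUnitary {x : Fin (n + m) → Bool // ¬ AuxZero x} := by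
    ext x y
    simp only [applyRight, Matrix.of_apply, inverseIso_isoOf hU, complementTwirl]
  rw [h]
  refine posSemidef_integral (M := fun S =>
    applyRight (fun Y => traceAux ((extendById S)ᴴ * (Uᴴ * Y * U) * extendById S)) X) ?_ ?_
  · refine continuous_matrix fun a b => ?_
    exact (continuous_traceAux_conj _).matrix_elem _ _
  · intro S
    have e : (fun Y : Op (Fin (n + m)) => traceAux ((extendById S)ᴴ * (Uᴴ * Y * U) * extendById S))
        = fun Y => reduce (Fin.castAddEmb m) ((U * extendById S)ᴴ * Y * (U * extendById S)ᴴᴴ) := by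
      ext1 Y
      rw [traceAux_eq_reduce]
      simp only [Matrix.conjTranspose_mul, Matrix.conjTranspose_conjTranspose, mul_assoc]
    rw [e, ← reduce_applyRight]
    exact posSemidef_reduce _ (posSemidef_applyRight_conj _ hX)

end InverseIsometry

section Twirl

open scoped Kronecker

variable {ι : Type} [Fintype ι] [DecidableEq ι]

/-- The expectation of the exchange of two registers. -/
def swapSum (X : Matrix (ι × ι) (ι × ι) ℂ) : ℂ := ∑ j, ∑ k, X (j, k) (k, j)

lemma swapSum_eq_trace (X : Matrix (ι × ι) (ι × ι) ℂ) :
    swapSum X = (X.submatrix id Prod.swap).trace := by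
  simp [swapSum, Matrix.trace, Fintype.sum_prod_type]

lemma swapSum_kronecker_conj {B : Matrix ι ι ℂ} (hB : B ∈ Matrix.unitaryGroup ι ℂ)
    (X : Matrix (ι × ι) (ι × ι) ℂ) : swapSum ((B ⊗ₖ B)ᴴ * X * (B ⊗ₖ B)) = swapSum X := by
  have hBB : B ⊗ₖ B ∈ Matrix.unitaryGroup (ι × ι) ℂ := by
    have := Matrix.mem_unitaryGroup_iff.1 hB
    rw [Matrix.star_eq_conjTranspose] at this
    rw [Matrix.mem_unitaryGroup_iff, Matrix.star_eq_conjTranspose, Matrix.conjTranspose_kronecker,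
      ← Matrix.mul_kronecker_mul, this, Matrix.one_kronecker_one]
  have h : ((B ⊗ₖ B)ᴴ * X * (B ⊗ₖ B)).submatrix id Prod.swap
      = (B ⊗ₖ B)ᴴ * X.submatrix id Prod.swap * (B ⊗ₖ B) := by
    ext p ⟨k, l⟩
    rw [Matrix.submatrix_apply, Matrix.mul_assoc, Matrix.mul_assoc, Matrix.mul_apply,
      Matrix.mul_apply]
    refine Finset.sum_congr rfl fun r _ => ?_
    congr 1
    rw [Matrix.mul_apply, Matrix.mul_apply, ← (Equiv.prodComm ι ι).sum_comp]
    refine Finset.sum_congr rfl fun s _ => ?_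
    simp [Matrix.kroneckerMap_apply, mul_comm]
  rw [swapSum_eq_trace, h, trace_conj_unitary' hBB, ← swapSum_eq_trace]

/-- The signs `±1` outside of `A`. -/
def signs (A : Finset ι) (s : ι → Bool) (j : ι) : ℂ := if j ∈ A then 1 else if s j then -1 else 1

/-- The signed permutation matrix of `s` and `π`. -/
def signedPerm (A : Finset ι) (s : ι → Bool) (π : Equiv.Perm ι) : Matrix ι ι ℂ :=
  Matrix.of fun x j => if x = π j then signs A s j else 0

lemma signs_mul_self (A : Finset ι) (s : ι → Bool) (j : ι) : signs A s j * signs A s j = 1 := by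
  simp only [signs]; split_ifs <;> simp

lemma star_signs (A : Finset ι) (s : ι → Bool) (j : ι) : star (signs A s j) = signs A s j := by
  simp only [signs]; split_ifs <;> simp

lemma signedPerm_mem (A : Finset ι) (s : ι → Bool) (π : Equiv.Perm ι) :
    signedPerm A s π ∈ Matrix.unitaryGroup ι ℂ := by
  rw [Matrix.mem_unitaryGroup_iff', Matrix.star_eq_conjTranspose]
  ext j k
  simp only [Matrix.mul_apply, Matrix.conjTranspose_apply, signedPerm, Matrix.of_apply, mul_ite,
    mul_zero, Finset.sum_ite_eq', Finset.mem_univ, if_true, Matrix.one_apply,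
    EmbeddingLike.apply_eq_iff_eq, apply_ite star, star_zero, star_signs]
  by_cases h : j = k
  · subst h; simp [signs_mul_self]
  · simp [h, Ne.symm h]

lemma one_kronecker_signedPerm_conj_apply (A : Finset ι) (s : ι → Bool) (π : Equiv.Perm ι)
    (X : Matrix (ι × ι) (ι × ι) ℂ) (i j k l : ι) :
    (((1 : Matrix ι ι ℂ) ⊗ₖ signedPerm A s π)ᴴ * X * ((1 : Matrix ι ι ℂ) ⊗ₖ signedPerm A s π))
      (i, j) (k, l) = signs A s j * signs A s l * X (i, π j) (k, π l) := by
  simp only [Matrix.mul_apply, Matrix.conjTranspose_apply, Matrix.kroneckerMap_apply, signedPerm,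
    Matrix.of_apply, Fintype.sum_prod_type, Matrix.one_apply, mul_ite, mul_zero, ite_mul, one_mul,
    zero_mul, apply_ite star, star_zero, star_signs, Finset.sum_ite_eq',
    Finset.mem_univ, if_true]
  ring

lemma sum_signs (A : Finset ι) (j k : ι) :
    ∑ s, signs A s k * signs A s j
      = if j = k ∨ (j ∈ A ∧ k ∈ A) then (2 : ℂ) ^ Fintype.card ι else 0 := by
  have hflip : ∀ i, Function.Involutive fun s : ι → Bool => Function.update s i (!s i) := by
    intro i s; simp
  have key : ∀ j k : ι, j ≠ k → j ∉ A → ∑ s, signs A s k * signs A s j = 0 := by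
    intro j k hjk hj
    have : ∑ s, signs A s k * signs A s j = - ∑ s, signs A s k * signs A s j := by
      conv_lhs => rw [← Equiv.sum_comp (hflip j).toPerm]
      rw [← Finset.sum_neg_distrib]
      refine Finset.sum_congr rfl fun s _ => ?_
      have h1 : signs A (Function.update s j (!s j)) k = signs A s k := by
        simp [signs, Function.update_of_ne (Ne.symm hjk)]
      have h2 : signs A (Function.update s j (!s j)) j = - signs A s j := by
        rcases h : s j <;> simp [signs, hj, h]
      simp only [Function.Involutive.coe_toPerm, h1, h2, mul_neg]
    exact self_eq_neg.1 this
  split_ifs with h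
  · have : ∀ s, signs A s k * signs A s j = 1 := by
      intro s
      rcases h with rfl | ⟨hj, hk⟩
      · exact signs_mul_self A s j
      · simp [signs, hj, hk]
    simp [this]
  · push Not at h
    by_cases hj : j ∈ A
    · rw [← key k j (Ne.symm h.1) (h.2 hj)]
      simp only [mul_comm]
    · exact key j k h.1 hj

lemma posSemidef_re_apply_le {κ : Type} [Fintype κ] [DecidableEq κ] {X : Matrix κ κ ℂ}
    (hX : X.PosSemidef) (x y : κ) : (X x y).re ≤ ((X x x).re + (X y y).re) / 2 := by
  have h := hX.dotProduct_mulVec_nonneg (Pi.single x 1 - Pi.single y 1)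
  have h1 : (X y x).re = (X x y).re := by rw [← hX.1.apply x y]; simp
  have h2 := (Complex.le_def.1 h).1
  simp [Matrix.mulVec_sub, star_sub, sub_dotProduct, dotProduct_sub] at h2
  rw [h1] at h2
  linarith

/-- Cyclic shifts of the complement of `A`. -/
lemma exists_shifts (A : Finset ι) (hA : A.card < Fintype.card ι) :
    ∃ π : Fin (Fintype.card ι - A.card) → Equiv.Perm ι, (∀ h, ∀ j ∈ A, π h j = j) ∧
      ∀ j ∉ A, ∀ g : ι → ℝ, ∑ h, g (π h j) = ∑ k ∈ Aᶜ, g k := by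
  have : NeZero (Fintype.card ι - A.card) := ⟨by omega⟩
  have hc : Fintype.card {x // x ∉ A} = Fintype.card (Fin (Fintype.card ι - A.card)) := by
    rw [Fintype.card_fin]; simp [Fintype.card_subtype_compl]
  set e := Fintype.equivOfCardEq hc
  refine ⟨fun h => Equiv.Perm.ofSubtype ((e.trans (Equiv.addRight h)).trans e.symm), ?_, ?_⟩
  · intro h j hj
    exact Equiv.Perm.ofSubtype_apply_of_not_mem _ (by simpa using hj)
  · intro j hj g
    have h1 : ∀ h, Equiv.Perm.ofSubtype ((e.trans (Equiv.addRight h)).trans e.symm) j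
        = (e.symm (e ⟨j, hj⟩ + h)).1 := by
      intro h
      rw [Equiv.Perm.ofSubtype_apply_of_mem (p := fun x => x ∉ A) _ hj]; rfl
    simp only [h1]
    have h2 := Equiv.sum_comp (Equiv.addLeft (e ⟨j, hj⟩)) fun h => g (e.symm h).1
    simp only [Equiv.coe_addLeft] at h2
    rw [h2, e.symm.sum_comp fun x => g x.1]
    rw [Finset.sum_subtype (p := fun x => x ∉ A) _ (fun x => by simp)]

/-- The weight of the first register in the span of the basis vectors in `A`. -/
noncomputable def weight (A : Finset ι) (B : Matrix ι ι ℂ) (X : Matrix (ι × ι) (ι × ι) ℂ) : ℝ :=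
  ∑ j ∈ A, ∑ k, (((B ⊗ₖ B)ᴴ * X * (B ⊗ₖ B)) (j, k) (j, k)).re

/-- Averaging the second register over signed permutations of the complement of `A`. -/
lemma sum_swapSum_le {A : Finset ι} {B : Matrix ι ι ℂ} (hB : B ∈ Matrix.unitaryGroup ι ℂ)
    {X : Matrix (ι × ι) (ι × ι) ℂ} (hX : X.PosSemidef) {d : ℕ} {π : Fin d → Equiv.Perm ι}
    (h1 : ∀ h, ∀ j ∈ A, π h j = j)
    (h2 : ∀ j ∉ A, ∀ g : ι → ℝ, ∑ h, g (π h j) = ∑ k ∈ Aᶜ, g k) :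
    ∑ h, ∑ s, (swapSum (((1 : Matrix ι ι ℂ) ⊗ₖ (B * signedPerm A s (π h) * Bᴴ))ᴴ * X *
        ((1 : Matrix ι ι ℂ) ⊗ₖ (B * signedPerm A s (π h) * Bᴴ)))).re
      ≤ 2 ^ Fintype.card ι * (d * weight A B X + X.trace.re) := by
  set Y := (B ⊗ₖ B)ᴴ * X * (B ⊗ₖ B) with hY
  have hYpos : Y.PosSemidef := hX.conjTranspose_mul_mul_same _
  have hBB : Bᴴ * B = 1 := by
    rw [← Matrix.star_eq_conjTranspose]; exact Matrix.mem_unitaryGroup_iff'.1 hB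
  have e1 : ∀ h s, swapSum (((1 : Matrix ι ι ℂ) ⊗ₖ (B * signedPerm A s (π h) * Bᴴ))ᴴ * X *
        ((1 : Matrix ι ι ℂ) ⊗ₖ (B * signedPerm A s (π h) * Bᴴ)))
      = ∑ j, ∑ k, signs A s k * signs A s j * Y (j, π h k) (k, π h j) := by
    intro h s
    rw [← swapSum_kronecker_conj hB]
    have : ((1 : Matrix ι ι ℂ) ⊗ₖ (B * signedPerm A s (π h) * Bᴴ)) * (B ⊗ₖ B)
        = (B ⊗ₖ B) * ((1 : Matrix ι ι ℂ) ⊗ₖ signedPerm A s (π h)) := by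
      rw [← Matrix.mul_kronecker_mul, ← Matrix.mul_kronecker_mul, one_mul, mul_one,
        Matrix.mul_assoc, hBB, mul_one]
    have e2 : (B ⊗ₖ B)ᴴ * (((1 : Matrix ι ι ℂ) ⊗ₖ (B * signedPerm A s (π h) * Bᴴ))ᴴ * X *
        ((1 : Matrix ι ι ℂ) ⊗ₖ (B * signedPerm A s (π h) * Bᴴ))) * (B ⊗ₖ B)
        = ((1 : Matrix ι ι ℂ) ⊗ₖ signedPerm A s (π h))ᴴ * Y *
          ((1 : Matrix ι ι ℂ) ⊗ₖ signedPerm A s (π h)) := by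
      calc _ = (((1 : Matrix ι ι ℂ) ⊗ₖ (B * signedPerm A s (π h) * Bᴴ)) * (B ⊗ₖ B))ᴴ * X *
          (((1 : Matrix ι ι ℂ) ⊗ₖ (B * signedPerm A s (π h) * Bᴴ)) * (B ⊗ₖ B)) := by
            simp only [Matrix.conjTranspose_mul, mul_assoc]
        _ = _ := by
            rw [this, hY]; simp only [Matrix.conjTranspose_mul, mul_assoc]
    rw [e2]
    simp only [swapSum, one_kronecker_signedPerm_conj_apply]
  have e3 : ∀ h, ∑ s, (∑ j, ∑ k, signs A s k * signs A s j * Y (j, π h k) (k, π h j)).re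
      = 2 ^ Fintype.card ι * (∑ j ∈ A, ∑ k ∈ A, (Y (j, k) (k, j)).re
        + ∑ j ∈ Aᶜ, (Y (j, π h j) (j, π h j)).re) := by
    intro h
    have a1 : ∑ s, ∑ j, ∑ k, signs A s k * signs A s j * Y (j, π h k) (k, π h j)
        = ∑ j, ∑ k, (if j = k ∨ (j ∈ A ∧ k ∈ A) then (2 : ℂ) ^ Fintype.card ι else 0)
          * Y (j, π h k) (k, π h j) := by
      rw [Finset.sum_comm]
      refine Finset.sum_congr rfl fun j _ => ?_
      rw [Finset.sum_comm]
      refine Finset.sum_congr rfl fun k _ => ?_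
      rw [← sum_signs, Finset.sum_mul]
    have a2 : ∀ j ∈ A, ∑ k, (if j = k ∨ (j ∈ A ∧ k ∈ A) then (2 : ℂ) ^ Fintype.card ι else 0)
          * Y (j, π h k) (k, π h j) = 2 ^ Fintype.card ι * ∑ k ∈ A, Y (j, k) (k, j) := by
      intro j hj
      rw [Finset.mul_sum, ← Finset.sum_subset (Finset.subset_univ A)]
      · refine Finset.sum_congr rfl fun k hk => ?_
        rw [if_pos (Or.inr ⟨hj, hk⟩), h1 h j hj, h1 h k hk]
      · intro k _ hk
        rw [if_neg, zero_mul]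
        rintro (rfl | h)
        · exact hk hj
        · exact hk h.2
    have a3 : ∀ j ∈ Aᶜ, ∑ k, (if j = k ∨ (j ∈ A ∧ k ∈ A) then (2 : ℂ) ^ Fintype.card ι else 0)
          * Y (j, π h k) (k, π h j) = 2 ^ Fintype.card ι * Y (j, π h j) (j, π h j) := by
      intro j hj
      rw [Finset.sum_eq_single j]
      · simp
      · intro k _ hk
        rw [if_neg, zero_mul]
        rintro (rfl | h)
        · exact hk rfl
        · exact Finset.mem_compl.1 hj h.1
      · simp
    rw [← Complex.re_sum, a1, ← Finset.sum_add_sum_compl A, Finset.sum_congr rfl a2,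
      Finset.sum_congr rfl a3, ← Finset.mul_sum, ← Finset.mul_sum, ← mul_add,
      show (2 : ℂ) ^ Fintype.card ι = ((2 ^ Fintype.card ι : ℝ) : ℂ) by push_cast; rfl,
      Complex.re_ofReal_mul]
    simp only [Complex.add_re, Complex.re_sum]
  simp only [e1, e3]
  rw [← Finset.mul_sum, Finset.sum_add_distrib]
  refine mul_le_mul_of_nonneg_left ?_ (by positivity)
  have hdiag : ∀ p, 0 ≤ (Y p p).re := fun p => (Complex.le_def.1 hYpos.diag_nonneg).1
  refine add_le_add ?_ ?_
  · rw [Finset.sum_const, Finset.card_univ, Fintype.card_fin, nsmul_eq_mul]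
    refine mul_le_mul_of_nonneg_left ?_ (by positivity)
    calc ∑ j ∈ A, ∑ k ∈ A, (Y (j, k) (k, j)).re
        ≤ ∑ j ∈ A, ∑ k ∈ A, ((Y (j, k) (j, k)).re + (Y (k, j) (k, j)).re) / 2 :=
          Finset.sum_le_sum fun j _ => Finset.sum_le_sum fun k _ => posSemidef_re_apply_le hYpos _ _
      _ = ∑ j ∈ A, ∑ k ∈ A, (Y (j, k) (j, k)).re := by
          simp only [← Finset.sum_div, Finset.sum_add_distrib]
          rw [Finset.sum_comm (f := fun j k => (Y (k, j) (k, j)).re)]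
          ring
      _ ≤ weight A B X := Finset.sum_le_sum fun j _ =>
          Finset.sum_le_univ_sum_of_nonneg fun k => hdiag _
  · rw [Finset.sum_comm, Finset.sum_congr rfl fun j hj => h2 j (Finset.mem_compl.1 hj)
      fun k => (Y (j, k) (j, k)).re]
    have htr : X.trace = Y.trace := by
      have hBB' : B ⊗ₖ B ∈ Matrix.unitaryGroup (ι × ι) ℂ := by
        rw [Matrix.mem_unitaryGroup_iff', Matrix.star_eq_conjTranspose,
          Matrix.conjTranspose_kronecker, ← Matrix.mul_kronecker_mul, hBB, Matrix.one_kronecker_one]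
      rw [hY, trace_conj_unitary' hBB']
    rw [htr, Matrix.trace, Complex.re_sum, Fintype.sum_prod_type]
    calc ∑ j ∈ Aᶜ, ∑ k ∈ Aᶜ, (Y (j, k) (j, k)).re
        ≤ ∑ j ∈ Aᶜ, ∑ k, (Y (j, k) (j, k)).re := Finset.sum_le_sum fun j _ =>
          Finset.sum_le_univ_sum_of_nonneg fun k => hdiag _
      _ ≤ ∑ j, ∑ k, (Y (j, k) (j, k)).re :=
          Finset.sum_le_univ_sum_of_nonneg fun j => Finset.sum_nonneg fun k _ => hdiag _

/-- The weight is an expectation in the marginal of the first register. -/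
lemma weight_eq {A : Finset ι} {B : Matrix ι ι ℂ} (hB : B ∈ Matrix.unitaryGroup ι ℂ)
    (X : Matrix (ι × ι) (ι × ι) ℂ) :
    weight A B X = ∑ j ∈ A, (∑ x, ∑ x', star (B x j) * (∑ y, X (x, y) (x', y)) * B x' j).re := by
  refine Finset.sum_congr rfl fun j _ => ?_
  rw [← Complex.re_sum]
  congr 1
  set N : Matrix ι ι ℂ := Matrix.of fun y y' => ∑ x, ∑ x', star (B x j) * X (x, y) (x', y') * B x' j
    with hN
  have h1 : ∀ k, ((B ⊗ₖ B)ᴴ * X * (B ⊗ₖ B)) (j, k) (j, k) = (Bᴴ * N * B) k k := by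
    intro k
    simp only [Matrix.mul_apply, Matrix.conjTranspose_apply, Matrix.kroneckerMap_apply,
      Fintype.sum_prod_type, hN, Matrix.of_apply, Finset.sum_mul, Finset.mul_sum, star_mul']
    rw [Finset.sum_comm]
    refine Finset.sum_congr rfl fun y' _ => ?_
    rw [Finset.sum_comm]
    conv_rhs => rw [Finset.sum_comm]
    refine Finset.sum_congr rfl fun x _ => ?_
    rw [Finset.sum_comm]
    refine Finset.sum_congr rfl fun y _ => Finset.sum_congr rfl fun x' _ => ?_
    ring
  have h2 : ∑ k, ((B ⊗ₖ B)ᴴ * X * (B ⊗ₖ B)) (j, k) (j, k) = N.trace := by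
    rw [← trace_conj_unitary' hB N, Matrix.trace]
    exact Finset.sum_congr rfl fun k _ => h1 k
  rw [h2]
  simp only [Matrix.trace, Matrix.diag_apply, hN, Matrix.of_apply, Finset.mul_sum, Finset.sum_mul]
  rw [Finset.sum_comm]
  refine Finset.sum_congr rfl fun x _ => ?_
  rw [Finset.sum_comm]

end Twirl

section Basis

/-- A basis that extends a basis of the span of the given vectors. -/
lemma exists_adapted_basis {ι : Type} [Fintype ι] [DecidableEq ι] {q : ℕ}
    (msg : Fin q → EuclideanSpace ℂ ι) :
    ∃ (b : OrthonormalBasis ι ℂ (EuclideanSpace ℂ ι)) (A : Finset ι), A.card ≤ q ∧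
      (∀ i, ∀ j ∉ A, inner ℂ (b j) (msg i) = 0) ∧
      ∀ j ∈ A, b j ∈ Submodule.span ℂ (Set.range msg) := by
  set S := Submodule.span ℂ (Set.range msg) with hS
  set v := stdOrthonormalBasis ℂ S with hv
  have hd : Module.finrank ℂ S ≤ Fintype.card ι := by
    have := S.finrank_le
    rwa [finrank_euclideanSpace] at this
  have hdq : Module.finrank ℂ S ≤ q := by
    have := finrank_range_le_card (R := ℂ) msg
    rwa [Set.finrank, Fintype.card_fin] at this
  obtain ⟨g⟩ : Nonempty (Fin (Module.finrank ℂ S) ↪ ι) :=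
    Function.Embedding.nonempty_of_card_le (by simpa using hd)
  set u : ι → EuclideanSpace ℂ ι := Function.extend g (fun i => (v i : EuclideanSpace ℂ ι)) 0 with hu
  have hug : ∀ i, u (g i) = v i := fun i => g.injective.extend_apply _ _ i
  have hon : Orthonormal ℂ ((Set.range g).domRestrict u) := by
    have h1 : Orthonormal ℂ fun i => (v i : EuclideanSpace ℂ ι) :=
      v.orthonormal.comp_linearIsometry S.subtypeₗᵢ
    have h2 := h1.comp _ (Equiv.ofInjective g g.injective).symm.injective
    convert h2 using 1
    ext1 ⟨_, i, rfl⟩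
    simp [hug]
  obtain ⟨b, hb⟩ := hon.exists_orthonormalBasis_extension_of_card_eq (by simp)
  refine ⟨b, Finset.univ.map g, by simpa using hdq, ?_, ?_⟩
  · intro i j hj
    have hm : msg i ∈ S := Submodule.subset_span ⟨i, rfl⟩
    have h3 := congrArg Subtype.val (v.sum_repr ⟨msg i, hm⟩)
    simp only [Submodule.coe_sum, Submodule.coe_smul] at h3
    rw [← h3, inner_sum]
    refine Finset.sum_eq_zero fun l _ => ?_
    rw [inner_smul_right, ← hug, ← hb _ ⟨l, rfl⟩]
    rw [b.orthonormal.2, mul_zero]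
    rintro rfl
    exact hj (by simp)
  · intro j hj
    obtain ⟨l, -, rfl⟩ := Finset.mem_map.1 hj
    rw [hb _ ⟨l, rfl⟩, hug]
    exact (v l).2

/-- The matrix whose columns are the basis vectors. -/
noncomputable def basisMatrix {ι : Type} [Fintype ι] (b : OrthonormalBasis ι ℂ (EuclideanSpace ℂ ι)) :
    Matrix ι ι ℂ := Matrix.of fun x j => b j x

lemma basisMatrix_mem {ι : Type} [Fintype ι] [DecidableEq ι]
    (b : OrthonormalBasis ι ℂ (EuclideanSpace ℂ ι)) :
    basisMatrix b ∈ Matrix.unitaryGroup ι ℂ := by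
  rw [Matrix.mem_unitaryGroup_iff', Matrix.star_eq_conjTranspose]
  ext j k
  have := orthonormal_iff_ite.1 b.orthonormal j k
  rw [PiLp.inner_apply] at this
  rw [Matrix.one_apply, ← this]
  simp [Matrix.mul_apply, basisMatrix, mul_comm]

end Basis

section Ideal

open scoped Kronecker

/-- An operator on two copies of a register as a matrix indexed by pairs. -/
def pairMatrix {A : Type} (ρ : Op (A ⊕ A)) :
    Matrix ((A → Bool) × (A → Bool)) ((A → Bool) × (A → Bool)) ℂ :=
  ρ.submatrix (fun p => Sum.elim p.1 p.2) fun p => Sum.elim p.1 p.2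

lemma swapSum_pairMatrix {A : Type} [Fintype A] [DecidableEq A] (ρ : Op (A ⊕ A)) :
    swapSum (pairMatrix ρ) = swapValue ρ := rfl

lemma trace_pairMatrix {A : Type} [Fintype A] [DecidableEq A] (ρ : Op (A ⊕ A)) :
    (pairMatrix ρ).trace = ρ.trace := by
  simp only [Matrix.trace, Matrix.diag_apply, Fintype.sum_prod_type]
  exact (sum_sumArrow fun x => ρ x x).symm

lemma pairMatrix_applyRight_conj {A B : Type} [Fintype A] [DecidableEq A]
    (Φ : Op B → Op A) (W : Op A) (X : Op (A ⊕ B)) :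
    pairMatrix (applyRight (fun Y => Wᴴ * Φ Y * W) X)
      = ((1 : Op A) ⊗ₖ W)ᴴ * pairMatrix (applyRight Φ X) * ((1 : Op A) ⊗ₖ W) := by
  ext ⟨x, y⟩ ⟨x', y'⟩
  simp only [pairMatrix, Matrix.submatrix_apply, applyRight, Matrix.of_apply, Matrix.mul_apply,
    Matrix.conjTranspose_apply, Matrix.kroneckerMap_apply, Fintype.sum_prod_type, Matrix.one_apply,
    Sum.elim_comp_inl, Sum.elim_comp_inr, apply_ite star, star_zero, ite_mul, one_mul, zero_mul,
    mul_ite, mul_zero]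
  symm
  rw [Finset.sum_eq_single x']
  · simp
  · intro c _ hc; simp [hc]
  · simp

lemma adapted_unitary_mulVec {n q : ℕ} {msg : Fin q → Ket (Fin n)}
    {b : OrthonormalBasis (Fin n → Bool) ℂ (Ket (Fin n))} {A : Finset (Fin n → Bool)}
    (hb : ∀ i, ∀ j ∉ A, inner ℂ (b j) (msg i) = 0) (s : (Fin n → Bool) → Bool)
    {π : Equiv.Perm (Fin n → Bool)} (hπ : ∀ j ∈ A, π j = j) (i : Fin q) :
    (basisMatrix b * signedPerm A s π * (basisMatrix b)ᴴ) *ᵥ (msg i).ofLp = (msg i).ofLp := by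
  have h1 : ∀ j, ((basisMatrix b)ᴴ *ᵥ (msg i).ofLp) j = inner ℂ (b j) (msg i) := by
    intro j
    rw [PiLp.inner_apply]
    simp [Matrix.mulVec, dotProduct, basisMatrix, mul_comm]
  have h2 : signedPerm A s π *ᵥ ((basisMatrix b)ᴴ *ᵥ (msg i).ofLp)
      = (basisMatrix b)ᴴ *ᵥ (msg i).ofLp := by
    ext x
    by_cases hx : x ∈ A
    · rw [Matrix.mulVec, dotProduct, Finset.sum_eq_single x]
      · simp [signedPerm, hπ x hx, signs, hx]
      · intro j _ hj
        have : x ≠ π j := fun h => hj (π.injective (by rw [← h, hπ x hx]))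
        simp [signedPerm, this]
      · simp
    · rw [h1, hb i x hx, Matrix.mulVec, dotProduct]
      refine Finset.sum_eq_zero fun j _ => ?_
      by_cases hj : j ∈ A
      · have : x ≠ π j := fun h => hx (by rw [h, hπ j hj]; exact hj)
        simp [signedPerm, this]
      · rw [h1, hb i j hj, mul_zero]
  have hB : basisMatrix b * (basisMatrix b)ᴴ = 1 := by
    have := Matrix.mem_unitaryGroup_iff.1 (basisMatrix_mem b)
    rwa [Matrix.star_eq_conjTranspose] at this
  rw [← Matrix.mulVec_mulVec, ← Matrix.mulVec_mulVec, h2, Matrix.mulVec_mulVec, hB,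
    Matrix.one_mulVec]

lemma conj_pureState {P Q : Type} [Fintype P] [DecidableEq P] [Fintype Q] [DecidableEq Q]
    (K : Matrix (Q → Bool) (P → Bool) ℂ) (ψ : Ket P) :
    K * pureState ψ * Kᴴ = pureState (WithLp.toLp 2 (K *ᵥ ψ.ofLp)) := by
  ext x y
  simp only [Matrix.mul_apply, pureState, Matrix.of_apply, Matrix.conjTranspose_apply,
    Matrix.mulVec, dotProduct, star_sum, star_mul', Finset.sum_mul, Finset.mul_sum]
  refine Finset.sum_congr rfl fun a _ => Finset.sum_congr rfl fun b _ => ?_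
  ring

lemma isLinearMap_isoOracles_fwd {n m : ℕ} (V : Matrix (Fin (n + m) → Bool) (Fin n → Bool) ℂ) :
    IsLinearMap ℂ (isoOracles V).fwd := isLinearMap_conj V

lemma isoOf_conjTranspose_mul {n m : ℕ} {U : Op (Fin (n + m))}
    (hU : U ∈ Matrix.unitaryGroup (Fin (n + m) → Bool) ℂ) :
    (isoOf (n := n) U)ᴴ * isoOf U = 1 := by
  have h := Matrix.mem_unitaryGroup_iff'.1 hU
  rw [Matrix.star_eq_conjTranspose] at h
  ext a b
  have := congrFun (congrFun h (Fin.append a fun _ => false)) (Fin.append b fun _ => false)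
  rw [Matrix.one_apply] at this ⊢
  have e : (Fin.append a (fun _ : Fin m => false) = Fin.append b fun _ => false) ↔ a = b := by
    constructor
    · intro h; ext i; simpa using congrFun h (Fin.castAdd m i)
    · rintro rfl; rfl
  simp only [e] at this
  rw [← this]
  rfl

lemma trace_isoOracles_fwd {n m : ℕ} {V : Matrix (Fin (n + m) → Bool) (Fin n → Bool) ℂ}
    (hV : Vᴴ * V = 1) (X : Op (Fin n)) : ((isoOracles V).fwd X).trace = X.trace := by
  rw [isoOracles, Matrix.trace_mul_comm, ← Matrix.mul_assoc, hV, Matrix.one_mul]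

lemma reduce_inl_apply {A B : Type} [Fintype A] [DecidableEq A] [Fintype B] [DecidableEq B]
    (X : Op (A ⊕ B)) (x x' : A → Bool) :
    reduce Function.Embedding.inl X x x' = ∑ y, X (Sum.elim x y) (Sum.elim x' y) := by
  rw [reduce_eq_sum_ite, sum_sumArrow, Finset.sum_eq_single x]
  · refine Finset.sum_congr rfl fun y _ => ?_
    rw [extend_inl, if_pos (by ext i; rfl)]
    rfl
  · intro c _ hc
    refine Finset.sum_eq_zero fun y _ => if_neg fun h => hc ?_
    rw [← h]; ext i; rfl
  · simp

variable {𝒢 : GateSet} {n m q t r : ℕ}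
  (C : Circuit 𝒢 ((Fin q × Fin (n + m)) ⊕ Fin r) ((Fin t × Fin n) ⊕ Fin (n + m)))
  (msg : Fin q → Ket (Fin n)) (μ : Op (Fin r)) (i : Fin t)

/-- A copy of the forged message and the verified tag, in the game with the isometry of `U`. -/
noncomputable def idealPair (U : Op (Fin (n + m))) : Op (Fin n ⊕ Fin n) :=
  verifiedPair (inverseIso (isoOf U)) i (gameOutput C msg μ (isoOracles (isoOf U)))

lemma pairMatrix_idealPair_mul {U : Op (Fin (n + m))}
    (hU : U ∈ Matrix.unitaryGroup (Fin (n + m) → Bool) ℂ) {W : Op (Fin n)}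
    (hW : W ∈ Matrix.unitaryGroup (Fin n → Bool) ℂ) (hmsg : ∀ i, W *ᵥ (msg i).ofLp = (msg i).ofLp) :
    pairMatrix (idealPair C msg μ i (U * withId m W))
      = ((1 : Op (Fin n)) ⊗ₖ W)ᴴ * pairMatrix (idealPair C msg μ i U) * ((1 : Op (Fin n)) ⊗ₖ W) := by
  have h : gameOutput C msg μ (isoOracles (isoOf (U * withId m W)))
      = gameOutput C msg μ (isoOracles (isoOf U)) := by
    simp only [gameOutput, isoOracles, isoOf_mul_withId, conj_pureState, ← Matrix.mulVec_mulVec, hmsg]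
  rw [idealPair, h, idealPair, verifiedPair, verifiedPair, ← pairMatrix_applyRight_conj]
  congr 3
  funext X
  exact inverseIso_isoOf_mul hU hW X

lemma posSemidef_idealPair (hμ : μ.PosSemidef) {U : Op (Fin (n + m))}
    (hU : U ∈ Matrix.unitaryGroup (Fin (n + m) → Bool) ℂ) : (idealPair C msg μ i U).PosSemidef := by
  refine posSemidef_applyRight_inverseIso hU (posSemidef_reduce _ (posSemidef_circuit_run _
    (posSemidef_tensor ?_ hμ)))
  simp only [isoOracles, conj_pureState, tensorFamily_pureState]
  exact posSemidef_pureState _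

lemma trace_applyRight {P A B : Type} [Fintype P] [DecidableEq P] [Fintype A] [DecidableEq A]
    [Fintype B] [DecidableEq B] {Φ : Op A → Op B}
    (hΦ : ∀ X, (Φ X).trace = X.trace) (X : Op (P ⊕ A)) : (applyRight Φ X).trace = X.trace := by
  simp only [Matrix.trace, Matrix.diag_apply]
  rw [sum_sumArrow, sum_sumArrow]
  exact Finset.sum_congr rfl fun a _ => hΦ (Matrix.of fun c d => X (Sum.elim a c) (Sum.elim a d))

lemma trace_idealPair (hmsg : ∀ i, ‖msg i‖ = 1) (hμ : μ.trace = 1) {U : Op (Fin (n + m))}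
    (hU : U ∈ Matrix.unitaryGroup (Fin (n + m) → Bool) ℂ) : (idealPair C msg μ i U).trace = 1 := by
  rw [idealPair, verifiedPair, trace_applyRight (trace_inverseIso_isoOf hU), trace_reduce, gameOutput,
    trace_circuit_run, trace_tensor, trace_tensorFamily, hμ, mul_one]
  exact Finset.prod_eq_one fun j _ => by
    rw [trace_isoOracles_fwd (isoOf_conjTranspose_mul hU), trace_pureState (hmsg j)]

lemma continuous_idealPair :
    Continuous fun U : Matrix.unitaryGroup (Fin (n + m) → Bool) ℂ => idealPair C msg μ i U.1 := by
  have hV : Continuous fun U : Matrix.unitaryGroup (Fin (n + m) → Bool) ℂ => isoOf (n := n) U.1 :=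
    continuous_matrix fun a b => continuous_subtype_val.matrix_elem _ _
  have hF : ∀ j, Continuous fun U : Matrix.unitaryGroup (Fin (n + m) → Bool) ℂ =>
      (isoOracles (isoOf (n := n) U.1)).fwd (pureState (msg j)) := fun j =>
    (hV.matrix_mul continuous_const).matrix_mul hV.matrix_conjTranspose
  have hT : Continuous fun U : Matrix.unitaryGroup (Fin (n + m) → Bool) ℂ =>
      tensor (tensorFamily fun j => (isoOracles (isoOf (n := n) U.1)).fwd (pureState (msg j))) μ :=
    continuous_matrix fun a b => by
      simp only [tensor, tensorFamily, Matrix.of_apply]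
      exact (continuous_finsetProd _ fun j _ => (hF j).matrix_elem _ _).mul continuous_const
  have hR : Continuous fun U : Matrix.unitaryGroup (Fin (n + m) → Bool) ℂ =>
      reduce (firstCopy i) (gameOutput C msg μ (isoOracles (isoOf U.1))) :=
    (continuous_of_isLinearMap (isLinearMap_reduce _)).comp
      ((continuous_of_isLinearMap (isLinearMap_circuit_run C)).comp hT)
  have e : (fun U : Matrix.unitaryGroup (Fin (n + m) → Bool) ℂ => idealPair C msg μ i U.1)
      = fun U => applyRight (fun X => complementTwirl (U.1ᴴ * X * U.1))
        (reduce (firstCopy i) (gameOutput C msg μ (isoOracles (isoOf U.1)))) := by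
    funext U
    rw [idealPair, verifiedPair]
    congr 1
    funext X
    exact inverseIso_isoOf U.2 X
  rw [e]
  refine continuous_matrix fun a b => ?_
  refine Continuous.matrix_elem (((continuous_of_isLinearMap isLinearMap_complementTwirl).comp
    ((continuous_subtype_val.matrix_conjTranspose.matrix_mul (continuous_matrix fun c d =>
      hR.matrix_elem _ _)).matrix_mul continuous_subtype_val))) _ _

lemma continuous_swapValue {A : Type} [Fintype A] [DecidableEq A] :
    Continuous (swapValue (A := A)) :=
  continuous_finsetSum _ fun _ _ => continuous_finsetSum _ fun _ _ => continuous_id.matrix_elem _ _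

lemma continuous_swapValue_idealPair : Continuous
    fun U : Matrix.unitaryGroup (Fin (n + m) → Bool) ℂ => (swapValue (idealPair C msg μ i U.1)).re :=
  Complex.continuous_re.comp (continuous_swapValue.comp (continuous_idealPair C msg μ i))

lemma continuous_overlap_idealPair (τ : Op (Fin n)) : Continuous
    fun U : Matrix.unitaryGroup (Fin (n + m) → Bool) ℂ =>
      (swapValue (tensor (reduce Function.Embedding.inl (idealPair C msg μ i U.1)) τ)).re := by
  refine Complex.continuous_re.comp (continuous_swapValue.comp (continuous_matrix fun x y =>
    Continuous.mul ?_ continuous_const))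
  exact ((continuous_of_isLinearMap (isLinearMap_reduce _)).comp
    (continuous_idealPair C msg μ i)).matrix_elem _ _

/-- With a Haar random isometry, a verified tag overlaps with the forged message only in the span of
the queried messages. -/
lemma exists_overlap_state (hmsg : ∀ i, ‖msg i‖ = 1) (hq : q < 2 ^ n) :
    ∃ (τ : Op (Fin n)) (c : ℕ), IsDensity τ ∧ c ≤ q ∧
      (c ≠ 0 → ∀ ψ : Ket (Fin n), (∀ j, inner ℂ (msg j) ψ = 0) → (pureState ψ * τ).trace = 0) ∧
      ∀ (C : Circuit 𝒢 ((Fin q × Fin (n + m)) ⊕ Fin r) ((Fin t × Fin n) ⊕ Fin (n + m)))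
        (μ : Op (Fin r)) (i : Fin t), IsDensity μ →
        ∫ U, (swapValue (idealPair C msg μ i U.1)).re ∂haarUnitary (Fin (n + m) → Bool)
          ≤ c * ∫ U, (swapValue (tensor (reduce Function.Embedding.inl (idealPair C msg μ i U.1)) τ)).re
            ∂haarUnitary (Fin (n + m) → Bool) + 1 / (2 ^ n - c) := by
  obtain ⟨b, A, hA, hb, hspan⟩ := exists_adapted_basis msg
  set S : Op (Fin n) := ∑ a ∈ A, pureState (b a) with hS
  have hSpos : S.PosSemidef := Matrix.posSemidef_sum _ fun a _ => posSemidef_pureState _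
  have hStr : S.trace = A.card := by
    rw [hS, Matrix.trace_sum, Finset.sum_congr rfl fun a _ => trace_pureState (b.norm_eq_one a)]
    simp
  obtain ⟨τ, hτ, hτS⟩ : ∃ τ : Op (Fin n), IsDensity τ ∧ (A.card : ℂ) • τ = S := by
    by_cases h : A.card = 0
    · refine ⟨basisState fun _ => false, ⟨posSemidef_basisState _, trace_basisState _⟩, ?_⟩
      rw [h, hS, Finset.card_eq_zero.1 h]; simp
    · have h' : (A.card : ℂ) ≠ 0 := by exact_mod_cast h
      refine ⟨(A.card : ℂ)⁻¹ • S, ⟨hSpos.smul ?_, ?_⟩, ?_⟩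
      · rw [show (A.card : ℂ)⁻¹ = (((A.card : ℝ)⁻¹ : ℝ) : ℂ) by push_cast; rfl]
        exact Complex.zero_le_real.2 (by positivity)
      · rw [Matrix.trace_smul, hStr, smul_eq_mul, inv_mul_cancel₀ h']
      · rw [smul_smul, mul_inv_cancel₀ h', one_smul]
  refine ⟨τ, A.card, hτ, hA, ?_, ?_⟩
  · intro h ψ hψ
    have h0 : (pureState ψ * S).trace = 0 := by
      rw [hS, Finset.mul_sum, Matrix.trace_sum]
      refine Finset.sum_eq_zero fun a ha => ?_
      have hin : inner ℂ (b a) ψ = 0 := by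
        have : b a ∈ (ℂ ∙ ψ)ᗮ := by
          refine Submodule.span_le.2 ?_ (hspan a ha)
          rintro _ ⟨j, rfl⟩
          exact Submodule.mem_orthogonal_singleton_iff_inner_left.2 (hψ j)
        exact Submodule.mem_orthogonal_singleton_iff_inner_left.1 this
      rw [PiLp.inner_apply] at hin
      rw [Matrix.trace_mul_comm, trace_pureState_mul]
      have e : ∀ x y, star (b a x) * pureState ψ x y * b a y
          = inner ℂ (b a x) (ψ x) * (b a y * star (ψ y)) := by
        intro x y; simp [pureState]; ring
      simp only [e, ← Finset.mul_sum, ← Finset.sum_mul, hin, zero_mul]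
    rw [← hτS, Matrix.mul_smul, Matrix.trace_smul, smul_eq_mul] at h0
    exact (mul_eq_zero.1 h0).resolve_left (by exact_mod_cast h)
  · intro C μ i hμ
    have hcard : Fintype.card (Fin n → Bool) = 2 ^ n := by simp
    obtain ⟨π, hπ1, hπ2⟩ := exists_shifts A (by rw [hcard]; omega)
    set W : Fin (Fintype.card (Fin n → Bool) - A.card) → ((Fin n → Bool) → Bool) → Op (Fin n) :=
      fun h s => basisMatrix b * signedPerm A s (π h) * (basisMatrix b)ᴴ with hWdef
    have hBadj : (basisMatrix b)ᴴ ∈ Matrix.unitaryGroup (Fin n → Bool) ℂ :=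
      Unitary.star_mem (basisMatrix_mem b)
    have hW : ∀ h s, W h s ∈ Matrix.unitaryGroup (Fin n → Bool) ℂ := fun h s =>
      mul_mem (mul_mem (basisMatrix_mem b) (signedPerm_mem _ _ _)) hBadj
    set f : Matrix.unitaryGroup (Fin (n + m) → Bool) ℂ → ℝ :=
      fun U => (swapValue (idealPair C msg μ i U.1)).re with hf
    set g : Matrix.unitaryGroup (Fin (n + m) → Bool) ℂ → ℝ := fun U =>
      (swapValue (tensor (reduce Function.Embedding.inl (idealPair C msg μ i U.1)) τ)).re with hg
    have hfc : Continuous f := continuous_swapValue_idealPair C msg μ i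
    have hgc : Continuous g := continuous_overlap_idealPair C msg μ i τ
    have hweight : ∀ U, weight A (basisMatrix b) (pairMatrix (idealPair C msg μ i U.1))
        = A.card * g U := by
      intro U
      rw [weight_eq (basisMatrix_mem b), hg]
      simp only
      rw [swapValue_tensor, ← Complex.re_ofReal_mul, Complex.ofReal_natCast, ← smul_eq_mul,
        ← Matrix.trace_smul, ← Matrix.mul_smul, hτS, hS, Finset.mul_sum, Matrix.trace_sum,
        Complex.re_sum]
      refine Finset.sum_congr rfl fun a _ => ?_
      rw [Matrix.trace_mul_comm, trace_pureState_mul]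
      congr 1
      refine Finset.sum_congr rfl fun x _ => Finset.sum_congr rfl fun x' _ => ?_
      congr 2
      rw [reduce_inl_apply]
      rfl
    have key : ∀ U : Matrix.unitaryGroup (Fin (n + m) → Bool) ℂ,
        ∑ h, ∑ s, f (U * ⟨withId m (W h s), withId_mem (hW h s)⟩)
          ≤ 2 ^ Fintype.card (Fin n → Bool)
            * (((Fintype.card (Fin n → Bool) - A.card : ℕ) : ℝ) * (A.card * g U) + 1) := by
      intro U
      have := sum_swapSum_le (basisMatrix_mem b)
        (X := pairMatrix (idealPair C msg μ i U.1))
        ((posSemidef_idealPair C msg μ i hμ.1 U.2).submatrix _) hπ1 hπ2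
      rw [trace_pairMatrix, trace_idealPair C msg μ i hmsg hμ.2 U.2, hweight] at this
      refine le_trans (le_of_eq ?_) this
      refine Finset.sum_congr rfl fun h _ => Finset.sum_congr rfl fun s _ => ?_
      rw [hf]
      simp only
      rw [← pairMatrix_idealPair_mul C msg μ i U.2 (hW h s)
        (adapted_unitary_mulVec hb s (hπ1 h)), swapSum_pairMatrix]
      rfl
    have hfW : ∀ h s, Integrable (fun U => f (U * ⟨withId m (W h s), withId_mem (hW h s)⟩))
        (haarUnitary (Fin (n + m) → Bool)) := fun h s =>
      integrable_haarUnitary (hfc.comp (continuous_mul_const _))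
    have hgi := integrable_haarUnitary hgc
    have hint := integral_mono (integrable_finsetSum _ fun h _ => integrable_finsetSum _ fun s _ =>
      hfW h s) ((((hgi.const_mul _).const_mul _).add (integrable_const 1)).const_mul _) key
    rw [integral_finsetSum _ fun h _ => integrable_finsetSum _ fun s _ => hfW h s,
      Finset.sum_congr rfl fun h _ => (integral_finsetSum _ fun s _ => hfW h s).trans
        (Finset.sum_congr rfl fun s _ => integral_mul_right_eq_self f _),
      integral_const_mul, integral_add' ((hgi.const_mul _).const_mul _) (integrable_const _),
      integral_const_mul, integral_const_mul] at hint
    simp only [Finset.sum_const, Finset.card_univ, Fintype.card_fin, Fintype.card_fun,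
      Fintype.card_bool, nsmul_eq_mul, integral_const, probReal_univ, one_smul] at hint
    have hd : (0 : ℝ) < ((2 ^ n - A.card : ℕ) : ℝ) := by
      exact_mod_cast Nat.sub_pos_of_lt (lt_of_le_of_lt hA hq)
    rw [show ((2 : ℝ) ^ n - A.card) = ((2 ^ n - A.card : ℕ) : ℝ) by
      rw [Nat.cast_sub (hA.trans hq.le)]; push_cast; rfl]
    set d : ℝ := ((2 ^ n - A.card : ℕ) : ℝ)
    have h2 : (0 : ℝ) < 2 ^ 2 ^ n := by positivity
    push_cast at hint
    rw [mul_left_comm] at hint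
    have h3 := le_of_mul_le_mul_left hint h2
    rw [← mul_le_mul_iff_of_pos_left hd]
    refine h3.trans (le_of_eq ?_)
    field_simp

end Ideal

section Asymptotics

lemma PolyBounded.add {f g : ℕ → ℕ} (hf : PolyBounded f) (hg : PolyBounded g) :
    PolyBounded fun l => f l + g l := by
  obtain ⟨p, hp⟩ := hf
  obtain ⟨r, hr⟩ := hg
  exact ⟨p + r, fun l => by rw [Polynomial.eval_add]; exact add_le_add (hp l) (hr l)⟩

lemma PolyBounded.const_mul {f : ℕ → ℕ} (hf : PolyBounded f) (c : ℕ) :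
    PolyBounded fun l => c * f l := by
  obtain ⟨p, hp⟩ := hf
  exact ⟨Polynomial.C c * p, fun l => by
    rw [Polynomial.eval_mul, Polynomial.eval_C]; exact Nat.mul_le_mul_left c (hp l)⟩

lemma polyBounded_const (c : ℕ) : PolyBounded fun _ => c := ⟨Polynomial.C c, fun l => by simp⟩

lemma Negligible.polyBounded_mul {ε : ℕ → ℝ} (hε : Negligible ε) {f : ℕ → ℕ} (hf : PolyBounded f) :
    Negligible fun l => f l * ε l := by
  obtain ⟨p, hp⟩ := hf
  refine (Asymptotics.SuperpolynomialDecay.polynomial_mul hε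
    (p.map (Nat.castRingHom ℝ))).trans_abs_le fun l => ?_
  rw [Polynomial.eval_natCast_map, abs_mul, abs_mul]
  refine mul_le_mul_of_nonneg_right ?_ (abs_nonneg _)
  simp only [Nat.abs_cast, eq_natCast]
  exact_mod_cast hp l

lemma Negligible.tendsto_zero {ε : ℕ → ℝ} (hε : Negligible ε) : Tendsto ε atTop (nhds 0) := by
  simpa using hε 0

end Asymptotics

section Game

variable {𝒢 : GateSet} {n m : ℕ → ℕ}

/-- The distinguishing advantage of an oracle circuit. -/
noncomputable def OracleCircuit.advantage (F : KeyedAlg 𝒢 n fun l => n l + m l)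
    (Inv : KeyedAlg 𝒢 (fun l => n l + m l) n) {l : ℕ} (D : OracleCircuit 𝒢 (n l) (m l)) : ℝ :=
  |(∑ k : Fin l → Bool, D.prob ⟨F.run l k, Inv.run l k⟩) / 2 ^ l
    - ∫ U, D.prob (isoOracles (isoOf U.1)) ∂haarUnitary (Fin (n l + m l) → Bool)|

lemma IsStrongInvertiblePRI.negligible_advantage {F : KeyedAlg 𝒢 n fun l => n l + m l}
    {Inv : KeyedAlg 𝒢 (fun l => n l + m l) n} (h : IsStrongInvertiblePRI F Inv)
    (D : ∀ l, OracleCircuit 𝒢 (n l) (m l)) {b : ℕ → ℕ} (hb : PolyBounded b)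
    (hD : ∀ l, (D l).size ≤ b l) : Negligible fun l => (D l).advantage F Inv := by
  obtain ⟨p, hp⟩ := hb
  exact h.security
    { wires := fun l => (D l).wires
      advice := fun l => (D l).advice
      advice_density := fun l => (D l).advice_density
      steps := fun l => (D l).steps
      out := fun l => (D l).out
      poly := ⟨p, fun l => (hD l).trans (hp l)⟩ }

lemma exists_oracleCircuit_size_one (𝒢 : GateSet) (n m : ℕ) :
    ∃ D : OracleCircuit 𝒢 n m, D.size = 1 :=
  ⟨⟨1, plusState, isDensity_plusState, [], 0⟩, rfl⟩

lemma avg_affine {l : ℕ} (s : (Fin l → Bool) → ℝ) (a b : ℝ) :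
    (∑ k, (a + b * s k)) / 2 ^ l = a + b * ((∑ k, s k) / 2 ^ l) := by
  rw [Finset.sum_add_distrib, ← Finset.mul_sum, Finset.sum_const, Finset.card_univ]
  simp only [Fintype.card_fun, Fintype.card_bool, Fintype.card_fin, nsmul_eq_mul, Nat.cast_pow,
    Nat.cast_ofNat]
  field_simp

lemma integral_half_sub {κ : Type} [Fintype κ] [DecidableEq κ] {f : Matrix.unitaryGroup κ ℂ → ℝ}
    (hf : Continuous f) :
    ∫ U, (1 - f U) / 2 ∂haarUnitary κ = 1 / 2 + (-1 / 2) * ∫ U, f U ∂haarUnitary κ := by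
  rw [integral_div, integral_sub (integrable_const _) (integrable_haarUnitary hf), integral_const,
    probReal_univ, one_smul]
  ring

/-- The winning probability at one security parameter is governed by the distinguishing advantages
of two small oracle circuits. -/
lemma exists_tests (F : KeyedAlg 𝒢 n fun l => n l + m l) (Inv : KeyedAlg 𝒢 (fun l => n l + m l) n)
    {l q t r : ℕ} (C : Circuit 𝒢 ((Fin q × Fin (n l + m l)) ⊕ Fin r)
      ((Fin t × Fin (n l)) ⊕ Fin (n l + m l)))
    (msg : Fin q → Ket (Fin (n l))) (hmsg : ∀ i, ‖msg i‖ = 1) {μ : Op (Fin r)} (hμ : IsDensity μ)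
    (hX : ∀ k, gameOutput C msg μ ⟨F.run l k, Inv.run l k⟩ ∈ convexHull ℝ (forgeries t msg)) :
    ∃ D₁ D₂ : OracleCircuit 𝒢 (n l) (m l), D₁.size ≤ q + C.size + 85 * n l + 3 ∧
      D₂.size ≤ q + C.size + 85 * n l + 3 ∧ (q < 2 ^ n l →
      (∑ k : Fin l → Bool, permTestProb (collect (applyRight (Inv.run l k)
        (gameOutput C msg μ ⟨F.run l k, Inv.run l k⟩)))) / 2 ^ l
      ≤ 1 / ((t : ℝ) + 1) + (2 * D₁.advantage F Inv + q * (2 * D₂.advantage F Inv)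
        + 1 / (2 ^ n l - q))) := by
  have hFlin := fun k => isLinearMap_keyedAlg_run F l k
  have hIlin := fun k => isLinearMap_keyedAlg_run Inv l k
  have hFtr := fun k => trace_keyedAlg_run F l k
  have hItr := fun k => trace_keyedAlg_run Inv l k
  have hIpos := fun k X => posSemidef_keyedAlg_run Inv l k (X := X)
  obtain ⟨D₀, hD₀⟩ := exists_oracleCircuit_size_one 𝒢 (n l) (m l)
  by_cases hq : q < 2 ^ n l
  swap
  · exact ⟨D₀, D₀, by omega, by omega, fun h => absurd h hq⟩
  have hqn : (0 : ℝ) < 2 ^ n l - q := by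
    have : (q : ℝ) < 2 ^ n l := by exact_mod_cast hq
    linarith
  have hadv : ∀ D : OracleCircuit 𝒢 (n l) (m l), 0 ≤ D.advantage F Inv := fun D => abs_nonneg _
  rcases Nat.eq_zero_or_pos t with ht | ht
  · refine ⟨D₀, D₀, by omega, by omega, fun _ => ?_⟩
    have h1 : (∑ k : Fin l → Bool, permTestProb (collect (applyRight (Inv.run l k)
        (gameOutput C msg μ ⟨F.run l k, Inv.run l k⟩)))) / 2 ^ l ≤ 1 := by
      rw [div_le_one (by positivity)]
      refine (Finset.sum_le_sum fun k _ => permTestProb_le_one_of_zero (hIlin k) (hItr k) (hIpos k) ht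
        (hX k)).trans ?_
      simp
    have h2 : (1 : ℝ) / ((t : ℝ) + 1) = 1 := by rw [ht]; simp
    rw [h2]
    have h3 := hadv D₀
    have : 0 ≤ 2 * D₀.advantage F Inv + q * (2 * D₀.advantage F Inv) + 1 / (2 ^ n l - q) := by
      positivity
    linarith
  set i : Fin t := ⟨0, ht⟩
  obtain ⟨τ, c, hτ, hc, hτo, hideal⟩ := exists_overlap_state (𝒢 := 𝒢) (m := m l) (t := t) (r := r)
    msg hmsg hq
  obtain ⟨D₁, hD₁, h₁⟩ := exists_tag_test (μ := μ) C msg i hmsg hμ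
  obtain ⟨D₂, hD₂, h₂⟩ := exists_overlap_test C msg i hmsg hμ hτ
  refine ⟨D₁, D₂, hD₁, hD₂, fun _ => ?_⟩
  set s : (Fin l → Bool) → ℝ := fun k => (swapValue (verifiedPair (Inv.run l k) i
    (gameOutput C msg μ ⟨F.run l k, Inv.run l k⟩))).re with hs
  set I : ℝ := ∫ U, (swapValue (idealPair C msg μ i U.1)).re
    ∂haarUnitary (Fin (n l + m l) → Bool) with hI
  set G : ℝ := ∫ U, (swapValue (tensor (reduce Function.Embedding.inl (idealPair C msg μ i U.1)) τ)).re
    ∂haarUnitary (Fin (n l + m l) → Bool) with hG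
  have hiso : ∀ (D : OracleCircuit 𝒢 (n l) (m l)) (v : Oracles (n l) (m l) → ℂ),
      (∀ O : Oracles (n l) (m l), IsLinearMap ℂ O.fwd → IsLinearMap ℂ O.bwd →
        (∀ X, (O.fwd X).trace = X.trace) → (∀ X, (O.bwd X).trace = X.trace) →
        D.prob O = (1 - (v O).re) / 2) →
      ∀ U : Matrix.unitaryGroup (Fin (n l + m l) → Bool) ℂ,
        D.prob (isoOracles (isoOf U.1)) = (1 - (v (isoOracles (isoOf U.1))).re) / 2 := by
    intro D v h U
    exact h _ (isLinearMap_isoOracles_fwd _) (isLinearMap_inverseIso_isoOf U.2)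
      (trace_isoOracles_fwd (isoOf_conjTranspose_mul U.2)) (trace_inverseIso_isoOf U.2)
  have hadv₁ : D₁.advantage F Inv = |(∑ k, s k) / 2 ^ l - I| / 2 := by
    have e1 : ∀ k, D₁.prob ⟨F.run l k, Inv.run l k⟩ = 1 / 2 + (-1 / 2) * s k := by
      intro k
      rw [h₁ _ (hFlin k) (hIlin k) (hFtr k) (hItr k)]
      ring
    have e2 : ∫ U, D₁.prob (isoOracles (isoOf U.1)) ∂haarUnitary (Fin (n l + m l) → Bool)
        = 1 / 2 + (-1 / 2) * I := by
      rw [hI, ← integral_half_sub (continuous_swapValue_idealPair C msg μ i)]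
      exact integral_congr_ae (Eventually.of_forall (hiso D₁ _ h₁))
    rw [OracleCircuit.advantage, e2]
    simp only [e1]
    rw [avg_affine, ← abs_two, ← abs_div, abs_two, ← abs_neg]
    congr 1
    ring
  have hadv₂ : c ≠ 0 → D₂.advantage F Inv = |G| / 2 := by
    intro hc0
    have e1 : ∀ k, D₂.prob ⟨F.run l k, Inv.run l k⟩ = 1 / 2 + 0 * s k := by
      intro k
      rw [h₂ _ (hFlin k) (hIlin k) (hFtr k) (hItr k),
        swapValue_forgery_eq_zero (hIlin k) i (hτo hc0) (hX k)]
      simp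
    have e2 : ∫ U, D₂.prob (isoOracles (isoOf U.1)) ∂haarUnitary (Fin (n l + m l) → Bool)
        = 1 / 2 + (-1 / 2) * G := by
      rw [hG, ← integral_half_sub (continuous_overlap_idealPair C msg μ i τ)]
      exact integral_congr_ae (Eventually.of_forall (hiso D₂ _ h₂))
    rw [OracleCircuit.advantage, e2]
    simp only [e1]
    rw [avg_affine, ← abs_two, ← abs_div, abs_two]
    congr 1
    ring
  have hcq : (c : ℝ) ≤ q := by exact_mod_cast hc
  have hcG : c * G ≤ q * (2 * D₂.advantage F Inv) := by
    by_cases hc0 : c = 0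
    · have := hadv D₂
      rw [hc0, Nat.cast_zero, zero_mul]; positivity
    · rw [hadv₂ hc0]
      calc c * G ≤ c * |G| := mul_le_mul_of_nonneg_left (le_abs_self G) (Nat.cast_nonneg c)
        _ ≤ q * |G| := mul_le_mul_of_nonneg_right hcq (abs_nonneg G)
        _ = _ := by ring
  have hN : (1 : ℝ) / (2 ^ n l - c) ≤ 1 / (2 ^ n l - q) :=
    one_div_le_one_div_of_le hqn (by linarith)
  set B := 2 * D₁.advantage F Inv + q * (2 * D₂.advantage F Inv) + 1 / (2 ^ n l - q) with hB
  have hB0 : 0 ≤ B := by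
    have := hadv D₁
    have := hadv D₂
    positivity
  have hS : (∑ k, s k) / 2 ^ l ≤ B := by
    have h3 := hideal C μ i hμ
    have h4 := le_abs_self ((∑ k, s k) / 2 ^ l - I)
    rw [hB]
    linarith
  have ht1 : (0 : ℝ) < (t : ℝ) + 1 := by positivity
  calc _ ≤ (∑ k, (1 / ((t : ℝ) + 1) + t / ((t : ℝ) + 1) * s k)) / 2 ^ l := by
        refine div_le_div_of_nonneg_right (Finset.sum_le_sum fun k _ => ?_) (by positivity)
        refine (permTestProb_le_swapValue (hIlin k) (hItr k) (hIpos k) i (hX k)).trans (le_of_eq ?_)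
        rw [hs]; ring
    _ = 1 / ((t : ℝ) + 1) + t / ((t : ℝ) + 1) * ((∑ k, s k) / 2 ^ l) := avg_affine s _ _
    _ ≤ 1 / ((t : ℝ) + 1) + t / ((t : ℝ) + 1) * B := by gcongr
    _ ≤ 1 / ((t : ℝ) + 1) + 1 * B := by
        gcongr
        rw [div_le_one ht1]; linarith
    _ = _ := by rw [one_mul]

variable {F : KeyedAlg 𝒢 n fun l => n l + m l} {Inv : KeyedAlg 𝒢 (fun l => n l + m l) n} {t : ℕ → ℕ}

lemma Forger.isDensity_mem {M : QMAC 𝒢} (A : Forger M t) (l : ℕ) : IsDensity (A.mem l) := by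
  have htr : (tensorFamily fun i => pureState (A.msg l i)).trace = 1 := by
    rw [trace_tensorFamily]
    exact Finset.prod_eq_one fun i _ => trace_pureState (A.msg_norm l i)
  have h : reduce Function.Embedding.inr ((A.stage1 l).run (A.advice l)) = A.mem l := by
    rw [A.sends, reduce_tensor_inr, htr, one_smul]
  rw [← h]
  exact ⟨posSemidef_reduce _ (posSemidef_circuit_run _ (A.advice_density l).1), by
    rw [trace_reduce, trace_circuit_run, (A.advice_density l).2]⟩

lemma Forger.exists_negligible (hn : PolyBounded n)
    (hneg : Negligible fun l => (1 / 2 : ℝ) ^ n l) (h : IsStrongInvertiblePRI F Inv)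
    (A : Forger (priMAC F Inv) t) :
    ∃ ε : ℕ → ℝ, Negligible ε ∧ ∀ l, A.winProb l ≤ 1 / ((t l : ℝ) + 1) + ε l := by
  have hex := fun l => exists_tests F Inv (A.stage2 l) (A.msg l) (A.msg_norm l)
    (A.isDensity_mem l) (A.forges l)
  choose D₁ D₂ hD₁ hD₂ hwin using hex
  have hsize : PolyBounded fun l => A.queries l + (A.stage2 l).size + 85 * n l + 3 :=
    ((A.queries_poly.add A.stage2_poly).add (hn.const_mul 85)).add (polyBounded_const 3)
  have hη₁ := h.negligible_advantage D₁ hsize hD₁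
  have hη₂ := h.negligible_advantage D₂ hsize hD₂
  have hsmall : ∀ᶠ l in atTop, A.queries l * (1 / 2 : ℝ) ^ n l < 1 / 2 :=
    (hneg.polyBounded_mul A.queries_poly).tendsto_zero.eventually_lt_const (by norm_num)
  refine ⟨fun l => max 0 (A.winProb l - 1 / ((t l : ℝ) + 1)), ?_, fun l => ?_⟩
  · refine Asymptotics.SuperpolynomialDecay.trans_eventually_abs_le
      (Asymptotics.SuperpolynomialDecay.add (Asymptotics.SuperpolynomialDecay.add
        (Asymptotics.SuperpolynomialDecay.const_mul hη₁ 2)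
        (Negligible.polyBounded_mul (Asymptotics.SuperpolynomialDecay.const_mul hη₂ 2)
          A.queries_poly)) (Asymptotics.SuperpolynomialDecay.const_mul hneg 2)) ?_
    filter_upwards [hsmall] with l hl
    have hpow : (0 : ℝ) < 2 ^ n l := by positivity
    rw [one_div, inv_pow, ← div_eq_mul_inv, div_lt_iff₀ hpow] at hl
    have hq : A.queries l < 2 ^ n l := by
      have : (A.queries l : ℝ) < 2 ^ n l := by linarith
      exact_mod_cast this
    have hN : (1 : ℝ) / (2 ^ n l - A.queries l) ≤ 2 * (1 / 2 : ℝ) ^ n l := by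
      rw [one_div_pow, ← div_eq_mul_one_div, div_le_div_iff₀ (by linarith) hpow]
      linarith
    have hw : A.winProb l ≤ _ := hwin l hq
    have h0 : (0 : ℝ) ≤ 1 / (2 ^ n l - A.queries l) := one_div_nonneg.2 (by linarith)
    have h1 : 0 ≤ (D₁ l).advantage F Inv := abs_nonneg _
    have h2 : 0 ≤ (A.queries l : ℝ) * (2 * (D₂ l).advantage F Inv) :=
      mul_nonneg (Nat.cast_nonneg _) (mul_nonneg zero_le_two (abs_nonneg _))
    simp only [Function.comp_apply, Pi.add_apply]
    rw [abs_of_nonneg (le_max_left _ _)]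
    refine le_trans (max_le ?_ ?_) (le_abs_self _)
    · positivity
    · linarith
  · have := le_max_right 0 (A.winProb l - 1 / ((t l : ℝ) + 1))
    linarith

end Game

end PRIMac

theorem mainTheorem10 :
    ∃ C : ℝ, 0 < C ∧
      ∀ (𝒢 : PRIMac.GateSet) (n m : ℕ → ℕ), PRIMac.PolyBounded n → PRIMac.PolyBounded m →
        PRIMac.Negligible (fun l => (1 / 2 : ℝ) ^ n l) →
        ∀ (F : PRIMac.KeyedAlg 𝒢 n fun l => n l + m l)
          (Inv : PRIMac.KeyedAlg 𝒢 (fun l => n l + m l) n),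
          PRIMac.IsStrongInvertiblePRI F Inv →
          ∀ t : ℕ → ℕ, PRIMac.PolyBounded t →
            (∀ A : PRIMac.Forger (PRIMac.priMAC F Inv) t,
              ∃ ε : ℕ → ℝ, PRIMac.Negligible ε ∧
                ∀ l, A.winProb l ≤ 1 / ((t l : ℝ) + 1) + ε l) ∧
            ((∀ l, 1 ≤ t l) →
              PRIMac.PermTestUnforgeable (PRIMac.priMAC F Inv) t fun l => C / (t l : ℝ)) := by
  refine ⟨2, two_pos, fun 𝒢 n m hn _ hneg F Inv h t ht =>
    ⟨fun A => A.exists_negligible hn hneg h, fun ht1 A => ?_⟩⟩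
  obtain ⟨ε, hε, hwin⟩ := A.exists_negligible hn hneg h
  have hlim := (hε.polyBounded_mul ht).tendsto_zero
  filter_upwards [hlim.eventually_lt_const one_pos] with l hl
  have hpos : (0 : ℝ) < t l := by exact_mod_cast ht1 l
  refine (hwin l).trans ?_
  have h1 : 1 / ((t l : ℝ) + 1) ≤ 1 / t l := one_div_le_one_div_of_le hpos (by linarith)
  have h2 : ε l ≤ 1 / t l := by
    rw [le_div_iff₀ hpos, mul_comm]; exact hl.le
  have h3 : (2 : ℝ) / t l = 1 / t l + 1 / t l := by ring
  rw [h3]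
  exact add_le_add h1 h2
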